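/- **Setting.** Let $n\ge 2$, $T>0$, let $A\in\mathbb R^{n\times 2n}$ be in reduced row-echelon form with $n$ pivots (rank $n$), let $a=\pm i$ if $n$ is odd and $a=e^{i\theta}$ with $\theta\in[-\pi/2,\pi/2]$ if $n$ is even, let $h=(h_1,\dots,h_n)\in (C^\infty[0,T])^n$ and $q_0\in C^\infty[0,1]$ be complex-valued with $A\,(q_0^{(n-1)}(0),q_0^{(n-1)}(1),\dots,q_0(0),q_0(1))^{\mathsf T}=h(0)$. The problem $\Pi(n,A,a,h,q_0)$ is to find $q\in C^\infty([0,1]\times[0,T])$ with $$\partial_t q+a(-i\partial_x)^n q=0,\qquad q(x,0)=q_0(x),\qquad A\,(\partial_x^{n-1}q(0,t),\partial_x^{n-1}q(1,t),\dots,q(0,t),q(1,t))^{\mathsf T}=h(t).$$ It is *well-posed* if it has exactly one solution $q$. **Notation.** Write $\omega=e^{2\pi i/n}$, $\hat f(\rho)=\int_0^1 e^{-i\rho y}f(y)\,dy$, $q_T=q(\cdot,T)$, $\widetilde X(\rho)=\int_0^T e^{a\rho^n t}X(t)\,dt$ and $c_j(\rho)=-a\rho^n(i\rho)^{-(j+1)}$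 for $0\le j\le n-1$. The $k$-th row of $A$ is $(\alpha_{k\,n-1},\beta_{k\,n-1},\dots,\alpha_{k\,0},\beta_{k\,0})$. Let $\widehat J^+$ (resp. $\widehat J^-$) be the set of $j$ such that $\alpha_{kj}$ (resp. $\beta_{kj}$) is a pivot for some $k$, this $k$ being denoted $\widehat J^+_j$ (resp. $\widehat J^-_j$). Let $J'=\{2j+1:j\in\widehat J^+\}\cup\{2j:j\in\widehat J^-\}$ and $J=\{0,\dots,2n-1\}\setminus J'$, enumerated decreasingly as $(J'_j)_{j=1}^n$ and $(J_j)_{j=1}^n$. For an integer $l\in\{0,\dots,2n-1\}$ put $[l]=\lfloor l/2\rfloor$, and put $\gamma_{k,l}=\alpha_{k\,[l]}$ for $l$ odd, $\gamma_{k,l}=\beta_{k\,[l]}$ for $l$ even; let $\widehat A_{kj}=\gamma_{k,J_j}$. The characteristic matrix $\mathcal A(\rho)$ is the $n\times n$ matrix with entries $$\mathcal A_{kj}(\rho)=p_{kj}(\rho)-\sum_{r\in\widehat J^+}\gamma_{\widehat J^+_r,J_j}\,\omega^{(n-1-r)(k-1)}c_r(\rho)+e^{-i\omega^{k-1}\rho}\sum_{r\in\widehat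 J^-}\gamma_{\widehat J^-_r,J_j}\,\omega^{(n-1-r)(k-1)}c_r(\rho),$$ where $p_{kj}=\omega^{(n-1-[J_j])(k-1)}c_{[J_j]}(\rho)$ if $J_j$ is odd and $p_{kj}=-e^{-i\omega^{k-1}\rho}\omega^{(n-1-[J_j])(k-1)}c_{[J_j]}(\rho)$ if $J_j$ is even; $\Delta_P=\det\mathcal A$. Let $U(\rho)$ be the vector with entries $$u(\rho,k)=\hat q_0(\omega^{k-1}\rho)-\sum_{l\in\widehat J^+}c_l(\omega^{k-1}\rho)\,\widetilde h_{\widehat J^+_l}(\rho)+e^{-i\omega^{k-1}\rho}\sum_{l\in\widehat J^-}c_l(\omega^{k-1}\rho)\,\widetilde h_{\widehat J^-_l}(\rho),\quad 1\le k\le n.$$ For $1\le j\le n$ let $\widehat\zeta_j$ (resp. $\widehat\eta_j$) be the determinant of $\mathcal A(\rho)$ with its $j$-th column replaced by $U(\rho)$ (resp. by $(\hat q_T(\omega^{k-1}\rho))_{k=1}^n$), and for $n<j\le 2n$ let $$\widehat\zeta_j=\Delta_P\,\widetilde h_{j-n}-\sum_{k=1}^n\widehat A_{j-n\,k}\,\widehat\zeta_k,\qquad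 \widehat\eta_j=-\sum_{k=1}^n\widehat A_{j-n\,k}\,\widehat\eta_k .$$ With $L_j=J_j$ for $j\le n$ and $L_j=J'_{j-n}$ for $j>n$, put $\zeta_j=c_{[L_j]}\widehat\zeta_j$, $\eta_j=c_{[L_j]}\widehat\eta_j$, $J^+=\{j:L_j\text{ odd}\}$, $J^-=\{j:L_j\text{ even}\}$. Finally $D=\{\rho\in\mathbb C:\operatorname{Re}(a\rho^n)<0\}$ and $D^\pm=D\cap\mathbb C^\pm$, which are unions of open sectors; $\partial D^\pm$ is positively oriented. **Theorem.** Let $\Pi(n,A,a,h,q_0)$ be well-posed with solution $q$. Then $\Delta_P$ is not identically zero, and for every $(x,t)\in[0,1]\times[0,T]$ other than the four corners, $$2\pi q(x,t)=\int_{\mathbb R}e^{i\rho x-a\rho^n t}\hat q_0(\rho)\,d\rho-\int_{\partial D^+}e^{i\rho x-a\rho^n t}\sum_{j\in J^+}\frac{\zeta_j(\rho)-e^{a\rho^nT}\eta_j(\rho)}{\Delta_P(\rho)}\,d\rho-\int_{\partial D^-}e^{i\rho(x-1)-a\rho^n t}\sum_{j\in J^-}\frac{\zeta_j(\rho)-e^{a\rho^nT}\eta_j(\rho)}{\Delta_P(\rho)}\,d\rho,$$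 where all integrals converge as improper integrals along each ray from $0$ to $\infty$ of the contours (the integrands being locally integrable there). -/

import Mathlib

open scoped ContDiff Topology

noncomputable section

/-- The column `(f (n-1), g (n-1), f (n-2), g (n-2), …, f 0, g 0)ᵀ`. -/
def boundaryVector {n : ℕ} (f g : Fin n → ℂ) : Fin (2 * n) → ℂ := fun c =>
  if (c : ℕ) % 2 = 0 then f (Fin.rev ⟨c / 2, by omega⟩) else g (Fin.rev ⟨c / 2, by omega⟩)

/-- The data `(n, A, a, h, q₀)` of the initial-boundary value problem on `[0,1] × [0,T]`. Rows of
`A` and entries of `h` are indexed by `Fin n`, so `k : Fin n` is the index `k + 1` of `{1, …, n}`. -/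
structure IBVP (n : ℕ) where
  /-- boundary coefficient matrix -/
  A : Matrix (Fin n) (Fin (2 * n)) ℝ
  /-- direction coefficient -/
  a : ℂ
  /-- final time -/
  T : ℝ
  /-- boundary data -/
  h : Fin n → ℝ → ℂ
  /-- initial datum -/
  q₀ : ℝ → ℂ
  two_le : 2 ≤ n
  rref : A.IsReducedRowEchelon
  rank_eq : A.rank = n
  a_odd : Odd n → a = Complex.I ∨ a = -Complex.I
  a_even : Even n → ∃ θ ∈ Set.Icc (-(Real.pi / 2)) (Real.pi / 2), a = Complex.exp (θ * Complex.I)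
  T_pos : 0 < T
  h_smooth : ∀ k, ContDiffOn ℝ ∞ (h k) (Set.Icc 0 T)
  q₀_smooth : ContDiffOn ℝ ∞ q₀ (Set.Icc 0 1)
  compatible : (A.map Complex.ofReal).mulVec
      (boundaryVector (fun j => iteratedDerivWithin j q₀ (Set.Icc 0 1) 0)
        (fun j => iteratedDerivWithin j q₀ (Set.Icc 0 1) 1)) = fun k => h k 0

namespace IBVP

/-! ### Solutions and well-posedness -/

/-- `∂_x^j q (x, t)`, one-sided at the ends of `[0,1]`. -/
def dx (j : ℕ) (q : ℝ → ℝ → ℂ) (x t : ℝ) : ℂ :=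
  iteratedDerivWithin j (fun y => q y t) (Set.Icc 0 1) x

/-- `q ∈ C^∞([0,1] × [0,T])` solves `∂_t q + a (-i ∂_x)^n q = 0` with the initial condition
`q(x,0) = q₀(x)` and the boundary conditions `A (∂_x^{n-1} q(0,t), ∂_x^{n-1} q(1,t), …)ᵀ = h(t)`. -/
structure IsSolution {n : ℕ} (P : IBVP n) (q : ℝ → ℝ → ℂ) : Prop where
  smooth : ContDiffOn ℝ ∞ (fun p : ℝ × ℝ => q p.1 p.2) (Set.Icc 0 1 ×ˢ Set.Icc 0 P.T)
  pde : ∀ x ∈ Set.Icc (0 : ℝ) 1, ∀ t ∈ Set.Icc 0 P.T,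
    derivWithin (fun s => q x s) (Set.Icc 0 P.T) t + P.a * ((-Complex.I) ^ n * dx n q x t) = 0
  initial : ∀ x ∈ Set.Icc (0 : ℝ) 1, q x 0 = P.q₀ x
  boundary : ∀ t ∈ Set.Icc 0 P.T, (P.A.map Complex.ofReal).mulVec
      (boundaryVector (fun j => dx j q 0 t) (fun j => dx j q 1 t)) = fun k => P.h k t

/-- The problem admits a unique smooth solution on `[0,1] × [0,T]`. -/
def WellPosed {n : ℕ} (P : IBVP n) : Prop :=
  (∃ q, P.IsSolution q) ∧ ∀ q q', P.IsSolution q → P.IsSolution q' →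
    ∀ x ∈ Set.Icc (0 : ℝ) 1, ∀ t ∈ Set.Icc 0 P.T, q x t = q' x t

/-! ### Transforms -/

/-- The Fourier transform `∫₀¹ e^{-iρy} f(y) dy`. -/
def fourierTransform (f : ℝ → ℂ) (ρ : ℂ) : ℂ :=
  ∫ y in (0 : ℝ)..1, Complex.exp (-Complex.I * ρ * y) * f y

/-- The `t`-transform `∫₀ᵀ e^{aρⁿt} X(t) dt`. -/
def tTransform {n : ℕ} (P : IBVP n) (X : ℝ → ℂ) (ρ : ℂ) : ℂ :=
  ∫ t in (0 : ℝ)..P.T, Complex.exp (P.a * ρ ^ n * t) * X t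

/-- `c_j(ρ) = -aρⁿ(iρ)^{-(j+1)}`, written as the monomial `-a i^{-(j+1)} ρ^{n-(j+1)}` so that the
value at `ρ = 0` is the right one. -/
def c {n : ℕ} (P : IBVP n) (j : Fin n) (ρ : ℂ) : ℂ :=
  -P.a * (Complex.I ^ ((j : ℕ) + 1))⁻¹ * ρ ^ (n - ((j : ℕ) + 1))

/-- `ω = e^{2πi/n}`. -/
def omega (n : ℕ) : ℂ := Complex.exp (2 * Real.pi * Complex.I / n)

/-! ### Boundary coefficients and index sets -/

/-- The column of `A` that multiplies `∂_x^j q(0,t)`. -/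
def colLeft {n : ℕ} (j : Fin n) : Fin (2 * n) := ⟨2 * (Fin.rev j : ℕ), by omega⟩

/-- The column of `A` that multiplies `∂_x^j q(1,t)`. -/
def colRight {n : ℕ} (j : Fin n) : Fin (2 * n) := ⟨2 * (Fin.rev j : ℕ) + 1, by omega⟩

/-- The boundary coefficient `α_{k j}`. -/
def α {n : ℕ} (P : IBVP n) (k j : Fin n) : ℝ := P.A k (colLeft j)

/-- The boundary coefficient `β_{k j}`. -/
def β {n : ℕ} (P : IBVP n) (k j : Fin n) : ℝ := P.A k (colRight j)

open Classical in
/-- `Ĵ⁺`: the `j` such that `α_{k j}` is a pivot of `A` for some `k`. -/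
def JhatPlus {n : ℕ} (P : IBVP n) : Finset (Fin n) :=
  {j | ∃ k, P.A.IsLeadingEntry k (colLeft j)}

open Classical in
/-- `Ĵ⁻`: the `j` such that `β_{k j}` is a pivot of `A` for some `k`. -/
def JhatMinus {n : ℕ} (P : IBVP n) : Finset (Fin n) :=
  {j | ∃ k, P.A.IsLeadingEntry k (colRight j)}

theorem exists_pivot_of_mem_JhatPlus {n : ℕ} (P : IBVP n) (j : P.JhatPlus) :
    ∃ k, P.A.IsLeadingEntry k (colLeft j.1) := by
  classical
  exact (Finset.mem_filter.1 (show j.1 ∈ Finset.filter _ _ from j.2)).2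

theorem exists_pivot_of_mem_JhatMinus {n : ℕ} (P : IBVP n) (j : P.JhatMinus) :
    ∃ k, P.A.IsLeadingEntry k (colRight j.1) := by
  classical
  exact (Finset.mem_filter.1 (show j.1 ∈ Finset.filter _ _ from j.2)).2

/-- `Ĵ⁺_j`: the row `k` such that `α_{k j}` is a pivot, for `j ∈ Ĵ⁺`. -/
def rowPlus {n : ℕ} (P : IBVP n) (j : P.JhatPlus) : Fin n :=
  (P.exists_pivot_of_mem_JhatPlus j).choose

/-- `Ĵ⁻_j`: the row `k` such that `β_{k j}` is a pivot, for `j ∈ Ĵ⁻`. -/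
def rowMinus {n : ℕ} (P : IBVP n) (j : P.JhatMinus) : Fin n :=
  (P.exists_pivot_of_mem_JhatMinus j).choose

/-- The label `2j+1` of the boundary function `∂_x^j q(0,·)`. -/
def labelLeft {n : ℕ} (j : Fin n) : Fin (2 * n) := ⟨2 * j + 1, by omega⟩

/-- The label `2j` of the boundary function `∂_x^j q(1,·)`. -/
def labelRight {n : ℕ} (j : Fin n) : Fin (2 * n) := ⟨2 * j, by omega⟩

/-- The order `j` of the boundary function with label `l = 2j+1` or `l = 2j`. -/
def ord {n : ℕ} (l : Fin (2 * n)) : Fin n := ⟨(l : ℕ) / 2, by omega⟩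

/-- `J'`, the labels of the boundary functions whose columns in `A` contain a pivot. -/
def J' {n : ℕ} (P : IBVP n) : Finset (Fin (2 * n)) :=
  P.JhatPlus.image labelLeft ∪ P.JhatMinus.image labelRight

/-- `J`, the labels of the boundary functions whose columns in `A` do not contain a pivot. -/
def J {n : ℕ} (P : IBVP n) : Finset (Fin (2 * n)) :=
  (P.JhatPlus)ᶜ.image labelLeft ∪ (P.JhatMinus)ᶜ.image labelRight

theorem mem_J' {n : ℕ} (P : IBVP n) (l : Fin (2 * n)) :
    l ∈ P.J' ↔ ∃ k, P.A.IsLeadingEntry k (Fin.rev l) := by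
  classical
  simp only [J', JhatPlus, JhatMinus, Finset.mem_union, Finset.mem_image, Finset.mem_filter,
    Finset.mem_univ, true_and]
  constructor
  · rintro (⟨j, ⟨k, hk⟩, rfl⟩ | ⟨j, ⟨k, hk⟩, rfl⟩)
    · refine ⟨k, ?_⟩
      rwa [show Fin.rev (labelLeft j) = colLeft j by
        ext; simp [labelLeft, colLeft, Fin.val_rev]; omega]
    · refine ⟨k, ?_⟩
      rwa [show Fin.rev (labelRight j) = colRight j by
        ext; simp [labelRight, colRight, Fin.val_rev]; omega]
  · rintro ⟨k, hk⟩
    rcases Nat.even_or_odd' (l : ℕ) with ⟨i, hi | hi⟩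
    · right
      refine ⟨ord l, ⟨k, ?_⟩, by ext; simp [labelRight, ord]; omega⟩
      rwa [show colRight (ord l) = Fin.rev l by
        ext; simp [ord, colRight, Fin.val_rev]; omega]
    · left
      refine ⟨ord l, ⟨k, ?_⟩, by ext; simp [labelLeft, ord]; omega⟩
      rwa [show colLeft (ord l) = Fin.rev l by
        ext; simp [ord, colLeft, Fin.val_rev]; omega]

theorem J_eq_compl {n : ℕ} (P : IBVP n) : P.J = P.J'ᶜ := by
  classical
  ext l
  simp only [J, J', Finset.mem_union, Finset.mem_image, Finset.mem_compl]
  rcases Nat.even_or_odd' (l : ℕ) with ⟨i, hi | hi⟩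
  · have h1 : ∀ j : Fin n, labelRight j = l ↔ j = ord l := fun j => by
      simp only [Fin.ext_iff, labelRight, ord]; omega
    have h2 : ∀ j : Fin n, labelLeft j ≠ l := fun j => by
      simp only [ne_eq, Fin.ext_iff, labelLeft]; omega
    simp [h1, h2]
  · have h1 : ∀ j : Fin n, labelLeft j = l ↔ j = ord l := fun j => by
      simp only [Fin.ext_iff, labelLeft, ord]; omega
    have h2 : ∀ j : Fin n, labelRight j ≠ l := fun j => by
      simp only [ne_eq, Fin.ext_iff, labelRight]; omega
    simp [h1, h2]

theorem card_J' {n : ℕ} (P : IBVP n) : P.J'.card = n := by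
  classical
  have hrow : ∀ k, ∃ c, P.A.IsLeadingEntry k c := fun k => by
    rw [← Matrix.row_ne_zero_iff_exists_isLeadingEntry]
    have hli : LinearIndependent ℝ P.A.row := by
      rw [linearIndependent_iff_card_eq_finrank_span, Set.finrank,
        ← Matrix.rank_eq_finrank_span_row, P.rank_eq, Fintype.card_fin]
    exact hli.ne_zero k
  choose p hp using hrow
  have hinj : Function.Injective fun k => Fin.rev (p k) := fun k₁ k₂ h => by
    have h' : p k₁ = p k₂ := Fin.rev_injective h
    by_contra hne
    exact (hp k₁).2 (P.rref.eq_zero_of_ne_of_isLeadingEntry hne (h' ▸ hp k₂))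
  have : P.J' = Finset.univ.image fun k => Fin.rev (p k) := by
    ext l
    rw [mem_J']
    simp only [Finset.mem_image, Finset.mem_univ, true_and]
    refine exists_congr fun k => ⟨fun h => ?_, fun h => ?_⟩
    · rw [(hp k).unique h, Fin.rev_rev]
    · rw [← h, Fin.rev_rev]
      exact hp k
  rw [this, Finset.card_image_of_injective _ hinj, Finset.card_univ, Fintype.card_fin]

theorem card_J {n : ℕ} (P : IBVP n) : P.J.card = n := by
  rw [J_eq_compl, Finset.card_compl, card_J', Fintype.card_fin]
  omega

/-- The decreasing sequence `J_1 > J_2 > … > J_n` of the elements of `J`. -/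
def Jseq {n : ℕ} (P : IBVP n) (j : Fin n) : Fin (2 * n) := P.J.orderEmbOfFin P.card_J (Fin.rev j)

/-- The decreasing sequence `J'_1 > J'_2 > … > J'_n` of the elements of `J'`. -/
def J'seq {n : ℕ} (P : IBVP n) (j : Fin n) : Fin (2 * n) :=
  P.J'.orderEmbOfFin P.card_J' (Fin.rev j)

/-- The reduced boundary coefficient matrix `Â`. -/
def Ahat {n : ℕ} (P : IBVP n) (k j : Fin n) : ℝ :=
  if Odd (P.Jseq j : ℕ) then P.α k (ord (P.Jseq j)) else P.β k (ord (P.Jseq j))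

/-! ### The characteristic matrix and Cramer's rule -/

/-- The PDE characteristic matrix. Row `k : Fin n` is row `k + 1` of the usual indexing, and
`c_m(ρ) (iρ)^{m-r}` has been written as the equal monomial `c_r(ρ)`. -/
def charMatrix {n : ℕ} (P : IBVP n) (ρ : ℂ) : Matrix (Fin n) (Fin n) ℂ := fun k j =>
  let m : Fin n := ord (P.Jseq j)
  let w : Fin n → ℂ := fun r => omega n ^ ((n - 1 - (r : ℕ)) * (k : ℕ))
  let e : ℂ := Complex.exp (-Complex.I * omega n ^ (k : ℕ) * ρ)
  if Odd (P.Jseq j : ℕ) then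
    P.c m ρ * w m
      - ∑ r : P.JhatPlus, P.α (P.rowPlus r) m * w r * P.c r ρ
      + e * ∑ r : P.JhatMinus, P.α (P.rowMinus r) m * w r * P.c r ρ
  else
    -P.c m ρ * w m * e
      - ∑ r : P.JhatPlus, P.β (P.rowPlus r) m * w r * P.c r ρ
      + e * ∑ r : P.JhatMinus, P.β (P.rowMinus r) m * w r * P.c r ρ

/-- The PDE characteristic determinant `Δ_P`. -/
def DeltaP {n : ℕ} (P : IBVP n) (ρ : ℂ) : ℂ := (P.charMatrix ρ).det

/-- The vector `U(ρ)`, with entries `u(ρ,k)`. -/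
def U {n : ℕ} (P : IBVP n) (ρ : ℂ) : Fin n → ℂ := fun k =>
  fourierTransform P.q₀ (omega n ^ (k : ℕ) * ρ)
    - ∑ l : P.JhatPlus, P.c l (omega n ^ (k : ℕ) * ρ) * P.tTransform (P.h (P.rowPlus l)) ρ
    + Complex.exp (-Complex.I * omega n ^ (k : ℕ) * ρ) *
      ∑ l : P.JhatMinus, P.c l (omega n ^ (k : ℕ) * ρ) * P.tTransform (P.h (P.rowMinus l)) ρ

/-- The vector `(q̂_T(ρ), q̂_T(ωρ), …, q̂_T(ω^{n-1}ρ))`, with `q̂_T` the Fourier transform of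
`q(·,T)`. -/
def UT {n : ℕ} (P : IBVP n) (q : ℝ → ℝ → ℂ) (ρ : ℂ) : Fin n → ℂ := fun k =>
  fourierTransform (fun x => q x P.T) (omega n ^ (k : ℕ) * ρ)

/-- `ζ̂_j`. The index `j ∈ {1, …, 2n}` is `Sum.inl j` for `j ≤ n` and `Sum.inr (j - n)` for
`j > n`. -/
def zetaHat {n : ℕ} (P : IBVP n) (ρ : ℂ) : Fin n ⊕ Fin n → ℂ
  | Sum.inl j => ((P.charMatrix ρ).updateCol j (P.U ρ)).det
  | Sum.inr j => P.DeltaP ρ * P.tTransform (P.h j) ρ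
      - ∑ k, P.Ahat j k * ((P.charMatrix ρ).updateCol k (P.U ρ)).det

/-- `η̂_j`, indexed as `ζ̂_j`. -/
def etaHat {n : ℕ} (P : IBVP n) (q : ℝ → ℝ → ℂ) (ρ : ℂ) : Fin n ⊕ Fin n → ℂ
  | Sum.inl j => ((P.charMatrix ρ).updateCol j (P.UT q ρ)).det
  | Sum.inr j => -∑ k, P.Ahat j k * ((P.charMatrix ρ).updateCol k (P.UT q ρ)).det

/-- The label `J_j` for `j ≤ n`, and `J'_{j-n}` for `j > n`. -/
def label {n : ℕ} (P : IBVP n) : Fin n ⊕ Fin n → Fin (2 * n)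
  | Sum.inl j => P.Jseq j
  | Sum.inr j => P.J'seq j

/-- `ζ_j`. -/
def zeta {n : ℕ} (P : IBVP n) (j : Fin n ⊕ Fin n) (ρ : ℂ) : ℂ :=
  P.c (ord (P.label j)) ρ * P.zetaHat ρ j

/-- `η_j`. -/
def eta {n : ℕ} (P : IBVP n) (q : ℝ → ℝ → ℂ) (j : Fin n ⊕ Fin n) (ρ : ℂ) : ℂ :=
  P.c (ord (P.label j)) ρ * P.etaHat q ρ j

/-- `J⁺`. -/
def JPlus {n : ℕ} (P : IBVP n) : Finset (Fin n ⊕ Fin n) := {j | Odd (P.label j : ℕ)}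

/-- `J⁻`. -/
def JMinus {n : ℕ} (P : IBVP n) : Finset (Fin n ⊕ Fin n) := {j | Even (P.label j : ℕ)}

/-! ### Contours -/

/-- `D = {ρ : Re(aρⁿ) < 0}`. -/
def D {n : ℕ} (P : IBVP n) : Set ℂ := {ρ | (P.a * ρ ^ n).re < 0}

/-- `D⁺ = D ∩ ℂ⁺`. -/
def DPlus {n : ℕ} (P : IBVP n) : Set ℂ := P.D ∩ {ρ | 0 < ρ.im}

/-- `D⁻ = D ∩ ℂ⁻`. -/
def DMinus {n : ℕ} (P : IBVP n) : Set ℂ := P.D ∩ {ρ | ρ.im < 0}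

/-- The angle of the initial ray of the `m`-th component sector of `D`. -/
def startAngle {n : ℕ} (P : IBVP n) (m : Fin n) : ℝ :=
  (Real.pi / 2 - P.a.arg + 2 * Real.pi * (m : ℕ)) / n

/-- The angle of the final ray of the `m`-th component sector of `D`. -/
def endAngle {n : ℕ} (P : IBVP n) (m : Fin n) : ℝ :=
  (3 * Real.pi / 2 - P.a.arg + 2 * Real.pi * (m : ℕ)) / n

/-- The `m`-th component sector of `D`. -/
def sector {n : ℕ} (P : IBVP n) (m : Fin n) : Set ℂ :=
  {ρ | ∃ r φ : ℝ, 0 < r ∧ P.startAngle m < φ ∧ φ < P.endAngle m ∧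
    ρ = r * Complex.exp (φ * Complex.I)}

/-- The improper integral of `f` along the ray from `0` to `∞` at angle `φ` converges, to `L`. -/
def HasRayIntegral (f : ℂ → ℂ) (φ : ℝ) (L : ℂ) : Prop :=
  let F : ℝ → ℂ := fun r => f (r * Complex.exp (φ * Complex.I)) * Complex.exp (φ * Complex.I)
  (∀ R, 0 ≤ R → IntervalIntegrable F MeasureTheory.volume 0 R) ∧
    Filter.Tendsto (fun R => ∫ r in (0 : ℝ)..R, F r) Filter.atTop (𝓝 L)

/-- The improper integral of `f` along `ℝ` (from `-∞` to `∞`) converges, to `L`. -/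
def HasLineIntegral (f : ℂ → ℂ) (L : ℂ) : Prop :=
  ∃ L₁ L₂, HasRayIntegral f 0 L₁ ∧ HasRayIntegral f Real.pi L₂ ∧ L = L₁ - L₂

open Classical in
/-- The improper contour integral of `f` along the positively oriented boundary of `Ω` converges,
to `L`, where `Ω` is the union of those component sectors of `D` that it contains (as are `D⁺` and
`D⁻`, see `DPlus_eq` and `DMinus_eq`): the boundary of each such sector is traversed inwards along
the final ray and outwards along the initial ray, so that the sector lies to the left. -/
def HasBoundaryIntegral {n : ℕ} (P : IBVP n) (Ω : Set ℂ) (f : ℂ → ℂ) (L : ℂ) : Prop :=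
  ∃ L₁ L₂ : Fin n → ℂ,
    (∀ m, P.sector m ⊆ Ω → HasRayIntegral f (P.startAngle m) (L₁ m) ∧
      HasRayIntegral f (P.endAngle m) (L₂ m)) ∧
    L = ∑ m with P.sector m ⊆ Ω, (L₁ m - L₂ m)

theorem a_eq {n : ℕ} (P : IBVP n) :
    P.a = Complex.exp (P.a.arg * Complex.I) ∧ |P.a.arg| ≤ Real.pi / 2 ∧
      0 ≤ Real.cos (P.a.arg + n * Real.pi) := by
  rcases Nat.even_or_odd n with hn | hn
  · obtain ⟨θ, hθ, ha⟩ := P.a_even hn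
    have harg : P.a.arg = θ := by
      rw [ha, Complex.arg_exp_mul_I, toIocMod_eq_self]
      constructor <;> linarith [hθ.1, hθ.2, Real.pi_pos]
    obtain ⟨m, rfl⟩ := hn
    refine ⟨by rw [harg, ha], by rw [harg]; exact abs_le.2 hθ, ?_⟩
    rw [harg, show θ + ((m + m : ℕ) : ℝ) * Real.pi = θ + m * (2 * Real.pi) by push_cast; ring,
      Real.cos_add_nat_mul_two_pi]
    exact Real.cos_nonneg_of_mem_Icc hθ
  · obtain ⟨m, rfl⟩ := hn
    have key : ∀ θ : ℝ, Real.cos θ = 0 →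
        0 ≤ Real.cos (θ + ((2 * m + 1 : ℕ) : ℝ) * Real.pi) := fun θ h => by
      rw [show θ + ((2 * m + 1 : ℕ) : ℝ) * Real.pi = θ + Real.pi + m * (2 * Real.pi) by
        push_cast; ring, Real.cos_add_nat_mul_two_pi, Real.cos_add_pi, h, neg_zero]
    have hpi := Real.pi_pos
    rcases P.a_odd ⟨m, rfl⟩ with ha | ha
    · rw [ha, Complex.arg_I]
      refine ⟨?_, by rw [abs_of_pos (by positivity)], key _ Real.cos_pi_div_two⟩
      push_cast
      exact Complex.exp_pi_div_two_mul_I.symm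
    · rw [ha, Complex.arg_neg_I]
      refine ⟨?_, by rw [abs_neg, abs_of_pos (by positivity)], key _ (by simp)⟩
      push_cast
      rw [← neg_div]
      exact Complex.exp_neg_pi_div_two_mul_I.symm

theorem re_polar {n : ℕ} (P : IBVP n) (r φ : ℝ) :
    (P.a * (r * Complex.exp (φ * Complex.I)) ^ n).re = r ^ n * Real.cos (P.a.arg + n * φ) := by
  have : P.a * (r * Complex.exp (φ * Complex.I)) ^ n =
      ((r ^ n : ℝ) : ℂ) * Complex.exp (((P.a.arg + n * φ : ℝ) : ℂ) * Complex.I) := by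
    conv_lhs => rw [P.a_eq.1]
    rw [mul_pow, ← Complex.exp_nat_mul]
    push_cast
    rw [add_mul, Complex.exp_add]
    ring_nf
  rw [this, Complex.re_ofReal_mul, Complex.exp_ofReal_mul_I_re]

theorem cos_neg_of_mem {n : ℕ} (P : IBVP n) (m : Fin n) (φ : ℝ) (h₁ : P.startAngle m < φ)
    (h₂ : φ < P.endAngle m) : Real.cos (P.a.arg + n * φ) < 0 := by
  have hn : (0 : ℝ) < n := by exact_mod_cast (by have := P.two_le; omega : 0 < n)
  rw [startAngle, div_lt_iff₀ hn] at h₁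
  rw [endAngle, lt_div_iff₀ hn] at h₂
  rw [← Real.cos_sub_nat_mul_two_pi _ m]
  apply Real.cos_neg_of_pi_div_two_lt_of_lt <;> nlinarith

theorem sector_subset {n : ℕ} (P : IBVP n) (m : Fin n) :
    P.sector m ⊆ P.DPlus ∨ P.sector m ⊆ P.DMinus := by
  have hpi := Real.pi_pos
  have hn : (0 : ℝ) < n := by exact_mod_cast (by have := P.two_le; omega : 0 < n)
  obtain ⟨-, ha, hc⟩ := P.a_eq
  rw [abs_le] at ha
  have hm : ((m : ℕ) : ℝ) + 1 ≤ n := by exact_mod_cast m.2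
  have h0 : 0 ≤ P.startAngle m := by
    rw [startAngle]
    refine div_nonneg ?_ hn.le
    have : 0 ≤ 2 * Real.pi * ((m : ℕ) : ℝ) := by positivity
    linarith
  have h1 : P.endAngle m ≤ 2 * Real.pi := by
    rw [endAngle, div_le_iff₀ hn]
    nlinarith
  have him : ∀ r φ : ℝ, ((r : ℂ) * Complex.exp (φ * Complex.I)).im = r * Real.sin φ := by
    intro r φ
    rw [Complex.im_ofReal_mul, Complex.exp_ofReal_mul_I_im]
  have hD : ∀ r φ : ℝ, 0 < r → P.startAngle m < φ → φ < P.endAngle m →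
      (r : ℂ) * Complex.exp (φ * Complex.I) ∈ P.D := fun r φ hr hs he => by
    change (P.a * (r * Complex.exp (φ * Complex.I)) ^ n).re < 0
    rw [re_polar]
    exact mul_neg_of_pos_of_neg (by positivity) (P.cos_neg_of_mem m φ hs he)
  have hπ : P.endAngle m ≤ Real.pi ∨ Real.pi ≤ P.startAngle m := by
    by_contra! h
    exact absurd (P.cos_neg_of_mem m Real.pi h.2 h.1) (not_lt.2 hc)
  rcases hπ with h | h
  · left
    rintro _ ⟨r, φ, hr, hs, he, rfl⟩
    refine ⟨hD r φ hr hs he, ?_⟩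
    change 0 < ((r : ℂ) * Complex.exp (φ * Complex.I)).im
    rw [him]
    exact mul_pos hr (Real.sin_pos_of_pos_of_lt_pi (by linarith) (by linarith))
  · right
    rintro _ ⟨r, φ, hr, hs, he, rfl⟩
    refine ⟨hD r φ hr hs he, ?_⟩
    change ((r : ℂ) * Complex.exp (φ * Complex.I)).im < 0
    rw [him, ← Real.sin_sub_two_pi]
    exact mul_neg_of_pos_of_neg hr (Real.sin_neg_of_neg_of_neg_pi_lt (by linarith) (by linarith))

theorem exists_sector {n : ℕ} (P : IBVP n) (ρ : ℂ) (hρ : ρ ∈ P.D) : ∃ m, ρ ∈ P.sector m := by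
  have hpi := Real.pi_pos
  have hn0 : 0 < n := by have := P.two_le; omega
  have hn : (0 : ℝ) < n := by exact_mod_cast hn0
  obtain ⟨-, ha, -⟩ := P.a_eq
  rw [abs_le] at ha
  have hne : ρ ≠ 0 := by
    rintro rfl
    have : (P.a * 0 ^ n).re < 0 := hρ
    simp [zero_pow hn0.ne'] at this
  obtain ⟨φ, h0, h1, hφ⟩ : ∃ φ : ℝ, 0 ≤ φ ∧ φ < 2 * Real.pi ∧
      ρ = ‖ρ‖ * Complex.exp (φ * Complex.I) := by
    have h := Complex.norm_mul_exp_arg_mul_I ρ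
    rcases le_or_gt 0 ρ.arg with h' | h'
    · exact ⟨ρ.arg, h', by linarith [Complex.arg_le_pi ρ], h.symm⟩
    · refine ⟨ρ.arg + 2 * Real.pi, by linarith [Complex.neg_pi_lt_arg ρ], by linarith, ?_⟩
      push_cast
      rw [add_mul, Complex.exp_add, Complex.exp_two_pi_mul_I, mul_one, h]
  have hr : 0 < ‖ρ‖ := norm_pos_iff.2 hne
  have hcos : Real.cos (P.a.arg + n * φ) < 0 := by
    have h : (P.a * ρ ^ n).re < 0 := hρ
    rw [hφ, re_polar] at h
    exact neg_of_mul_neg_right h (by positivity)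
  set ψ := P.a.arg + n * φ with hψ
  have hψ1 : ψ < Real.pi / 2 + 2 * Real.pi * n := by nlinarith
  have hψ0 : Real.pi / 2 < ψ := by
    by_contra! h
    exact absurd (Real.cos_nonneg_of_mem_Icc ⟨by nlinarith, h⟩) (not_le.2 hcos)
  set m := ⌊(ψ - Real.pi / 2) / (2 * Real.pi)⌋₊ with hm
  have hm0 : (m : ℝ) * (2 * Real.pi) ≤ ψ - Real.pi / 2 := by
    rw [← le_div_iff₀ (by positivity)]
    exact Nat.floor_le (div_nonneg (by linarith) (by positivity))
  have hm1 : ψ - Real.pi / 2 < (m + 1) * (2 * Real.pi) := by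
    rw [← div_lt_iff₀ (by positivity)]
    exact Nat.lt_floor_add_one _
  have hmn : m < n := by
    have : (m : ℝ) < n := by
      by_contra! h
      nlinarith
    exact_mod_cast this
  have hcos' : Real.cos (ψ - m * (2 * Real.pi)) < 0 := by
    rwa [Real.cos_sub_nat_mul_two_pi]
  refine ⟨⟨m, hmn⟩, ‖ρ‖, φ, hr, ?_, ?_, hφ⟩
  · rw [startAngle, div_lt_iff₀ hn]
    by_contra! h
    have : ψ - m * (2 * Real.pi) = Real.pi / 2 := by
      apply le_antisymm <;> simp only at h <;> nlinarith
    rw [this, Real.cos_pi_div_two] at hcos'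
    exact lt_irrefl _ hcos'
  · rw [endAngle, lt_div_iff₀ hn]
    by_contra! h
    have h' : 0 ≤ Real.cos (ψ - m * (2 * Real.pi) - 2 * Real.pi) := by
      apply Real.cos_nonneg_of_mem_Icc
      constructor <;> simp only at h <;> nlinarith
    rw [Real.cos_sub_two_pi] at h'
    linarith

theorem DPlus_eq {n : ℕ} (P : IBVP n) :
    P.DPlus = ⋃ m ∈ {m | P.sector m ⊆ P.DPlus}, P.sector m := by
  ext ρ
  simp only [Set.mem_iUnion, exists_prop]
  constructor
  · intro hρ
    obtain ⟨m, hm⟩ := P.exists_sector ρ hρ.1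
    refine ⟨m, ?_, hm⟩
    rcases P.sector_subset m with h | h
    · exact h
    · exact (lt_asymm (show 0 < ρ.im from hρ.2) (h hm).2).elim
  · rintro ⟨m, hm, h⟩
    exact hm h

theorem DMinus_eq {n : ℕ} (P : IBVP n) :
    P.DMinus = ⋃ m ∈ {m | P.sector m ⊆ P.DMinus}, P.sector m := by
  ext ρ
  simp only [Set.mem_iUnion, exists_prop]
  constructor
  · intro hρ
    obtain ⟨m, hm⟩ := P.exists_sector ρ hρ.1
    refine ⟨m, ?_, hm⟩
    rcases P.sector_subset m with h | h
    · exact (lt_asymm (show ρ.im < 0 from hρ.2) (h hm).2).elim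
    · exact h
  · rintro ⟨m, hm, h⟩
    exact hm h

/-- `∑_{j ∈ S} (ζ_j(ρ) - e^{aρⁿT} η_j(ρ)) / Δ_P(ρ)`. -/
def integrandSum {n : ℕ} (P : IBVP n) (q : ℝ → ℝ → ℂ) (S : Finset (Fin n ⊕ Fin n)) (ρ : ℂ) : ℂ :=
  ∑ j ∈ S, (P.zeta j ρ - Complex.exp (P.a * ρ ^ n * P.T) * P.eta q j ρ) / P.DeltaP ρ

end IBVP

end

namespace IBVP

variable {n : ℕ} (P : IBVP n)

/-! The formula. Pairing the equation with e^{-iρx+aρⁿs} over [0,1]×[0,τ] yields the global relation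
(`global_relation`): e^{aρⁿτ} times the Fourier transform of q(·,τ) equals the transform of q₀ minus
weighted time transforms over [0,τ] of the 2n boundary functions. These time transforms depend on ρ
only through ρⁿ, so rotating ρ by powers of ω gives n equations for the same unknowns. Once the
boundary conditions have removed the pivot functions, the system for τ = T is square with matrix
`charMatrix`. Cramer's rule (`zetaHat_sub_etaHat`) then identifies ζ_j − e^{aρⁿT}η_j with Δ_P times
a weighted boundary transform over [0,T]. Off the zeros of Δ_P the quotients in the formula are thus
entire functions, and nothing about those zeros matters except that they are countable.

For x in (0,1), Fourier inversion of q(·,t) is combined with the global relation over [0,t]. After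
multiplication by e^{-aρⁿt} the transforms over [0,t] are O(1/|ρ|) where Re(aρⁿ) ≥ 0, and e^{iρx},
respectively e^{iρ(x-1)}, decays in the upper, respectively lower, half plane. Jordan's lemma
(`tendsto_rayIntegral_sub`) therefore moves the real line to ∂D^±. Inside D the transforms over
[t,T] are the ones under control, so [0,t] may be enlarged to [0,T] (`tendsto_boundary_deformation`,
`tendsto_representation`). Separate convergence of the ray integrals comes from their leading terms
e^{zr+wrⁿ}/r, which are integrated by parts (`norm_integral_exp_div_le`). For 0 < t < T the tails
are uniform in x over [0,1], so both sides are continuous in x and the formula reaches x = 0 and x =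
1 (`exists_representation`).

The determinant. If Δ_P vanished identically, `charMatrix` would have a nonzero kernel vector of
entire functions of exponential type (`exists_isExpType_mulVec_eq_zero`). With aρⁿ = −z, each z
gives a solution e^{zt}φ(x) of the homogeneous equation and boundary conditions. Superposing these
over Re z = 1 with the multiplier exp(−z^{3/4}) gives a smooth solution. The multiplier beats the
growth exp(K|z|^{1/2}) of the kernel vector, and for t ≤ 0 the contour can be pushed to the right,
so the solution vanishes there. Well-posedness then forces it to vanish for all t
(`WellPosed.homDeriv_eq_zero`), and injectivity of the Laplace integral forces the kernel vector to
vanish (`eq_zero_of_boundaryLaplace_eq_zero`), a contradiction. -/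

theorem n_pos (P : IBVP n) : 0 < n := by have := P.two_le; omega

/-! ### The boundary conditions in terms of labels -/

/-- Labels increase with the order of the derivative while the columns of `A` run the other way.
Hence column c carries the boundary function with label 2n−1−c, and `Fin.rev` translates between the
two orders. -/
theorem boundaryVector_apply (b : Fin (2 * n) → ℂ) (c : Fin (2 * n)) :
    boundaryVector (fun j => b (labelLeft j)) (fun j => b (labelRight j)) c = b (Fin.rev c) := by
  unfold boundaryVector
  split_ifs with h
  · refine congrArg b ?_
    ext
    simp [labelLeft, Fin.val_rev]
    omega
  · refine congrArg b ?_
    ext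
    simp [labelRight, Fin.val_rev]
    omega

theorem labelLeft_injective : Function.Injective (labelLeft (n := n)) := fun i j h => by
  simp only [labelLeft, Fin.ext_iff] at h
  ext
  omega

theorem labelRight_injective : Function.Injective (labelRight (n := n)) := fun i j h => by
  simp only [labelRight, Fin.ext_iff] at h
  ext
  omega

theorem labelLeft_ne_labelRight (i j : Fin n) : labelLeft i ≠ labelRight j := fun h => by
  simp only [labelRight, labelLeft, Fin.ext_iff] at h
  omega

theorem rev_labelLeft (j : Fin n) : Fin.rev (labelLeft j) = colLeft j := by
  ext; simp [labelLeft, colLeft, Fin.val_rev]; omega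

theorem rev_labelRight (j : Fin n) : Fin.rev (labelRight j) = colRight j := by
  ext; simp [labelRight, colRight, Fin.val_rev]; omega

theorem ord_labelLeft (j : Fin n) : ord (labelLeft j) = j := by
  ext; simp only [labelLeft, ord]; omega

theorem ord_labelRight (j : Fin n) : ord (labelRight j) = j := by
  ext; simp only [labelRight, ord]; omega

theorem odd_labelLeft (j : Fin n) : Odd (labelLeft j : ℕ) := ⟨j, rfl⟩

theorem even_labelRight (j : Fin n) : Even (labelRight j : ℕ) := ⟨j, by simp [labelRight]; omega⟩

theorem label_cases (l : Fin (2 * n)) : (∃ j, l = labelLeft j) ∨ ∃ j, l = labelRight j := by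
  rcases Nat.even_or_odd' (l : ℕ) with ⟨i, hi | hi⟩
  · exact Or.inr ⟨⟨i, by omega⟩, by ext; simp [labelRight, hi]⟩
  · exact Or.inl ⟨⟨i, by omega⟩, by ext; simp [labelLeft, hi]⟩

theorem sum_labels {M : Type*} [AddCommMonoid M] (f : Fin (2 * n) → M) :
    ∑ l, f l = ∑ j : Fin n, f (labelLeft j) + ∑ j : Fin n, f (labelRight j) := by
  classical
  have : (Finset.univ : Finset (Fin (2 * n))) =
      Finset.univ.image labelLeft ∪ Finset.univ.image labelRight := by
    ext l
    rcases label_cases l with ⟨j, rfl⟩ | ⟨j, rfl⟩ <;> simp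
  rw [this, Finset.sum_union, Finset.sum_image labelLeft_injective.injOn,
    Finset.sum_image labelRight_injective.injOn]
  rw [Finset.disjoint_left]
  intro l h1 h2
  simp only [Finset.mem_image, Finset.mem_univ, true_and] at h1 h2
  obtain ⟨i, rfl⟩ := h1
  obtain ⟨j, h⟩ := h2
  exact labelLeft_ne_labelRight i j h.symm

theorem sum_Jseq {M : Type*} [AddCommMonoid M] (f : Fin (2 * n) → M) :
    ∑ j, f (P.Jseq j) = ∑ l ∈ P.J, f l := by
  classical
  rw [← Finset.image_orderEmbOfFin_univ P.J P.card_J,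
    Finset.sum_image (P.J.orderEmbOfFin P.card_J).injective.injOn]
  exact Fintype.sum_equiv Fin.revPerm _ _ fun j => by simp [Jseq]

theorem sum_J'seq {M : Type*} [AddCommMonoid M] (f : Fin (2 * n) → M) :
    ∑ j, f (P.J'seq j) = ∑ l ∈ P.J', f l := by
  classical
  rw [← Finset.image_orderEmbOfFin_univ P.J' P.card_J',
    Finset.sum_image (P.J'.orderEmbOfFin P.card_J').injective.injOn]
  exact Fintype.sum_equiv Fin.revPerm _ _ fun j => by simp [J'seq]

theorem sum_eq_sum_Jseq_add {M : Type*} [AddCommMonoid M] (f : Fin (2 * n) → M) :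
    ∑ l, f l = ∑ j, f (P.Jseq j) + ∑ j, f (P.J'seq j) := by
  classical
  rw [sum_Jseq, sum_J'seq, J_eq_compl, Finset.sum_compl_add_sum]

theorem exists_isLeadingEntry (k : Fin n) : ∃ c, P.A.IsLeadingEntry k c := by
  rw [← Matrix.row_ne_zero_iff_exists_isLeadingEntry]
  have hli : LinearIndependent ℝ P.A.row := by
    rw [linearIndependent_iff_card_eq_finrank_span, Set.finrank,
      ← Matrix.rank_eq_finrank_span_row, P.rank_eq, Fintype.card_fin]
  exact hli.ne_zero k

/-- Pivot columns increase with the row, and the labels in J' are listed decreasingly, so the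
reversed enumerations coincide. This is why row k and the label `J'seq k` can share one index in
`zetaHat` and `label`. -/
theorem isLeadingEntry_J'seq (k : Fin n) : P.A.IsLeadingEntry k (Fin.rev (P.J'seq k)) := by
  choose p hp using P.exists_isLeadingEntry
  have hmono : StrictMono p := fun i j hij => by
    by_contra! h
    exact (hp j).2 (P.rref.isRowEchelon hij fun c hc => (hp i).1 c (hc.trans_le h))
  have : (fun k => Fin.rev (p (Fin.rev k))) = P.J'.orderEmbOfFin P.card_J' := by
    apply Finset.orderEmbOfFin_unique
    · intro k
      rw [mem_J']
      exact ⟨_, by rw [Fin.rev_rev]; exact hp _⟩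
    · intro i j hij
      exact Fin.rev_lt_rev.2 (hmono (Fin.rev_lt_rev.2 hij))
  have h : P.J'seq k = Fin.rev (p k) := by
    rw [J'seq, ← this]
    simp
  rw [h, Fin.rev_rev]
  exact hp k

/-- Pivot columns of a reduced echelon matrix are unit vectors, so each boundary condition contains
exactly one pivot boundary function. -/
theorem A_rev_J'seq (k j : Fin n) : P.A k (Fin.rev (P.J'seq j)) = if k = j then 1 else 0 := by
  split_ifs with h
  · rw [h]
    exact P.rref.eq_one (P.isLeadingEntry_J'seq j)
  · exact P.rref.eq_zero_of_ne_of_isLeadingEntry h (P.isLeadingEntry_J'seq j)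

theorem J'seq_of_isLeadingEntry {k : Fin n} {l : Fin (2 * n)}
    (h : P.A.IsLeadingEntry k (Fin.rev l)) : P.J'seq k = l :=
  Fin.rev_injective ((P.isLeadingEntry_J'seq k).unique h)

theorem J'seq_rowPlus (r : P.JhatPlus) : P.J'seq (P.rowPlus r) = labelLeft r.1 :=
  P.J'seq_of_isLeadingEntry
    (by rw [rev_labelLeft]; exact (P.exists_pivot_of_mem_JhatPlus r).choose_spec)

theorem J'seq_rowMinus (r : P.JhatMinus) : P.J'seq (P.rowMinus r) = labelRight r.1 :=
  P.J'seq_of_isLeadingEntry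
    (by rw [rev_labelRight]; exact (P.exists_pivot_of_mem_JhatMinus r).choose_spec)

theorem Ahat_eq (k j : Fin n) : P.Ahat k j = P.A k (Fin.rev (P.Jseq j)) := by
  unfold Ahat α β
  split_ifs with h
  · congr 1
    ext
    obtain ⟨m, hm⟩ := h
    simp [colLeft, ord, Fin.val_rev]
    omega
  · congr 1
    ext
    rw [Nat.not_odd_iff_even] at h
    obtain ⟨m, hm⟩ := h
    simp [colRight, ord, Fin.val_rev]
    omega

/-- The boundary conditions, solved for the boundary functions that belong to the pivots. -/
theorem mulVec_boundaryVector_eq_iff (b : Fin (2 * n) → ℂ) (H : Fin n → ℂ) :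
    (P.A.map Complex.ofReal).mulVec
      (boundaryVector (fun j => b (labelLeft j)) (fun j => b (labelRight j))) = H ↔
    ∀ k, b (P.J'seq k) + ∑ j, P.Ahat k j * b (P.Jseq j) = H k := by
  rw [funext_iff]
  refine forall_congr' fun k => ?_
  have : (P.A.map Complex.ofReal).mulVec
      (boundaryVector (fun j => b (labelLeft j)) (fun j => b (labelRight j))) k =
      b (P.J'seq k) + ∑ j, P.Ahat k j * b (P.Jseq j) := by
    simp only [Matrix.mulVec, dotProduct, boundaryVector_apply, Matrix.map_apply]
    rw [← Fintype.sum_equiv Fin.revPerm (fun l => (P.A k (Fin.rev l) : ℂ) * b l) _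
      (fun l => by simp), P.sum_eq_sum_Jseq_add, add_comm]
    simp only [A_rev_J'seq, Ahat_eq, apply_ite Complex.ofReal, Complex.ofReal_one,
      Complex.ofReal_zero, ite_mul, one_mul, zero_mul, Finset.sum_ite_eq, Finset.mem_univ, if_true]
  rw [this]

theorem c_omega (m : Fin n) (k : ℕ) (ρ : ℂ) :
    P.c m (omega n ^ k * ρ) = P.c m ρ * omega n ^ ((n - 1 - (m : ℕ)) * k) := by
  unfold c
  rw [show n - ((m : ℕ) + 1) = n - 1 - m by omega, mul_pow, ← pow_mul, mul_comm k]
  ring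

/-- Homogeneity of the monomials c_r absorbs the powers of ω, so every row is the same expression
evaluated at a rotated argument. This form can be compared directly with the global relation at
ω^kρ. -/
theorem charMatrix_apply (ρ : ℂ) (k j : Fin n) :
    P.charMatrix ρ k j =
      (if Odd (P.Jseq j : ℕ) then P.c (ord (P.Jseq j)) (omega n ^ (k : ℕ) * ρ)
        else -(Complex.exp (-Complex.I * omega n ^ (k : ℕ) * ρ) *
          P.c (ord (P.Jseq j)) (omega n ^ (k : ℕ) * ρ)))
      - ∑ r : P.JhatPlus, P.Ahat (P.rowPlus r) j * P.c r (omega n ^ (k : ℕ) * ρ)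
      + Complex.exp (-Complex.I * omega n ^ (k : ℕ) * ρ) *
        ∑ r : P.JhatMinus, P.Ahat (P.rowMinus r) j * P.c r (omega n ^ (k : ℕ) * ρ) := by
  simp only [charMatrix, Ahat, c_omega]
  split_ifs with h
  · simp only [mul_assoc, mul_comm (omega n ^ _) (P.c _ _)]
  · simp only [mul_assoc, mul_comm (omega n ^ _) (P.c _ _)]
    ring

/-- The characteristic matrix acts on the boundary values without pivots as the global relation
acts on all boundary values. -/
theorem charMatrix_mulVec (b : Fin (2 * n) → ℂ) (H : Fin n → ℂ)
    (hb : ∀ k, b (P.J'seq k) + ∑ j, P.Ahat k j * b (P.Jseq j) = H k) (ρ : ℂ) (k : Fin n) :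
    (P.charMatrix ρ).mulVec (fun j => b (P.Jseq j)) k =
      ∑ r, P.c r (omega n ^ (k : ℕ) * ρ) * (b (labelLeft r) -
        Complex.exp (-Complex.I * omega n ^ (k : ℕ) * ρ) * b (labelRight r))
      - ∑ l : P.JhatPlus, P.c l (omega n ^ (k : ℕ) * ρ) * H (P.rowPlus l)
      + Complex.exp (-Complex.I * omega n ^ (k : ℕ) * ρ) *
        ∑ l : P.JhatMinus, P.c l (omega n ^ (k : ℕ) * ρ) * H (P.rowMinus l) := by
  classical
  set e := Complex.exp (-Complex.I * omega n ^ (k : ℕ) * ρ) with he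
  set z := omega n ^ (k : ℕ) * ρ with hz
  -- The weight with which the boundary function labelled l enters the global relation at `z`.
  let s : Fin (2 * n) → ℂ := fun l => if Odd (l : ℕ) then P.c (ord l) z else -(e * P.c (ord l) z)
  have hsL : ∀ r, s (labelLeft r) = P.c r z := fun r => by
    simp only [s, if_pos (odd_labelLeft r), ord_labelLeft]
  have hsR : ∀ r, s (labelRight r) = -(e * P.c r z) := fun r => by
    simp only [s, if_neg (Nat.not_odd_iff_even.2 (even_labelRight r)), ord_labelRight]
  have h1 : ∑ r, P.c r z * (b (labelLeft r) - e * b (labelRight r)) = ∑ l, s l * b l := by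
    rw [sum_labels, ← Finset.sum_add_distrib]
    refine Finset.sum_congr rfl fun r _ => ?_
    rw [hsL, hsR]
    ring
  -- The boundary conditions eliminate the pivot labels. Their share of the sum becomes data minus
  -- exactly the corrections contained in the matrix entries.
  have h2 : ∑ l ∈ P.J', s l * b l = ∑ r : P.JhatPlus, P.c r z * (H (P.rowPlus r)
        - ∑ j, P.Ahat (P.rowPlus r) j * b (P.Jseq j))
      - e * ∑ r : P.JhatMinus, P.c r z * (H (P.rowMinus r)
        - ∑ j, P.Ahat (P.rowMinus r) j * b (P.Jseq j)) := by
    have hu : P.J' = P.JhatPlus.image labelLeft ∪ P.JhatMinus.image labelRight := by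
      unfold J'; congr
    rw [hu, Finset.sum_union, Finset.sum_image labelLeft_injective.injOn,
      Finset.sum_image labelRight_injective.injOn, ← Finset.sum_coe_sort P.JhatPlus,
      ← Finset.sum_coe_sort P.JhatMinus, sub_eq_add_neg, Finset.mul_sum, ← Finset.sum_neg_distrib]
    · congr 1
      · refine Finset.sum_congr rfl fun r _ => ?_
        rw [hsL, ← hb, J'seq_rowPlus]
        ring
      · refine Finset.sum_congr rfl fun r _ => ?_
        rw [hsR, ← hb, J'seq_rowMinus]
        ring
    · rw [Finset.disjoint_left]
      intro l h1 h2
      simp only [Finset.mem_image] at h1 h2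
      obtain ⟨i, -, rfl⟩ := h1
      obtain ⟨j, -, h⟩ := h2
      exact labelLeft_ne_labelRight i j h.symm
  rw [h1, P.sum_eq_sum_Jseq_add, P.sum_J'seq (fun l => s l * b l), h2]
  have h3 : (P.charMatrix ρ).mulVec (fun j => b (P.Jseq j)) k =
      ∑ j, (s (P.Jseq j) * b (P.Jseq j)
        - ∑ r : P.JhatPlus, P.c r z * (P.Ahat (P.rowPlus r) j * b (P.Jseq j))
        + e * ∑ r : P.JhatMinus, P.c r z * (P.Ahat (P.rowMinus r) j * b (P.Jseq j))) := by
    simp only [Matrix.mulVec, dotProduct, charMatrix_apply]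
    refine Finset.sum_congr rfl fun j _ => ?_
    rw [add_mul, sub_mul, Finset.sum_mul, mul_assoc (Complex.exp _) (∑ _, _), Finset.sum_mul]
    congr 1
    · congr 1
      exact Finset.sum_congr rfl fun r _ => by ring
    · congr 1
      exact Finset.sum_congr rfl fun r _ => by ring
  rw [h3, Finset.sum_add_distrib, Finset.sum_sub_distrib, Finset.sum_comm, ← Finset.mul_sum,
    Finset.sum_comm (s := Finset.univ (α := Fin n)) (t := Finset.univ (α := P.JhatMinus))]
  simp only [← Finset.mul_sum, mul_sub, Finset.sum_sub_distrib]
  ring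

end IBVP

/-! ### Smooth functions on rectangles -/

theorem ContinuousOn.intervalIntegral_parametric {X : Type*} [TopologicalSpace X]
    {f : X → ℝ → ℂ} {S : Set X} {a b : ℝ} (hab : a ≤ b)
    (hf : ContinuousOn (Function.uncurry f) (S ×ˢ Set.Icc a b)) :
    ContinuousOn (fun x => ∫ t in a..b, f x t) S := by
  rw [continuousOn_iff_continuous_domRestrict]
  -- Projecting t onto [a,b] extends the integrand continuously to all real t without changing the
  -- integral.
  have h : Continuous (Function.uncurry fun (x : S) (t : ℝ) => f x (Set.projIcc a b hab t)) := by
    refine hf.comp_continuous (f := fun p : S × ℝ => ((p.1 : X), (Set.projIcc a b hab p.2 : ℝ)))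
      ?_ fun p => ⟨p.1.2, (Set.projIcc a b hab p.2).2⟩
    exact (continuous_subtype_val.comp continuous_fst).prodMk
      (continuous_subtype_val.comp (continuous_projIcc.comp continuous_snd))
  convert intervalIntegral.continuous_parametric_intervalIntegral_of_continuous' h a b
    (μ := MeasureTheory.volume) using 1
  ext x
  refine intervalIntegral.integral_congr fun t ht => ?_
  rw [Set.uIcc_of_le hab] at ht
  simp only [Set.projIcc_of_mem hab ht]

/-- Integration by parts against `e^{cx}`. -/
theorem mul_integral_cexp_mul {u v : ℝ} (huv : u ≤ v) {f f' : ℝ → ℂ}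
    (hf : ∀ x ∈ Set.Icc u v, HasDerivWithinAt f (f' x) (Set.Icc u v) x)
    (hf' : ContinuousOn f' (Set.Icc u v)) (c : ℂ) :
    c * ∫ x in u..v, Complex.exp (c * x) * f x =
      Complex.exp (c * v) * f v - Complex.exp (c * u) * f u
        - ∫ x in u..v, Complex.exp (c * x) * f' x := by
  have he : ∀ x : ℝ, HasDerivAt (fun x : ℝ => Complex.exp (c * x)) (Complex.exp (c * x) * c) x :=
    fun x => by
      simpa using ((((hasDerivAt_id x).ofReal_comp).const_mul c).cexp)
  have hec : Continuous fun x : ℝ => Complex.exp (c * x) := by fun_prop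
  have := intervalIntegral.integral_mul_deriv_eq_deriv_mul_of_hasDerivWithinAt
    (a := u) (b := v) (u := f) (u' := f') (v := fun x : ℝ => Complex.exp (c * x))
    (v' := fun x : ℝ => Complex.exp (c * x) * c) (by rwa [Set.uIcc_of_le huv])
    (fun x _ => (he x).hasDerivWithinAt)
    (hf'.intervalIntegrable_of_Icc huv) ((hec.mul continuous_const).intervalIntegrable _ _)
  rw [← intervalIntegral.integral_const_mul]
  calc _ = ∫ x in u..v, f x * (Complex.exp (c * x) * c) := by
        congr 1; ext x; ring
    _ = _ := by
        rw [this]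
        simp only [mul_comm]

/-- The one-sided partial derivative is the derivative within the rectangle applied to (1,0). It is
therefore smooth up to the boundary, and the argument can be iterated. -/
theorem contDiffOn_derivWithin_left {f : ℝ × ℝ → ℂ} {s t : Set ℝ} (hs : UniqueDiffOn ℝ s)
    (ht : UniqueDiffOn ℝ t) (hf : ContDiffOn ℝ ∞ f (s ×ˢ t)) :
    ContDiffOn ℝ ∞ (fun p : ℝ × ℝ => derivWithin (fun y => f (y, p.2)) s p.1) (s ×ˢ t) ∧
    ∀ x ∈ s, ∀ y ∈ t, HasDerivWithinAt (fun y' => f (y', y))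
      (derivWithin (fun y' => f (y', y)) s x) s x := by
  have h1 : ∀ x ∈ s, ∀ y ∈ t, HasDerivWithinAt (fun y' => f (y', y))
      (fderivWithin ℝ f (s ×ˢ t) (x, y) (1, 0)) s x := fun x hx y hy => by
    have h := (hf.differentiableOn (by simp) (x, y) ⟨hx, hy⟩).hasFDerivWithinAt
    exact h.comp_hasDerivWithinAt_of_eq x
      (((hasDerivWithinAt_id x s).prodMk (hasDerivWithinAt_const x s y)))
      (fun x' hx' => ⟨hx', hy⟩) rfl
  refine ⟨?_, fun x hx y hy => by rw [(h1 x hx y hy).derivWithin (hs x hx)]; exact h1 x hx y hy⟩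
  refine ContDiffOn.congr (f := fun p => fderivWithin ℝ f (s ×ˢ t) p (1, 0)) ?_
    fun p hp => (h1 p.1 hp.1 p.2 hp.2).derivWithin (hs p.1 hp.1)
  exact (hf.fderivWithin (hs.prod ht) (by simp)).clm_apply contDiffOn_const

theorem contDiffOn_derivWithin_right {f : ℝ × ℝ → ℂ} {s t : Set ℝ} (hs : UniqueDiffOn ℝ s)
    (ht : UniqueDiffOn ℝ t) (hf : ContDiffOn ℝ ∞ f (s ×ˢ t)) :
    ContDiffOn ℝ ∞ (fun p : ℝ × ℝ => derivWithin (fun y => f (p.1, y)) t p.2) (s ×ˢ t) ∧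
    ∀ x ∈ s, ∀ y ∈ t, HasDerivWithinAt (fun y' => f (x, y'))
      (derivWithin (fun y' => f (x, y')) t y) t y := by
  have hm : Set.MapsTo (Prod.swap : ℝ × ℝ → ℝ × ℝ) (t ×ˢ s) (s ×ˢ t) := fun p hp => ⟨hp.2, hp.1⟩
  have hm' : Set.MapsTo (Prod.swap : ℝ × ℝ → ℝ × ℝ) (s ×ˢ t) (t ×ˢ s) := fun p hp => ⟨hp.2, hp.1⟩
  have hsw : ContDiff ℝ ∞ (Prod.swap : ℝ × ℝ → ℝ × ℝ) := contDiff_snd.prodMk contDiff_fst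
  obtain ⟨h1, h2⟩ := contDiffOn_derivWithin_left ht hs (hf.comp hsw.contDiffOn hm)
  exact ⟨h1.comp hsw.contDiffOn hm', fun x hx y hy => h2 y hy x hx⟩

/-! ### Derivatives of a solution and the global relation -/

namespace IBVP

variable {n : ℕ} {P : IBVP n} {q : ℝ → ℝ → ℂ}

theorem dx_zero (q : ℝ → ℝ → ℂ) (x t : ℝ) : dx 0 q x t = q x t := by simp [dx]

theorem dx_succ (j : ℕ) (q : ℝ → ℝ → ℂ) (x t : ℝ) :
    dx (j + 1) q x t = derivWithin (fun y => dx j q y t) (Set.Icc 0 1) x := by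
  simp only [dx, iteratedDerivWithin_succ]

theorem contDiffOn_dx {T : ℝ} (hT : 0 < T)
    (hq : ContDiffOn ℝ ∞ (fun p : ℝ × ℝ => q p.1 p.2) (Set.Icc 0 1 ×ˢ Set.Icc 0 T)) (j : ℕ) :
    ContDiffOn ℝ ∞ (fun p : ℝ × ℝ => dx j q p.1 p.2) (Set.Icc 0 1 ×ˢ Set.Icc 0 T) := by
  induction j with
  | zero => simpa only [dx_zero] using hq
  | succ j ih =>
    simp only [dx_succ]
    exact (contDiffOn_derivWithin_left (uniqueDiffOn_Icc one_pos) (uniqueDiffOn_Icc hT) ih).1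

theorem IsSolution.contDiffOn_dx (hq : P.IsSolution q) (j : ℕ) :
    ContDiffOn ℝ ∞ (fun p : ℝ × ℝ => dx j q p.1 p.2) (Set.Icc 0 1 ×ˢ Set.Icc 0 P.T) :=
  IBVP.contDiffOn_dx P.T_pos hq.smooth j

theorem IsSolution.contDiffOn_dx_left (hq : P.IsSolution q) (j : ℕ) {t : ℝ}
    (ht : t ∈ Set.Icc 0 P.T) : ContDiffOn ℝ ∞ (fun x => dx j q x t) (Set.Icc 0 1) :=
  (hq.contDiffOn_dx j).comp (contDiff_id.prodMk contDiff_const).contDiffOn fun _ hx => ⟨hx, ht⟩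

theorem IsSolution.contDiffOn_dx_right (hq : P.IsSolution q) (j : ℕ) {x : ℝ}
    (hx : x ∈ Set.Icc (0 : ℝ) 1) : ContDiffOn ℝ ∞ (fun t => dx j q x t) (Set.Icc 0 P.T) :=
  (hq.contDiffOn_dx j).comp (contDiff_const.prodMk contDiff_id).contDiffOn fun _ ht => ⟨hx, ht⟩

theorem IsSolution.hasDerivWithinAt_dx (hq : P.IsSolution q) (j : ℕ) {x t : ℝ}
    (hx : x ∈ Set.Icc (0 : ℝ) 1) (ht : t ∈ Set.Icc 0 P.T) :
    HasDerivWithinAt (fun y => dx j q y t) (dx (j + 1) q x t) (Set.Icc 0 1) x := by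
  rw [dx_succ]
  exact (contDiffOn_derivWithin_left (uniqueDiffOn_Icc one_pos) (uniqueDiffOn_Icc P.T_pos)
    (hq.contDiffOn_dx j)).2 x hx t ht

theorem IsSolution.hasDerivWithinAt_time (hq : P.IsSolution q) {x t : ℝ}
    (hx : x ∈ Set.Icc (0 : ℝ) 1) (ht : t ∈ Set.Icc 0 P.T) :
    HasDerivWithinAt (fun s => q x s) (-(P.a * ((-Complex.I) ^ n * dx n q x t)))
      (Set.Icc 0 P.T) t := by
  rw [← eq_neg_of_add_eq_zero_left (hq.pde x hx t ht)]
  exact (contDiffOn_derivWithin_right (uniqueDiffOn_Icc one_pos) (uniqueDiffOn_Icc P.T_pos)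
    hq.smooth).2 x hx t ht

/-- Each of the m integrations by parts in x contributes one boundary term and one factor iρ. -/
theorem IsSolution.fourierTransform_dx (hq : P.IsSolution q) (ρ : ℂ) {t : ℝ}
    (ht : t ∈ Set.Icc 0 P.T) (m : ℕ) :
    fourierTransform (fun x => dx m q x t) ρ =
      ∑ j ∈ Finset.range m, (Complex.I * ρ) ^ (m - 1 - j) *
        (Complex.exp (-Complex.I * ρ) * dx j q 1 t - dx j q 0 t)
      + (Complex.I * ρ) ^ m * fourierTransform (fun x => q x t) ρ := by
  induction m with
  | zero => simp [dx_zero]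
  | succ m ih =>
    have := mul_integral_cexp_mul zero_le_one (fun x hx => hq.hasDerivWithinAt_dx m hx ht)
      (hq.contDiffOn_dx_left (m + 1) ht).continuousOn (-Complex.I * ρ)
    have h2 : fourierTransform (fun x => dx (m + 1) q x t) ρ =
        Complex.exp (-Complex.I * ρ) * dx m q 1 t - dx m q 0 t
        + (Complex.I * ρ) * fourierTransform (fun x => dx m q x t) ρ := by
      unfold fourierTransform
      simp only [Complex.ofReal_one, mul_one, Complex.ofReal_zero, mul_zero, Complex.exp_zero,
        one_mul] at this
      linear_combination this
    rw [h2, ih, Finset.sum_range_succ, mul_add, Finset.mul_sum]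
    have h3 : ∑ j ∈ Finset.range m, Complex.I * ρ * ((Complex.I * ρ) ^ (m - 1 - j) *
        (Complex.exp (-Complex.I * ρ) * dx j q 1 t - dx j q 0 t)) =
        ∑ j ∈ Finset.range m, (Complex.I * ρ) ^ (m + 1 - 1 - j) *
        (Complex.exp (-Complex.I * ρ) * dx j q 1 t - dx j q 0 t) := by
      refine Finset.sum_congr rfl fun j hj => ?_
      rw [Finset.mem_range] at hj
      rw [show m + 1 - 1 - j = (m - 1 - j) + 1 by omega, pow_succ]
      ring
    rw [h3]
    simp only [show m + 1 - 1 - m = 0 by omega, pow_zero, one_mul, pow_succ]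
    ring

theorem IsSolution.continuousOn_fourierTransform (hq : P.IsSolution q) (ρ : ℂ) :
    ContinuousOn (fun t => fourierTransform (fun x => q x t) ρ) (Set.Icc 0 P.T) := by
  refine ContinuousOn.intervalIntegral_parametric zero_le_one ?_
  have h2 : Continuous fun p : ℝ × ℝ => Complex.exp (-Complex.I * ρ * p.2) := by fun_prop
  exact h2.continuousOn.mul (hq.smooth.continuousOn.comp continuous_swap.continuousOn
    fun p hp => ⟨hp.2, hp.1⟩)

/-- The `t`-transform over `[0,τ]`. -/
noncomputable def partialTransform (P : IBVP n) (τ : ℝ) (X : ℝ → ℂ) (ρ : ℂ) : ℂ :=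
  ∫ t in (0 : ℝ)..τ, Complex.exp (P.a * ρ ^ n * t) * X t

/-- Exhibits c_j as the product of the coefficient a(−i)ⁿ of the equation with the power of iρ left
by the boundary term of order j, which is how it arises in the global relation. -/
theorem c_eq_neg_mul (P : IBVP n) (j : Fin n) (ρ : ℂ) :
    P.c j ρ = -(P.a * (-Complex.I) ^ n * (Complex.I * ρ) ^ (n - 1 - (j : ℕ))) := by
  have h : (-Complex.I) ^ n * Complex.I ^ (n - 1 - (j : ℕ)) = (Complex.I ^ ((j : ℕ) + 1))⁻¹ := by
    refine eq_inv_of_mul_eq_one_left ?_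
    rw [mul_assoc, ← pow_add,
      show n - 1 - (j : ℕ) + (j + 1) = n by omega, ← mul_pow]
    simp
  rw [c, ← h, mul_pow, show n - ((j : ℕ) + 1) = n - 1 - j by omega]
  ring

/-- The global relation over `[0,τ]`. -/
theorem IsSolution.global_relation (hq : P.IsSolution q) (ρ : ℂ) {τ : ℝ}
    (hτ : τ ∈ Set.Icc 0 P.T) :
    fourierTransform P.q₀ ρ
      - Complex.exp (P.a * ρ ^ n * τ) * fourierTransform (fun x => q x τ) ρ =
    ∑ j : Fin n, P.c j ρ * (P.partialTransform τ (dx j q 0) ρ -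
      Complex.exp (-Complex.I * ρ) * P.partialTransform τ (dx j q 1) ρ) := by
  have hsub : Set.Icc 0 τ ⊆ Set.Icc 0 P.T := Set.Icc_subset_Icc_right hτ.2
  have h0 : (0 : ℝ) ∈ Set.Icc 0 P.T := ⟨le_rfl, P.T_pos.le⟩
  have h01 : (0 : ℝ) ∈ Set.Icc (0 : ℝ) 1 := ⟨le_rfl, zero_le_one⟩
  have h11 : (1 : ℝ) ∈ Set.Icc (0 : ℝ) 1 := ⟨zero_le_one, le_rfl⟩
  set lam := P.a * ρ ^ n with hlam
  -- integration by parts in time at fixed `x`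
  have hx : ∀ x ∈ Set.Icc (0 : ℝ) 1,
      lam * ∫ s in (0 : ℝ)..τ, Complex.exp (lam * s) * q x s =
      Complex.exp (lam * τ) * q x τ - q x 0 +
        P.a * (-Complex.I) ^ n * ∫ s in (0 : ℝ)..τ, Complex.exp (lam * s) * dx n q x s := by
    intro x hx
    have := mul_integral_cexp_mul hτ.1 (c := lam)
      (fun s hs => (hq.hasDerivWithinAt_time hx (hsub hs)).mono hsub)
      (((continuousOn_const.mul (hq.contDiffOn_dx_right n hx).continuousOn).const_mul P.a).neg.mono
        hsub)
    rw [this, ← intervalIntegral.integral_const_mul]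
    simp only [Complex.ofReal_zero, mul_zero, Complex.exp_zero, one_mul, mul_neg,
      intervalIntegral.integral_neg, sub_neg_eq_add]
    congr 2
    ext s
    ring
  -- Fubini
  have hswap : ∀ j : ℕ, ∫ x in (0 : ℝ)..1, Complex.exp (-Complex.I * ρ * x) *
        (∫ s in (0 : ℝ)..τ, Complex.exp (lam * s) * dx j q x s) =
      ∫ s in (0 : ℝ)..τ, Complex.exp (lam * s) * fourierTransform (fun x => dx j q x s) ρ := by
    intro j
    unfold fourierTransform
    simp only [← intervalIntegral.integral_const_mul]
    rw [MeasureTheory.intervalIntegral_intervalIntegral_swap]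
    · congr 1
      ext s
      congr 1
      ext x
      ring
    · have : ContinuousOn (Function.uncurry fun (x s : ℝ) => Complex.exp (-Complex.I * ρ * x) *
          (Complex.exp (lam * s) * dx j q x s)) (Set.Icc 0 1 ×ˢ Set.Icc 0 τ) := by
        have h1 := (hq.contDiffOn_dx j).continuousOn.mono
          (Set.prod_mono (le_refl (Set.Icc (0 : ℝ) 1)) hsub)
        have h2 : Continuous fun p : ℝ × ℝ => Complex.exp (-Complex.I * ρ * p.1) := by fun_prop
        have h3 : Continuous fun p : ℝ × ℝ => Complex.exp (lam * p.2) := by fun_prop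
        exact h2.continuousOn.mul (h3.continuousOn.mul h1)
      refine (this.integrableOn_compact (isCompact_Icc.prod isCompact_Icc)).mono_set ?_
      rw [Set.uIoc_of_le zero_le_one, Set.uIoc_of_le hτ.1]
      exact Set.prod_mono Set.Ioc_subset_Icc_self Set.Ioc_subset_Icc_self
  have hcont : ∀ j : ℕ, ContinuousOn (fun x => ∫ s in (0 : ℝ)..τ, Complex.exp (lam * s) * dx j q x s)
      (Set.Icc 0 1) := by
    intro j
    refine ContinuousOn.intervalIntegral_parametric hτ.1 ?_
    have h3 : Continuous fun p : ℝ × ℝ => Complex.exp (lam * p.2) := by fun_prop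
    exact h3.continuousOn.mul ((hq.contDiffOn_dx j).continuousOn.mono
      (Set.prod_mono (le_refl (Set.Icc (0 : ℝ) 1)) hsub))
  have hq0 : fourierTransform P.q₀ ρ = fourierTransform (fun x => q x 0) ρ := by
    unfold fourierTransform
    refine intervalIntegral.integral_congr fun x hx => ?_
    rw [Set.uIcc_of_le zero_le_one] at hx
    simp only [hq.initial x hx]
  have hec : Continuous fun x : ℝ => Complex.exp (-Complex.I * ρ * x) := by fun_prop
  -- This is `hx` integrated against e^{-iρx} over [0,1], with the order of integration exchanged.
  have key : lam * ∫ s in (0 : ℝ)..τ, Complex.exp (lam * s) * fourierTransform (fun x => q x s) ρ =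
      Complex.exp (lam * τ) * fourierTransform (fun x => q x τ) ρ - fourierTransform P.q₀ ρ
      + P.a * (-Complex.I) ^ n *
        ∫ s in (0 : ℝ)..τ, Complex.exp (lam * s) * fourierTransform (fun x => dx n q x s) ρ := by
    have e0 := hswap 0
    simp only [dx_zero] at e0
    rw [← hswap n, ← e0, hq0, fourierTransform, fourierTransform,
      ← intervalIntegral.integral_const_mul, ← intervalIntegral.integral_const_mul,
      ← intervalIntegral.integral_const_mul, ← intervalIntegral.integral_sub,
      ← intervalIntegral.integral_add]
    · refine intervalIntegral.integral_congr fun x hx' => ?_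
      rw [Set.uIcc_of_le zero_le_one] at hx'
      have := hx x hx'
      linear_combination Complex.exp (-Complex.I * ρ * x) * this
    all_goals apply ContinuousOn.intervalIntegrable_of_Icc zero_le_one
    · have h1 := (hq.contDiffOn_dx_left 0 hτ).continuousOn
      have h2 := (hq.contDiffOn_dx_left 0 h0).continuousOn
      simp only [dx_zero] at h1 h2
      exact (continuousOn_const.mul (hec.continuousOn.mul h1)).sub (hec.continuousOn.mul h2)
    · exact continuousOn_const.mul (hec.continuousOn.mul (hcont n))
    · have h1 := (hq.contDiffOn_dx_left 0 hτ).continuousOn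
      simp only [dx_zero] at h1
      exact continuousOn_const.mul (hec.continuousOn.mul h1)
    · have h2 := (hq.contDiffOn_dx_left 0 h0).continuousOn
      simp only [dx_zero] at h2
      exact (hec.continuousOn.mul h2)
  have hint : ∀ (j : ℕ) {x : ℝ}, x ∈ Set.Icc (0 : ℝ) 1 → ∀ d : ℂ, IntervalIntegrable
      (fun s : ℝ => d * (Complex.exp (lam * s) * dx j q x s)) MeasureTheory.volume 0 τ := by
    intro j x hx d
    have h3 : Continuous fun s : ℝ => Complex.exp (lam * s) := by fun_prop
    exact (continuousOn_const.mul (h3.continuousOn.mul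
      ((hq.contDiffOn_dx_right j hx).continuousOn.mono hsub))).intervalIntegrable_of_Icc hτ.1
  have hF : IntervalIntegrable (fun s : ℝ => Complex.exp (lam * s) *
      fourierTransform (fun x => q x s) ρ) MeasureTheory.volume 0 τ := by
    have h3 : Continuous fun s : ℝ => Complex.exp (lam * s) := by fun_prop
    exact (h3.continuousOn.mul (hq.continuousOn_fourierTransform ρ |>.mono
      hsub)).intervalIntegrable_of_Icc hτ.1
  have hdn : ∫ s in (0 : ℝ)..τ, Complex.exp (lam * s) * fourierTransform (fun x => dx n q x s) ρ =
      ∑ j : Fin n, (Complex.I * ρ) ^ (n - 1 - (j : ℕ)) * (Complex.exp (-Complex.I * ρ) *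
        P.partialTransform τ (dx j q 1) ρ - P.partialTransform τ (dx j q 0) ρ)
      + (Complex.I * ρ) ^ n *
        ∫ s in (0 : ℝ)..τ, Complex.exp (lam * s) * fourierTransform (fun x => q x s) ρ := by
    have e1 : ∀ s ∈ Set.uIcc 0 τ, Complex.exp (lam * s) * fourierTransform (fun x => dx n q x s) ρ =
        ∑ j : Fin n, ((Complex.I * ρ) ^ (n - 1 - (j : ℕ)) * Complex.exp (-Complex.I * ρ) *
          (Complex.exp (lam * s) * dx j q 1 s) -
          (Complex.I * ρ) ^ (n - 1 - (j : ℕ)) * (Complex.exp (lam * s) * dx j q 0 s)) +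
        (Complex.I * ρ) ^ n * (Complex.exp (lam * s) * fourierTransform (fun x => q x s) ρ) := by
      intro s hs
      rw [Set.uIcc_of_le hτ.1] at hs
      rw [hq.fourierTransform_dx ρ (hsub hs), ← Fin.sum_univ_eq_sum_range (fun j =>
        (Complex.I * ρ) ^ (n - 1 - j) *
        (Complex.exp (-Complex.I * ρ) * dx j q 1 s - dx j q 0 s)), mul_add, Finset.mul_sum]
      congr 1
      · exact Finset.sum_congr rfl fun j _ => by ring
      · ring
    rw [intervalIntegral.integral_congr e1, intervalIntegral.integral_add,
      intervalIntegral.integral_finsetSum, intervalIntegral.integral_const_mul]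
    · congr 1
      refine Finset.sum_congr rfl fun j _ => ?_
      rw [intervalIntegral.integral_sub (hint j h11 _) (hint j h01 _),
        intervalIntegral.integral_const_mul, intervalIntegral.integral_const_mul]
      simp only [partialTransform]
      ring
    · exact fun j _ => (hint j h11 _).sub (hint j h01 _)
    · simpa only [Finset.sum_fn] using IntervalIntegrable.sum Finset.univ
        fun (j : Fin n) _ => (hint j h11 _).sub (hint j h01 _)
    · exact hF.const_mul _
  rw [hdn] at key
  -- Because of this identity the space-time integral of q has coefficient aρⁿ on both sides and
  -- cancels. Only boundary terms and the two end times remain.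
  have hI : (-Complex.I) ^ n * (Complex.I * ρ) ^ n = ρ ^ n := by
    rw [← mul_pow, ← mul_assoc]; simp
  simp only [c_eq_neg_mul]
  have hs : ∑ j : Fin n, -(P.a * (-Complex.I) ^ n * (Complex.I * ρ) ^ (n - 1 - (j : ℕ))) *
      (P.partialTransform τ (dx j q 0) ρ -
      Complex.exp (-Complex.I * ρ) * P.partialTransform τ (dx j q 1) ρ) =
      P.a * (-Complex.I) ^ n * ∑ j : Fin n, (Complex.I * ρ) ^ (n - 1 - (j : ℕ)) *
        (Complex.exp (-Complex.I * ρ) *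
        P.partialTransform τ (dx j q 1) ρ - P.partialTransform τ (dx j q 0) ρ) := by
    rw [Finset.mul_sum]
    exact Finset.sum_congr rfl fun j _ => by ring
  rw [hs]
  set W := ∫ s in (0 : ℝ)..τ, Complex.exp (lam * s) * fourierTransform (fun x => q x s) ρ
  linear_combination key + P.a * W * hI - W * hlam

end IBVP

namespace IBVP

variable {n : ℕ} {P : IBVP n} {q : ℝ → ℝ → ℂ}

theorem omega_pow (hn : 0 < n) : omega n ^ n = 1 := by
  rw [omega, ← Complex.exp_nat_mul, mul_div_cancel₀ _ (by exact_mod_cast hn.ne')]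
  exact Complex.exp_two_pi_mul_I

theorem omega_pow_mul_pow (hn : 0 < n) (k : ℕ) (ρ : ℂ) : (omega n ^ k * ρ) ^ n = ρ ^ n := by
  rw [mul_pow, ← pow_mul, mul_comm k, pow_mul, omega_pow hn, one_pow, one_mul]

/-! ### Cramer's rule -/

/-- The boundary function with a given label. -/
noncomputable def boundaryFun (q : ℝ → ℝ → ℂ) (l : Fin (2 * n)) (t : ℝ) : ℂ :=
  if Odd (l : ℕ) then dx (ord l) q 0 t else dx (ord l) q 1 t

theorem boundaryFun_labelLeft (q : ℝ → ℝ → ℂ) (j : Fin n) :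
    boundaryFun q (labelLeft j) = dx j q 0 := by
  ext t
  rw [boundaryFun, if_pos (odd_labelLeft j), ord_labelLeft]

theorem boundaryFun_labelRight (q : ℝ → ℝ → ℂ) (j : Fin n) :
    boundaryFun q (labelRight j) = dx j q 1 := by
  ext t
  rw [boundaryFun, if_neg (Nat.not_odd_iff_even.2 (even_labelRight j)), ord_labelRight]

theorem IsSolution.continuousOn_boundaryFun (hq : P.IsSolution q) (l : Fin (2 * n)) :
    ContinuousOn (boundaryFun q l) (Set.Icc 0 P.T) := by
  rcases label_cases l with ⟨j, rfl⟩ | ⟨j, rfl⟩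
  · rw [boundaryFun_labelLeft]
    exact (hq.contDiffOn_dx_right j ⟨le_rfl, zero_le_one⟩).continuousOn
  · rw [boundaryFun_labelRight]
    exact (hq.contDiffOn_dx_right j ⟨zero_le_one, le_rfl⟩).continuousOn

theorem IsSolution.boundaryFun_J'seq (hq : P.IsSolution q) {t : ℝ} (ht : t ∈ Set.Icc 0 P.T)
    (k : Fin n) : boundaryFun q (P.J'seq k) t
      + ∑ j, P.Ahat k j * boundaryFun q (P.Jseq j) t = P.h k t := by
  refine (P.mulVec_boundaryVector_eq_iff (fun l => boundaryFun q l t) (fun k => P.h k t)).1 ?_ k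
  simp only [boundaryFun_labelLeft, boundaryFun_labelRight]
  exact hq.boundary t ht

theorem IsSolution.tTransform_J'seq (hq : P.IsSolution q) (ρ : ℂ) (k : Fin n) :
    P.tTransform (boundaryFun q (P.J'seq k)) ρ
      + ∑ j, P.Ahat k j * P.tTransform (boundaryFun q (P.Jseq j)) ρ = P.tTransform (P.h k) ρ := by
  have hec : Continuous fun t : ℝ => Complex.exp (P.a * ρ ^ n * t) := by fun_prop
  have hi : ∀ l, IntervalIntegrable (fun t : ℝ => Complex.exp (P.a * ρ ^ n * t) *
      boundaryFun q l t) MeasureTheory.volume 0 P.T := fun l =>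
    (hec.continuousOn.mul (hq.continuousOn_boundaryFun l)).intervalIntegrable_of_Icc P.T_pos.le
  unfold tTransform
  simp only [← intervalIntegral.integral_const_mul]
  rw [← intervalIntegral.integral_finsetSum fun j _ => (hi _).const_mul _,
    ← intervalIntegral.integral_add (hi _)]
  · refine intervalIntegral.integral_congr fun t ht => ?_
    rw [Set.uIcc_of_le P.T_pos.le] at ht
    simp only [← hq.boundaryFun_J'seq ht k, mul_add, Finset.mul_sum]
    congr 1
    exact Finset.sum_congr rfl fun j _ => by ring
  · simpa only [Finset.sum_fn] using IntervalIntegrable.sum Finset.univ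
        fun (j : Fin n) _ => (hi (P.Jseq j)).const_mul (P.Ahat k j : ℂ)

/-- The kernel sees ρ only through ρⁿ. The n rotated global relations therefore involve the same
unknown transforms, which makes the system square. -/
theorem tTransform_omega (P : IBVP n) (X : ℝ → ℂ) (k : ℕ) (ρ : ℂ) :
    P.partialTransform P.T X (omega n ^ k * ρ) = P.tTransform X ρ := by
  rw [partialTransform, tTransform, omega_pow_mul_pow P.n_pos]

/-- Row k is the global relation over [0,T] at ω^kρ after elimination of the pivot transforms. -/
theorem IsSolution.charMatrix_mulVec (hq : P.IsSolution q) (ρ : ℂ) :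
    (P.charMatrix ρ).mulVec (fun j => P.tTransform (boundaryFun q (P.Jseq j)) ρ) =
      P.U ρ - Complex.exp (P.a * ρ ^ n * P.T) • P.UT q ρ := by
  ext k
  rw [IBVP.charMatrix_mulVec P (fun l => P.tTransform (boundaryFun q l) ρ) _
    (hq.tTransform_J'seq ρ)]
  have := hq.global_relation (omega n ^ (k : ℕ) * ρ) ⟨P.T_pos.le, le_rfl⟩
  simp only [tTransform_omega, omega_pow_mul_pow P.n_pos, ← mul_assoc (-Complex.I)] at this
  simp only [boundaryFun_labelLeft, boundaryFun_labelRight, ← this, U, UT, Pi.sub_apply,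
    Pi.smul_apply, smul_eq_mul]
  ring

theorem det_updateCol_eq_cramer (M : Matrix (Fin n) (Fin n) ℂ) (v : Fin n → ℂ) (j : Fin n) :
    (M.updateCol j v).det = M.cramer v j := rfl

/-- Cramer's rule in the form adj(M)·M = det(M)·1, which needs no division and so holds at the zeros
of Δ_P as well. The indices beyond n follow by applying the boundary conditions to the first n. -/
theorem IsSolution.zetaHat_sub_etaHat (hq : P.IsSolution q) (ρ : ℂ) (j : Fin n ⊕ Fin n) :
    P.zetaHat ρ j - Complex.exp (P.a * ρ ^ n * P.T) * P.etaHat q ρ j =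
      P.DeltaP ρ * P.tTransform (boundaryFun q (P.label j)) ρ := by
  have h : ∀ j, (P.charMatrix ρ).cramer (P.U ρ) j
      - Complex.exp (P.a * ρ ^ n * P.T) * (P.charMatrix ρ).cramer (P.UT q ρ) j =
      P.DeltaP ρ * P.tTransform (boundaryFun q (P.Jseq j)) ρ := fun j => by
    have := congrFun (congrArg (P.charMatrix ρ).cramer (hq.charMatrix_mulVec ρ)) j
    rw [map_sub, map_smul, Matrix.cramer_eq_adjugate_mulVec, Matrix.mulVec_mulVec,
      Matrix.adjugate_mul, Matrix.smul_mulVec, Matrix.one_mulVec] at this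
    simpa [DeltaP] using this.symm
  rcases j with j | j
  · exact h j
  · simp only [zetaHat, etaHat, label, det_updateCol_eq_cramer]
    have h2 : ∑ k, (P.Ahat j k : ℂ) * (P.charMatrix ρ).cramer (P.U ρ) k -
        Complex.exp (P.a * ρ ^ n * P.T) * ∑ k, P.Ahat j k * (P.charMatrix ρ).cramer (P.UT q ρ) k =
        P.DeltaP ρ * ∑ k, P.Ahat j k * P.tTransform (boundaryFun q (P.Jseq k)) ρ := by
      rw [Finset.mul_sum, Finset.mul_sum, ← Finset.sum_sub_distrib]
      refine Finset.sum_congr rfl fun k _ => ?_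
      linear_combination (P.Ahat j k : ℂ) * h k
    rw [← hq.tTransform_J'seq ρ j]
    linear_combination (-1 : ℂ) * h2

theorem sum_label {M : Type*} [AddCommMonoid M] (P : IBVP n) (f : Fin (2 * n) → M) :
    ∑ j, f (P.label j) = ∑ l, f l := by
  rw [Fintype.sum_sum_type, P.sum_eq_sum_Jseq_add]
  rfl

theorem sum_JPlus {M : Type*} [AddCommMonoid M] (P : IBVP n) (f : Fin (2 * n) → M) :
    ∑ j ∈ P.JPlus, f (P.label j) = ∑ r, f (labelLeft r) := by
  rw [JPlus, Finset.sum_filter, P.sum_label fun l => if Odd (l : ℕ) then f l else 0, sum_labels]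
  simp [odd_labelLeft, Nat.not_odd_iff_even.2 (even_labelRight _)]

theorem sum_JMinus {M : Type*} [AddCommMonoid M] (P : IBVP n) (f : Fin (2 * n) → M) :
    ∑ j ∈ P.JMinus, f (P.label j) = ∑ r, f (labelRight r) := by
  rw [JMinus, Finset.sum_filter, P.sum_label fun l => if Even (l : ℕ) then f l else 0, sum_labels]
  simp [even_labelRight, Nat.not_even_iff_odd.2 (odd_labelLeft _)]

theorem IsSolution.integrandSum_eq (hq : P.IsSolution q) {ρ : ℂ} (hρ : P.DeltaP ρ ≠ 0)
    (S : Finset (Fin n ⊕ Fin n)) :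
    P.integrandSum q S ρ =
      ∑ j ∈ S, P.c (ord (P.label j)) ρ * P.tTransform (boundaryFun q (P.label j)) ρ := by
  refine Finset.sum_congr rfl fun j _ => ?_
  rw [div_eq_iff hρ, zeta, eta]
  linear_combination P.c (ord (P.label j)) ρ * hq.zetaHat_sub_etaHat ρ j

/-- The transforms of the boundary values at `x = e`, weighted as in the global relation. -/
noncomputable def boundarySum (P : IBVP n) (q : ℝ → ℝ → ℂ) (e τ : ℝ) (ρ : ℂ) : ℂ :=
  ∑ j : Fin n, P.c j ρ * P.partialTransform τ (dx j q e) ρ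

/-- Since J⁺ collects exactly the labels of values at x = 0, the sum of quotients collapses to an
expression in ρ without any denominator. -/
theorem IsSolution.integrandSum_JPlus (hq : P.IsSolution q) {ρ : ℂ} (hρ : P.DeltaP ρ ≠ 0) :
    P.integrandSum q P.JPlus ρ = P.boundarySum q 0 P.T ρ := by
  rw [hq.integrandSum_eq hρ, P.sum_JPlus fun l => P.c (ord l) ρ * P.tTransform (boundaryFun q l) ρ]
  simp only [ord_labelLeft, boundaryFun_labelLeft]
  rfl

theorem IsSolution.integrandSum_JMinus (hq : P.IsSolution q) {ρ : ℂ} (hρ : P.DeltaP ρ ≠ 0) :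
    P.integrandSum q P.JMinus ρ = P.boundarySum q 1 P.T ρ := by
  rw [hq.integrandSum_eq hρ,
    P.sum_JMinus fun l => P.c (ord l) ρ * P.tTransform (boundaryFun q l) ρ]
  simp only [ord_labelRight, boundaryFun_labelRight]
  rfl

theorem IsSolution.exp_mul_fourierTransform (hq : P.IsSolution q) (ρ : ℂ) {τ : ℝ}
    (hτ : τ ∈ Set.Icc 0 P.T) :
    Complex.exp (P.a * ρ ^ n * τ) * fourierTransform (fun x => q x τ) ρ =
      fourierTransform P.q₀ ρ - P.boundarySum q 0 τ ρ
        + Complex.exp (-Complex.I * ρ) * P.boundarySum q 1 τ ρ := by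
  have := hq.global_relation ρ hτ
  simp only [mul_sub, Finset.sum_sub_distrib] at this
  rw [boundarySum, boundarySum, Finset.mul_sum]
  have h2 : ∑ j : Fin n, P.c j ρ * (Complex.exp (-Complex.I * ρ) *
      P.partialTransform τ (dx j q 1) ρ) = ∑ j : Fin n, Complex.exp (-Complex.I * ρ) *
      (P.c j ρ * P.partialTransform τ (dx j q 1) ρ) :=
    Finset.sum_congr rfl fun j _ => by ring
  rw [h2] at this
  linear_combination (-1 : ℂ) * this

end IBVP

/-! ### Integrals along rays -/

/-- The integral of `f` along the segment from `0` to `Re^{iφ}`. -/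
noncomputable def rayIntegral (f : ℂ → ℂ) (φ R : ℝ) : ℂ :=
  ∫ r in (0 : ℝ)..R, f (r * Complex.exp (φ * Complex.I)) * Complex.exp (φ * Complex.I)

theorem continuous_rayIntegrand {f : ℂ → ℂ} (hf : Continuous f) (φ : ℝ) :
    Continuous fun r : ℝ => f (r * Complex.exp (φ * Complex.I)) * Complex.exp (φ * Complex.I) := by
  fun_prop

theorem rayIntegral_add {f g : ℂ → ℂ} (hf : Continuous f) (hg : Continuous g) (φ R : ℝ) :
    rayIntegral (fun z => f z + g z) φ R = rayIntegral f φ R + rayIntegral g φ R := by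
  simp only [rayIntegral, add_mul]
  exact intervalIntegral.integral_add ((continuous_rayIntegrand hf φ).intervalIntegrable _ _)
    ((continuous_rayIntegrand hg φ).intervalIntegrable _ _)

theorem rayIntegral_sub {f g : ℂ → ℂ} (hf : Continuous f) (hg : Continuous g) (φ R : ℝ) :
    rayIntegral (fun z => f z - g z) φ R = rayIntegral f φ R - rayIntegral g φ R := by
  simp only [rayIntegral, sub_mul]
  exact intervalIntegral.integral_sub ((continuous_rayIntegrand hf φ).intervalIntegrable _ _)
    ((continuous_rayIntegrand hg φ).intervalIntegrable _ _)

theorem hasDerivAt_exp_mul_I (φ : ℝ) :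
    HasDerivAt (fun φ : ℝ => Complex.exp (φ * Complex.I))
      (Complex.exp (φ * Complex.I) * Complex.I) φ := by
  simpa using (((hasDerivAt_id φ).ofReal_comp).mul_const Complex.I).cexp

/-- Dominated convergence: sin vanishes only on a countable set, so the integrand tends to 0 almost
everywhere. No lower bound for sin is needed, and the angular interval is arbitrary. -/
theorem tendsto_integral_exp_neg_mul_sin (C d φ₁ φ₂ : ℝ) (hd : 0 < d) :
    Filter.Tendsto (fun R : ℝ => ∫ φ in φ₁..φ₂, C * Real.exp (-(R * d * |Real.sin φ|)))
      Filter.atTop (𝓝 0) := by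
  have h : Filter.Tendsto (fun R : ℝ => ∫ φ in φ₁..φ₂, C * Real.exp (-(R * d * |Real.sin φ|)))
      Filter.atTop (𝓝 (∫ _ in φ₁..φ₂, 0)) := by
    apply intervalIntegral.tendsto_integral_filter_of_dominated_convergence (fun _ => |C|)
    · refine Filter.Eventually.of_forall fun R => Continuous.aestronglyMeasurable ?_
      fun_prop
    · filter_upwards [Filter.eventually_ge_atTop 0] with R hR
      refine Filter.Eventually.of_forall fun φ _ => ?_
      rw [Real.norm_eq_abs, abs_mul, Real.abs_exp]
      exact mul_le_of_le_one_right (abs_nonneg C) (Real.exp_le_one_iff.2 (by simp; positivity))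
    · exact intervalIntegrable_const
    · have hc : (Set.range fun k : ℤ => (k : ℝ) * Real.pi).Countable := Set.countable_range _
      filter_upwards [hc.ae_notMem MeasureTheory.volume] with φ hφ _
      have hs : 0 < |Real.sin φ| := by
        rw [abs_pos]
        intro h0
        obtain ⟨k, hk⟩ := Real.sin_eq_zero_iff.1 h0
        exact hφ ⟨k, hk⟩
      rw [← mul_zero C]
      refine (Real.tendsto_exp_neg_atTop_nhds_zero.comp ?_).const_mul C
      simp only [mul_assoc]
      exact Filter.tendsto_id.atTop_mul_const (by positivity)
  simpa using h

/-- Jordan's lemma: the integrals of an entire function along two rays agree in the limit if it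
decays on the arcs between them. -/
theorem tendsto_rayIntegral_sub {g : ℂ → ℂ} (hg : Differentiable ℂ g) {φ₁ φ₂ C d R₀ : ℝ}
    (hφ : φ₁ ≤ φ₂) (hd : 0 < d)
    (hb : ∀ R ≥ R₀, ∀ φ ∈ Set.Icc φ₁ φ₂, ‖g (R * Complex.exp (φ * Complex.I))‖ ≤
      C / R * Real.exp (-(R * d * |Real.sin φ|))) :
    Filter.Tendsto (fun R => rayIntegral g φ₁ R - rayIntegral g φ₂ R) Filter.atTop (𝓝 0) := by
  -- An entire function has a primitive. The two ray integrals are then differences of its values,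
  -- and subtracting them leaves the arc between the rays.
  obtain ⟨G, hG⟩ := hg.isExactOn_univ
  have hG' : ∀ z, HasDerivAt G (g z) z := fun z => hG z (Set.mem_univ z)
  have hray : ∀ φ R : ℝ, rayIntegral g φ R = G (R * Complex.exp (φ * Complex.I)) - G 0 := by
    intro φ R
    have : ∀ r : ℝ, HasDerivAt (fun r : ℝ => G (r * Complex.exp (φ * Complex.I)))
        (g (r * Complex.exp (φ * Complex.I)) * Complex.exp (φ * Complex.I)) r := fun r => by
      have h1 : HasDerivAt (fun r : ℝ => (r : ℂ) * Complex.exp (φ * Complex.I))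
          (Complex.exp (φ * Complex.I)) r := by
        simpa using ((hasDerivAt_id r).ofReal_comp).mul_const (Complex.exp (φ * Complex.I))
      exact (hG' _).comp r h1
    rw [rayIntegral, intervalIntegral.integral_eq_sub_of_hasDerivAt (fun r _ => this r)
      ((continuous_rayIntegrand hg.continuous φ).intervalIntegrable _ _)]
    simp
  have harc : ∀ R : ℝ, G (R * Complex.exp (φ₂ * Complex.I)) - G (R * Complex.exp (φ₁ * Complex.I)) =
      ∫ φ in φ₁..φ₂, g (R * Complex.exp (φ * Complex.I)) *
        (R * (Complex.exp (φ * Complex.I) * Complex.I)) := by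
    intro R
    have : ∀ φ : ℝ, HasDerivAt (fun φ : ℝ => G (R * Complex.exp (φ * Complex.I)))
        (g (R * Complex.exp (φ * Complex.I)) * (R * (Complex.exp (φ * Complex.I) * Complex.I)))
        φ := fun φ => (hG' _).comp φ ((hasDerivAt_exp_mul_I φ).const_mul (R : ℂ))
    have hgc := hg.continuous
    rw [intervalIntegral.integral_eq_sub_of_hasDerivAt (fun φ _ => this φ)
      (Continuous.intervalIntegrable (by fun_prop) _ _)]
  -- The factor 1/R in the assumed bound compensates the factor R from the arc length.
  refine squeeze_zero_norm' ?_ (tendsto_integral_exp_neg_mul_sin C d φ₁ φ₂ hd)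
  filter_upwards [Filter.eventually_ge_atTop R₀, Filter.eventually_gt_atTop 0] with R hR hR0
  rw [hray, hray, sub_sub_sub_cancel_right, norm_sub_rev, harc]
  refine intervalIntegral.norm_integral_le_of_norm_le hφ ?_
    (Continuous.intervalIntegrable (by fun_prop) _ _)
  refine Filter.Eventually.of_forall fun φ hφ' => ?_
  have h := hb R hR φ ⟨hφ'.1.le, hφ'.2⟩
  rw [norm_mul, norm_mul, norm_mul, Complex.norm_exp_ofReal_mul_I, Complex.norm_I, mul_one, mul_one,
    Complex.norm_real, Real.norm_of_nonneg hR0.le]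
  calc _ ≤ C / R * Real.exp (-(R * d * |Real.sin φ|)) * R := by gcongr
    _ = _ := by field_simp

namespace IBVP

variable {n : ℕ} (P : IBVP n)

/-! ### The sectors -/

/-- The closed gap just before the m-th sector of D. The index is a natural number because n + 1
gaps are needed: the one around the positive real axis occurs at m = 0 and again, shifted by 2π, at
m = n. -/
theorem cos_nonneg_gap (m : ℕ) {φ : ℝ} (h₁ : (-(Real.pi / 2) - P.a.arg + 2 * Real.pi * m) / n ≤ φ)
    (h₂ : φ ≤ (Real.pi / 2 - P.a.arg + 2 * Real.pi * m) / n) :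
    0 ≤ Real.cos (P.a.arg + n * φ) := by
  have hn : (0 : ℝ) < n := by exact_mod_cast P.n_pos
  rw [div_le_iff₀ hn] at h₁
  rw [le_div_iff₀ hn] at h₂
  rw [← Real.cos_sub_nat_mul_two_pi _ m]
  apply Real.cos_nonneg_of_mem_Icc
  constructor <;> nlinarith

theorem cos_nonpos_sector (m : Fin n) {φ : ℝ} (h₁ : P.startAngle m ≤ φ) (h₂ : φ ≤ P.endAngle m) :
    Real.cos (P.a.arg + n * φ) ≤ 0 := by
  have hn : (0 : ℝ) < n := by exact_mod_cast P.n_pos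
  rw [startAngle, div_le_iff₀ hn] at h₁
  rw [endAngle, le_div_iff₀ hn] at h₂
  rw [← Real.cos_sub_nat_mul_two_pi _ m]
  apply Real.cos_nonpos_of_pi_div_two_le_of_le <;> nlinarith

theorem startAngle_lt_endAngle (m : Fin n) : P.startAngle m < P.endAngle m := by
  have hn : (0 : ℝ) < n := by exact_mod_cast P.n_pos
  rw [startAngle, endAngle]
  gcongr
  linarith [Real.pi_pos]

theorem startAngle_nonneg (m : Fin n) : 0 ≤ P.startAngle m := by
  have hpi := Real.pi_pos
  have ha := (abs_le.1 P.a_eq.2.1).2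
  rw [startAngle]
  refine div_nonneg ?_ (Nat.cast_nonneg n)
  have : 0 ≤ 2 * Real.pi * ((m : ℕ) : ℝ) := by positivity
  linarith

theorem endAngle_le (m : Fin n) : P.endAngle m ≤ 2 * Real.pi := by
  have hpi := Real.pi_pos
  have hn : (0 : ℝ) < n := by exact_mod_cast P.n_pos
  have ha := (abs_le.1 P.a_eq.2.1).1
  have hm : ((m : ℕ) : ℝ) + 1 ≤ n := by exact_mod_cast m.2
  rw [endAngle, div_le_iff₀ hn]
  nlinarith

theorem endAngle_le_pi_or (m : Fin n) : P.endAngle m ≤ Real.pi ∨ Real.pi ≤ P.startAngle m := by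
  by_contra! h
  exact absurd (P.cos_neg_of_mem m Real.pi h.2 h.1) (not_lt.2 P.a_eq.2.2)

theorem sector_nonempty_mid (m : Fin n) :
    Complex.exp ((((P.startAngle m + P.endAngle m) / 2 : ℝ) : ℂ) * Complex.I) ∈ P.sector m := by
  have := P.startAngle_lt_endAngle m
  exact ⟨1, (P.startAngle m + P.endAngle m) / 2, one_pos, by linarith, by linarith, by simp⟩

theorem sector_subset_DPlus_iff (m : Fin n) : P.sector m ⊆ P.DPlus ↔ P.endAngle m ≤ Real.pi := by
  have h0 := P.startAngle_nonneg m
  have hlt := P.startAngle_lt_endAngle m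
  have h2 := P.endAngle_le m
  have hmem := P.sector_nonempty_mid m
  constructor
  · intro h
    rcases P.endAngle_le_pi_or m with h' | h'
    · exact h'
    · have : 0 < (Complex.exp ((((P.startAngle m + P.endAngle m) / 2 : ℝ) : ℂ) * Complex.I)).im :=
        (h hmem).2
      rw [Complex.exp_ofReal_mul_I_im, ← Real.sin_sub_two_pi] at this
      exact absurd this (not_lt.2 (Real.sin_nonpos_of_nonpos_of_neg_pi_le (by linarith)
        (by linarith)))
  · intro h
    rcases P.sector_subset m with h' | h'
    · exact h'
    · have : (Complex.exp ((((P.startAngle m + P.endAngle m) / 2 : ℝ) : ℂ) * Complex.I)).im < 0 :=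
        (h' hmem).2
      rw [Complex.exp_ofReal_mul_I_im] at this
      exact absurd this (not_lt.2 (Real.sin_nonneg_of_nonneg_of_le_pi (by linarith)
        (by linarith)))

theorem sector_subset_DMinus_iff (m : Fin n) :
    P.sector m ⊆ P.DMinus ↔ Real.pi ≤ P.startAngle m := by
  have hlt := P.startAngle_lt_endAngle m
  have hmem := P.sector_nonempty_mid m
  have hp := P.sector_subset_DPlus_iff m
  constructor
  · intro h
    rcases P.endAngle_le_pi_or m with h' | h'
    · exact absurd (show _ < (0 : ℝ) from (h hmem).2)
        (not_lt.2 (show (0 : ℝ) < _ from (hp.2 h' hmem).2).le)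
    · exact h'
  · intro h
    rcases P.sector_subset m with h' | h'
    · linarith [hp.1 h']
    · exact h'

/-- Deformation of a half line pair to the boundary of the sectors between them. -/
theorem tendsto_sub_sum_sectors {lo hi : ℝ} (h0 : 0 ≤ lo) (hlohi : lo ≤ hi) (h2 : hi ≤ 2 * Real.pi)
    {S : Finset (Fin n)} (hS : ∀ m ∈ S, lo ≤ P.startAngle m ∧ P.endAngle m ≤ hi)
    (hS' : ∀ m ∉ S, P.endAngle m ≤ lo ∨ hi ≤ P.startAngle m) (F : ℝ → ℝ → ℂ)
    (hF : ∀ φ₁ φ₂, lo ≤ φ₁ → φ₁ ≤ φ₂ → φ₂ ≤ hi →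
      (∀ φ ∈ Set.Icc φ₁ φ₂, 0 ≤ Real.cos (P.a.arg + n * φ)) →
      Filter.Tendsto (fun R => F φ₁ R - F φ₂ R) Filter.atTop (𝓝 0)) :
    Filter.Tendsto (fun R => F lo R - F hi R
      - ∑ m ∈ S, (F (P.startAngle m) R - F (P.endAngle m) R)) Filter.atTop (𝓝 0) := by
  have hpi := Real.pi_pos
  have hn : (0 : ℝ) < n := by exact_mod_cast P.n_pos
  have ha := abs_le.1 P.a_eq.2.1
  set s : ℕ → ℝ := fun m => (Real.pi / 2 - P.a.arg + 2 * Real.pi * m) / n with hs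
  set e : ℕ → ℝ := fun m => (-(Real.pi / 2) - P.a.arg + 2 * Real.pi * m) / n with he
  have hse : ∀ m : ℕ, e m ≤ s m := fun m => by
    simp only [hs, he]
    gcongr
    linarith
  have hsm : ∀ m : Fin n, s m = P.startAngle m := fun m => rfl
  have hem : ∀ m : Fin n, e (m + 1) = P.endAngle m := fun m => by
    simp only [he, endAngle]
    push_cast
    ring
  -- Clamping angles to [lo, hi] collapses sectors and gaps outside this range to a single ray and
  -- truncates the gaps that straddle an end. No case distinction on the position of the real axis
  -- is then needed.
  set cl : ℝ → ℝ := fun φ => max lo (min hi φ) with hcl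
  have cl_lo : ∀ φ, φ ≤ lo → cl φ = lo := fun φ h => max_eq_left ((min_le_right _ _).trans h)
  have cl_hi : ∀ φ, hi ≤ φ → cl φ = hi := fun φ h => by
    simp only [hcl, min_eq_left h, max_eq_right hlohi]
  have cl_mid : ∀ φ, lo ≤ φ → φ ≤ hi → cl φ = φ := fun φ h h' => by
    simp only [hcl, min_eq_right h', max_eq_right h]
  have cl_mono : Monotone cl := fun a b hab => max_le_max le_rfl (min_le_min le_rfl hab)
  have lo_cl : ∀ φ, lo ≤ cl φ := fun φ => le_max_left _ _
  have cl_le_hi : ∀ φ, cl φ ≤ hi := fun φ => max_le hlohi (min_le_left _ _)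
  have hgap : ∀ m : ℕ, Filter.Tendsto (fun R => F (cl (e m)) R - F (cl (s m)) R)
      Filter.atTop (𝓝 0) := by
    intro m
    rcases le_or_gt hi (e m) with h | h
    · simp only [cl_hi _ h, cl_hi _ (h.trans (hse m)), sub_self, tendsto_const_nhds_iff]
    rcases le_or_gt (s m) lo with h' | h'
    · simp only [cl_lo _ h', cl_lo _ ((hse m).trans h'), sub_self, tendsto_const_nhds_iff]
    refine hF _ _ (lo_cl _) (cl_mono (hse m)) (cl_le_hi _) fun φ hφ => ?_
    refine P.cos_nonneg_gap m ?_ ?_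
    · refine le_trans ?_ hφ.1
      simp only [hcl, min_eq_right h.le]
      exact le_max_right _ _
    · refine hφ.2.trans ?_
      simp only [hcl]
      exact max_le h'.le (min_le_right _ _)
  -- Sectors and gaps alternate from lo to hi, so the difference between the end rays telescopes.
  -- Removing the sectors leaves the gaps, each of which contributes 0 in the limit. The bound |arg
  -- a| ≤ π/2 puts the first gap's start at or below 0 and the last gap's end at or above 2π.
  have htel : ∀ R, F lo R - F hi R - ∑ m ∈ S, (F (P.startAngle m) R - F (P.endAngle m) R) =
      ∑ m ∈ Finset.range (n + 1), (F (cl (e m)) R - F (cl (s m)) R) := by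
    intro R
    have h1 : ∑ m ∈ S, (F (P.startAngle m) R - F (P.endAngle m) R) =
        ∑ m ∈ Finset.range n, (F (cl (s m)) R - F (cl (e (m + 1))) R) := by
      rw [← Fin.sum_univ_eq_sum_range (fun m => F (cl (s m)) R - F (cl (e (m + 1))) R)]
      rw [← Finset.sum_subset (Finset.subset_univ S)]
      · refine Finset.sum_congr rfl fun m hm => ?_
        have := hS m hm
        have hlt := P.startAngle_lt_endAngle m
        rw [hem, hsm, cl_mid _ this.1 (by linarith), cl_mid _ (by linarith) this.2]
      · intro m _ hm
        have hlt := P.startAngle_lt_endAngle m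
        rw [hem, hsm]
        rcases hS' m hm with h | h
        · rw [cl_lo _ h, cl_lo _ (by linarith), sub_self]
        · rw [cl_hi _ h, cl_hi _ (by linarith), sub_self]
    have e0 : cl (e 0) = lo := by
      apply cl_lo
      refine le_trans ?_ h0
      simp only [he]
      exact div_nonpos_of_nonpos_of_nonneg (by simp; linarith) hn.le
    have sn : cl (s n) = hi := by
      apply cl_hi
      refine h2.trans ?_
      simp only [hs]
      rw [le_div_iff₀ hn]
      linarith
    rw [h1, Finset.sum_range_succ, sn]
    have h3 := Finset.sum_range_sub' (fun m => F (cl (e m)) R) n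
    rw [e0] at h3
    have h4 : ∑ m ∈ Finset.range n, (F (cl (e m)) R - F (cl (e (m + 1))) R) =
        ∑ m ∈ Finset.range n, (F (cl (e m)) R - F (cl (s m)) R) +
        ∑ m ∈ Finset.range n, (F (cl (s m)) R - F (cl (e (m + 1))) R) := by
      rw [← Finset.sum_add_distrib]
      exact Finset.sum_congr rfl fun m _ => by ring
    linear_combination (-1 : ℂ) * h3 + h4
  simp only [htel]
  simpa using tendsto_finsetSum (Finset.range (n + 1)) fun m _ => hgap m

end IBVP

/-! ### Pointwise Fourier inversion on `[0,1]` -/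

theorem continuous_fourierTransform {f : ℝ → ℂ} (hf : ContinuousOn f (Set.Icc 0 1)) :
    Continuous (IBVP.fourierTransform f) := by
  rw [← continuousOn_univ]
  refine ContinuousOn.intervalIntegral_parametric zero_le_one ?_
  have h2 : Continuous fun p : ℂ × ℝ => Complex.exp (-Complex.I * p.1 * p.2) := by fun_prop
  exact h2.continuousOn.mul (hf.comp continuous_snd.continuousOn fun p hp => hp.2)

theorem rayIntegral_zero_sub_rayIntegral_pi {g : ℂ → ℂ} (hg : Continuous g) (R : ℝ) :
    rayIntegral g 0 R - rayIntegral g Real.pi R = ∫ r in (-R)..R, g r := by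
  have hi : ∀ a b : ℝ, IntervalIntegrable (fun r : ℝ => g r) MeasureTheory.volume a b := fun a b =>
    Continuous.intervalIntegrable (by fun_prop) _ _
  have h1 : rayIntegral g Real.pi R = -∫ r in (-R)..0, g r := by
    rw [rayIntegral, Complex.exp_pi_mul_I]
    have := intervalIntegral.integral_comp_neg (a := 0) (b := R) (fun r : ℝ => g r)
    simp only [mul_neg, mul_one, intervalIntegral.integral_neg]
    rw [neg_zero] at this
    rw [← this]
    simp
  rw [h1, sub_neg_eq_add, ← intervalIntegral.integral_add_adjacent_intervals (hi (-R) 0) (hi 0 R),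
    add_comm]
  simp [rayIntegral]

/-- The Riemann–Lebesgue lemma for the extension of w by zero, with the frequency rescaled by 2π. -/
theorem fourierTransform_tendsto_zero {w : ℝ → ℂ} :
    Filter.Tendsto (fun R : ℝ => IBVP.fourierTransform w R) (Filter.cocompact ℝ) (𝓝 0) := by
  have h := Real.tendsto_integral_exp_smul_cocompact ((Set.Ioc (0 : ℝ) 1).indicator w)
  have hc : Filter.Tendsto (fun R : ℝ => R * (2 * Real.pi)⁻¹) (Filter.cocompact ℝ)
      (Filter.cocompact ℝ) :=
    (Homeomorph.mulRight₀ (2 * Real.pi)⁻¹ (by positivity)).isClosedEmbedding.tendsto_cocompact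
  refine (h.comp hc).congr fun R => ?_
  simp only [Function.comp, IBVP.fourierTransform]
  rw [intervalIntegral.integral_of_le zero_le_one,
    ← MeasureTheory.integral_indicator measurableSet_Ioc]
  congr 1
  ext y
  by_cases hy : y ∈ Set.Ioc (0 : ℝ) 1
  · rw [Set.indicator_of_mem hy, Set.indicator_of_mem hy, Circle.smul_def, Real.fourierChar_apply,
      smul_eq_mul]
    congr 2
    push_cast
    field_simp
  · rw [Set.indicator_of_notMem hy, Set.indicator_of_notMem hy, smul_zero]

/-- The symmetric Fourier integral of a function with a removable zero at `x`. -/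
theorem tendsto_integral_fourierTransform_sub_mul {w : ℝ → ℂ} (hw : ContinuousOn w (Set.Icc 0 1))
    (x : ℝ) :
    Filter.Tendsto (fun R : ℝ => ∫ r in (-R)..R, Complex.exp (Complex.I * r * x) *
      IBVP.fourierTransform (fun y => ((y - x : ℝ) : ℂ) * w y) r) Filter.atTop (𝓝 0) := by
  -- The factor y − x makes the integrand an exact r-derivative, namely that of i·e^{ir(x−y)}·w(y).
  -- After exchanging the integrals only the transform of w at ±R remains, to which Riemann–Lebesgue
  -- applies.
  have hF : ∀ R : ℝ, 0 ≤ R → ∫ r in (-R)..R, Complex.exp (Complex.I * r * x) *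
      IBVP.fourierTransform (fun y => ((y - x : ℝ) : ℂ) * w y) r =
      Complex.I * (Complex.exp (Complex.I * R * x) * IBVP.fourierTransform w R -
        Complex.exp (-(Complex.I * R * x)) * IBVP.fourierTransform w (-R)) := by
    intro R hR
    unfold IBVP.fourierTransform
    simp only [← intervalIntegral.integral_const_mul]
    rw [MeasureTheory.intervalIntegral_intervalIntegral_swap]
    · have hec : ∀ s : ℂ, Continuous fun y : ℝ => Complex.exp (-Complex.I * s * y) :=
        fun s => by fun_prop
      rw [← intervalIntegral.integral_sub, ← intervalIntegral.integral_const_mul]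
      · refine intervalIntegral.integral_congr fun y _ => ?_
        have hd : ∀ r : ℝ, HasDerivAt (fun r : ℝ => Complex.I * Complex.exp (Complex.I * r * (x - y)))
            (((y - x : ℝ) : ℂ) * Complex.exp (Complex.I * r * (x - y))) r := fun r => by
          have h := ((((hasDerivAt_id r).ofReal_comp).const_mul Complex.I).mul_const
            ((x : ℂ) - y)).cexp.const_mul Complex.I
          refine h.congr_deriv ?_
          push_cast
          simp only [id]
          linear_combination (Complex.exp (Complex.I * r * (x - y)) * (x - y)) * Complex.I_mul_I
        have h1 : ∀ r : ℝ, Complex.exp (Complex.I * r * x) * (Complex.exp (-Complex.I * r * y) *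
            (((y - x : ℝ) : ℂ) * w y)) = w y * (((y - x : ℝ) : ℂ) *
            Complex.exp (Complex.I * r * (x - y))) := fun r => by
          rw [show Complex.I * r * ((x : ℂ) - y) = Complex.I * r * x + -Complex.I * r * y by ring,
            Complex.exp_add]
          ring
        simp only [h1]
        rw [intervalIntegral.integral_const_mul,
          intervalIntegral.integral_eq_sub_of_hasDerivAt (fun r _ => hd r)
            (Continuous.intervalIntegrable (by fun_prop) _ _)]
        push_cast
        rw [show Complex.I * R * ((x : ℂ) - y) = Complex.I * R * x + -Complex.I * R * y by ring,
          show Complex.I * -R * ((x : ℂ) - y) = -(Complex.I * R * x) + -Complex.I * -R * y by ring,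
          Complex.exp_add, Complex.exp_add]
        ring
      all_goals exact (continuousOn_const.mul
        ((hec _).continuousOn.mul hw)).intervalIntegrable_of_Icc zero_le_one
    · have hw' : ContinuousOn (fun p : ℝ × ℝ => w p.2) (Set.Icc (-R) R ×ˢ Set.Icc 0 1) :=
        hw.comp continuous_snd.continuousOn fun p hp => hp.2
      have h1 : Continuous fun p : ℝ × ℝ => Complex.exp (Complex.I * p.1 * x) := by fun_prop
      have h2 : Continuous fun p : ℝ × ℝ => Complex.exp (-Complex.I * p.1 * p.2) := by fun_prop
      have h3 : Continuous fun p : ℝ × ℝ => ((p.2 - x : ℝ) : ℂ) := by fun_prop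
      refine ((h1.continuousOn.mul (h2.continuousOn.mul
        (h3.continuousOn.mul hw'))).integrableOn_compact
        (isCompact_Icc.prod isCompact_Icc)).mono_set ?_
      rw [Set.uIoc_of_le zero_le_one, Set.uIoc_of_le (by linarith)]
      exact Set.prod_mono Set.Ioc_subset_Icc_self Set.Ioc_subset_Icc_self
  have hp : Filter.Tendsto (fun R : ℝ => IBVP.fourierTransform w R) Filter.atTop (𝓝 0) :=
    fourierTransform_tendsto_zero.mono_left
      (by rw [cocompact_eq_atBot_atTop]; exact le_sup_right)
  have hm : Filter.Tendsto (fun R : ℝ => IBVP.fourierTransform w (-R)) Filter.atTop (𝓝 0) := by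
    have := (fourierTransform_tendsto_zero (w := w)).mono_left
      (show Filter.atBot ≤ _ by rw [cocompact_eq_atBot_atTop]; exact le_sup_left)
    simpa [Function.comp_def] using this.comp Filter.tendsto_neg_atTop_atBot
  have hsum := hp.norm.add hm.norm
  simp only [norm_zero, add_zero] at hsum
  refine squeeze_zero_norm' ?_ hsum
  filter_upwards [Filter.eventually_ge_atTop 0] with R hR
  rw [hF R hR, norm_mul, Complex.norm_I, one_mul]
  refine (norm_sub_le _ _).trans (le_of_eq ?_)
  rw [norm_mul, norm_mul, Complex.norm_exp, Complex.norm_exp]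
  simp

-- A smooth function with compact support is Schwartz, so its Fourier transform is integrable and
-- the inversion theorem applies. The substitution r = 2πξ produces the factor 2π.
open FourierTransform in
theorem tendsto_integral_fourierTransform_of_compactSupport {ψ : ℝ → ℂ} (hψ : ContDiff ℝ ∞ ψ)
    (hs : tsupport ψ ⊆ Set.Ioo 0 1) (x : ℝ) :
    Filter.Tendsto (fun R : ℝ => ∫ r in (-R)..R, Complex.exp (Complex.I * r * x) *
      IBVP.fourierTransform ψ r) Filter.atTop (𝓝 (2 * Real.pi * ψ x)) := by
  have hcs : HasCompactSupport ψ :=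
    isCompact_Icc.of_isClosed_subset (isClosed_tsupport ψ) (hs.trans Set.Ioo_subset_Icc_self)
  let Ψ := hcs.toSchwartzMap hψ
  have hΨ : ⇑Ψ = ψ := rfl
  have hFi : MeasureTheory.Integrable (𝓕 ψ) := by
    have := (𝓕 Ψ).integrable (μ := MeasureTheory.volume)
    rwa [SchwartzMap.fourier_coe, hΨ] at this
  have hψi : MeasureTheory.Integrable ψ := hψ.continuous.integrable_of_hasCompactSupport hcs
  have hinv := congrFun (hψ.continuous.fourierInv_fourier_eq hψi hFi) x
  have hFT : ∀ r : ℝ, IBVP.fourierTransform ψ r = 𝓕 ψ (r / (2 * Real.pi)) := by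
    intro r
    rw [IBVP.fourierTransform, intervalIntegral.integral_of_le zero_le_one, Real.fourier_eq',
      MeasureTheory.setIntegral_eq_integral_of_forall_compl_eq_zero]
    · congr 1
      ext y
      rw [smul_eq_mul]
      congr 2
      simp
      field_simp
    · intro y hy
      have : ψ y = 0 := by
        by_contra h
        exact hy (Set.Ioo_subset_Ioc_self (hs (subset_tsupport ψ h)))
      rw [this, mul_zero]
  have h1 : ∀ r : ℝ, Complex.exp (Complex.I * r * x) * IBVP.fourierTransform ψ r =
      (fun ξ : ℝ => Complex.exp (((2 * Real.pi * ξ * x : ℝ) : ℂ) * Complex.I) * 𝓕 ψ ξ)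
        (r / (2 * Real.pi)) := by
    intro r
    simp only [hFT]
    congr 2
    push_cast
    field_simp
  simp only [h1]
  have hi : MeasureTheory.Integrable (fun ξ : ℝ => Complex.exp (((2 * Real.pi * ξ * x : ℝ) : ℂ) *
      Complex.I) * 𝓕 ψ ξ) := by
    refine hFi.bdd_mul (c := 1) (Continuous.aestronglyMeasurable (by fun_prop)) ?_
    exact Filter.Eventually.of_forall fun ξ => by rw [Complex.norm_exp_ofReal_mul_I]
  have h2 : Filter.Tendsto (fun R : ℝ => R / (2 * Real.pi)) Filter.atTop Filter.atTop :=
    Filter.tendsto_id.atTop_div_const (by positivity)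
  have h3 : Filter.Tendsto (fun R : ℝ => -R / (2 * Real.pi)) Filter.atTop Filter.atBot :=
    Filter.tendsto_neg_atTop_atBot.atBot_div_const (by positivity)
  have h4 := (MeasureTheory.intervalIntegral_tendsto_integral hi h3 h2).const_mul
    (2 * Real.pi : ℂ)
  have h5 : ∫ ξ : ℝ, Complex.exp (((2 * Real.pi * ξ * x : ℝ) : ℂ) * Complex.I) * 𝓕 ψ ξ = ψ x := by
    rw [← hinv, Real.fourierInv_eq']
    congr 1
    ext ξ
    rw [smul_eq_mul]
    congr 3
    simp
    ring
  rw [h5] at h4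
  refine h4.congr fun R => ?_
  rw [intervalIntegral.integral_comp_div (a := -R) (b := R)
    (fun ξ : ℝ => Complex.exp (((2 * Real.pi * ξ * x : ℝ) : ℂ) * Complex.I) * 𝓕 ψ ξ)
    (by positivity : (2 * Real.pi) ≠ 0), Complex.real_smul]
  push_cast
  rfl

theorem fourierTransform_add {f g : ℝ → ℂ} (hf : ContinuousOn f (Set.Icc 0 1))
    (hg : ContinuousOn g (Set.Icc 0 1)) (ρ : ℂ) :
    IBVP.fourierTransform (fun y => f y + g y) ρ =
      IBVP.fourierTransform f ρ + IBVP.fourierTransform g ρ := by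
  have hec : Continuous fun y : ℝ => Complex.exp (-Complex.I * ρ * y) := by fun_prop
  simp only [IBVP.fourierTransform, mul_add]
  exact intervalIntegral.integral_add
    ((hec.continuousOn.mul hf).intervalIntegrable_of_Icc zero_le_one)
    ((hec.continuousOn.mul hg).intervalIntegrable_of_Icc zero_le_one)

/-- Pointwise Fourier inversion at the interior points of `[0,1]`. -/
theorem tendsto_integral_fourierTransform {f : ℝ → ℂ} (hf : ContDiffOn ℝ ∞ f (Set.Icc 0 1))
    {x : ℝ} (hx : x ∈ Set.Ioo (0 : ℝ) 1) :
    Filter.Tendsto (fun R : ℝ => ∫ r in (-R)..R, Complex.exp (Complex.I * r * x) *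
      IBVP.fourierTransform f r) Filter.atTop (𝓝 (2 * Real.pi * f x)) := by
  obtain ⟨ε, hε, hball⟩ := Metric.isOpen_iff.1 isOpen_Ioo x hx
  let b : ContDiffBump x := ⟨ε / 4, ε / 2, by positivity, by linarith⟩
  -- A bump function scaled to agree with f at x. Then f − ψ vanishes at x, and its quotient by y −
  -- x, the `dslope`, is continuous because f is differentiable there. This splits f into the two
  -- cases already inverted.
  set ψ : ℝ → ℂ := fun y => (b y : ℂ) * f x with hψ
  have hψs : ContDiff ℝ ∞ ψ :=
    (Complex.ofRealCLM.contDiff.comp (b.contDiff (n := ⊤))).mul contDiff_const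
  have hbx : b x = 1 := b.one_of_mem_closedBall (by simp [b.rIn_pos.le])
  have hts : tsupport ψ ⊆ Set.Ioo 0 1 := by
    refine subset_trans ?_ hball
    have h1 : tsupport ψ ⊆ tsupport b := by
      refine closure_mono fun y hy => ?_
      simp only [Function.mem_support, hψ] at hy ⊢
      intro h
      simp [h] at hy
    refine h1.trans ?_
    rw [b.tsupport_eq]
    exact Metric.closedBall_subset_ball (show ε / 2 < ε by linarith)
  have hψx : ψ x = f x := by simp [hψ, hbx]
  set w := dslope (fun y => f y - ψ y) x with hw
  have hwc : ContinuousOn w (Set.Icc 0 1) := by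
    rw [hw, continuousOn_dslope (Icc_mem_nhds hx.1 hx.2)]
    refine ⟨hf.continuousOn.sub hψs.continuous.continuousOn, ?_⟩
    exact ((hf.contDiffAt (Icc_mem_nhds hx.1 hx.2)).differentiableAt (by simp)).sub
      (hψs.differentiable (by simp) x)
  have hsplit : ∀ y, f y = ψ y + ((y - x : ℝ) : ℂ) * w y := fun y => by
    have := sub_smul_dslope (fun y => f y - ψ y) x y
    rw [← Complex.real_smul, hw, this, hψx]
    ring
  have hg1 : ContinuousOn (fun y : ℝ => ((y - x : ℝ) : ℂ) * w y) (Set.Icc 0 1) := by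
    refine ContinuousOn.mul (Continuous.continuousOn ?_) hwc
    fun_prop
  have h := (tendsto_integral_fourierTransform_of_compactSupport hψs hts x).add
    (tendsto_integral_fourierTransform_sub_mul hwc x)
  rw [add_zero, hψx] at h
  refine h.congr fun R => ?_
  have hc1 := continuous_fourierTransform hψs.continuous.continuousOn
  have hc2 := continuous_fourierTransform hg1
  rw [← intervalIntegral.integral_add]
  · congr 1
    ext r
    rw [← mul_add, ← fourierTransform_add hψs.continuous.continuousOn hg1]
    congr 2
    ext y
    exact (hsplit y).symm
  · exact Continuous.intervalIntegrable (by fun_prop) _ _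
  · exact Continuous.intervalIntegrable (by fun_prop) _ _

/-! ### Asymptotics of exponential integrals over a bounded interval -/

/-- One integration by parts. The reference time t is chosen so that e^{l(s−t)} is bounded by 1 on
the interval, which makes the constant independent of both l and t. -/
theorem exists_norm_exp_mul_integral_le {u v : ℝ} (huv : u ≤ v) {f f' : ℝ → ℂ}
    (hf : ∀ x ∈ Set.Icc u v, HasDerivWithinAt f (f' x) (Set.Icc u v) x)
    (hf' : ContinuousOn f' (Set.Icc u v)) :
    ∃ C, 0 ≤ C ∧ ∀ l : ℂ, l ≠ 0 → ∀ t : ℝ, (∀ s ∈ Set.Icc u v, (l * (s - t)).re ≤ 0) →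
      ‖Complex.exp (-(l * t)) * ∫ s in u..v, Complex.exp (l * s) * f s‖ ≤ C / ‖l‖ := by
  obtain ⟨M, hM⟩ := isCompact_Icc.exists_bound_of_continuousOn hf'
  have hM0 : 0 ≤ M := (norm_nonneg _).trans (hM u ⟨le_rfl, huv⟩)
  refine ⟨‖f v‖ + ‖f u‖ + M * |v - u|, by positivity, fun l hl t hlt => ?_⟩
  have hE : ∀ s ∈ Set.Icc u v, ‖Complex.exp (-(l * t)) * Complex.exp (l * s)‖ ≤ 1 := fun s hs => by
    rw [← Complex.exp_add, Complex.norm_exp, Real.exp_le_one_iff,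
      show -(l * t) + l * s = l * (s - t) by ring]
    exact hlt s hs
  rw [le_div_iff₀ (norm_pos_iff.2 hl), mul_comm, ← norm_mul,
    show l * (Complex.exp (-(l * t)) * ∫ s in u..v, Complex.exp (l * s) * f s) =
      Complex.exp (-(l * t)) * (l * ∫ s in u..v, Complex.exp (l * s) * f s) by ring,
    mul_integral_cexp_mul huv hf hf', mul_sub, mul_sub, ← intervalIntegral.integral_const_mul]
  refine (norm_sub_le _ _).trans (add_le_add ((norm_sub_le _ _).trans (add_le_add ?_ ?_)) ?_)
  · rw [← mul_assoc, norm_mul]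
    exact mul_le_of_le_one_left (norm_nonneg _) (hE v ⟨huv, le_rfl⟩)
  · rw [← mul_assoc, norm_mul]
    exact mul_le_of_le_one_left (norm_nonneg _) (hE u ⟨le_rfl, huv⟩)
  · refine intervalIntegral.norm_integral_le_of_norm_le_const fun s hs => ?_
    rw [Set.uIoc_of_le huv] at hs
    have hs' := Set.Ioc_subset_Icc_self hs
    rw [← mul_assoc, norm_mul]
    exact (mul_le_of_le_one_left (norm_nonneg _) (hE s hs')).trans (hM s hs')

/-- A second integration by parts. The endpoint terms are only O(1/|l|), which is not absolutely
integrable along a ray, so they are isolated for separate treatment. -/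
theorem exists_norm_exp_mul_integral_sub_le {u v : ℝ} (huv : u < v) {f : ℝ → ℂ}
    (hf : ContDiffOn ℝ ∞ f (Set.Icc u v)) :
    ∃ C, 0 ≤ C ∧ ∀ l : ℂ, l ≠ 0 → ∀ t : ℝ, (∀ s ∈ Set.Icc u v, (l * (s - t)).re ≤ 0) →
      ‖Complex.exp (-(l * t)) * (∫ s in u..v, Complex.exp (l * s) * f s) -
        (Complex.exp (l * (v - t)) * f v - Complex.exp (l * (u - t)) * f u) / l‖ ≤
        C / ‖l‖ ^ 2 := by
  have hu := uniqueDiffOn_Icc huv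
  have hd : ∀ g : ℝ → ℂ, ContDiffOn ℝ ∞ g (Set.Icc u v) → ∀ x ∈ Set.Icc u v,
      HasDerivWithinAt g (derivWithin g (Set.Icc u v) x) (Set.Icc u v) x := fun g hg x hx =>
    (hg.differentiableOn (by simp) x hx).hasDerivWithinAt
  have hs : ∀ g : ℝ → ℂ, ContDiffOn ℝ ∞ g (Set.Icc u v) →
      ContDiffOn ℝ ∞ (derivWithin g (Set.Icc u v)) (Set.Icc u v) := fun g hg =>
    hg.derivWithin hu (by simp)
  obtain ⟨C, hC, h⟩ := exists_norm_exp_mul_integral_le huv.le (hd _ (hs f hf))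
    (hs _ (hs f hf)).continuousOn
  refine ⟨C, hC, fun l hl t hlt => ?_⟩
  have h1 := h l hl t hlt
  have h2 := mul_integral_cexp_mul huv.le (hd f hf) (hs f hf).continuousOn l
  have e1 : Complex.exp (l * (v - t)) = Complex.exp (-(l * t)) * Complex.exp (l * v) := by
    rw [← Complex.exp_add]; ring_nf
  have e2 : Complex.exp (l * (u - t)) = Complex.exp (-(l * t)) * Complex.exp (l * u) := by
    rw [← Complex.exp_add]; ring_nf
  have h3 : Complex.exp (-(l * t)) * (∫ s in u..v, Complex.exp (l * s) * f s) -
        (Complex.exp (l * (v - t)) * f v - Complex.exp (l * (u - t)) * f u) / l =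
      -(Complex.exp (-(l * t)) * ∫ s in u..v, Complex.exp (l * s) *
        derivWithin f (Set.Icc u v) s) / l := by
    rw [eq_div_iff hl, sub_mul, div_mul_cancel₀ _ hl, e1, e2]
    linear_combination Complex.exp (-(l * t)) * h2
  rw [h3, norm_div, norm_neg, div_le_iff₀ (norm_pos_iff.2 hl)]
  refine h1.trans (le_of_eq ?_)
  have := norm_pos_iff.2 hl
  field_simp

/-! ### Uniformly convergent improper integrals -/

/-- The tails of the improper integrals `∫ F x` are `O(1/R)`, uniformly for `x ∈ S`. -/
def UniformTail (S : Set ℝ) (F : ℝ → ℝ → ℂ) : Prop :=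
  ∃ C R₀ : ℝ, 0 < R₀ ∧ ∀ x ∈ S, ∀ R R' : ℝ, R₀ ≤ R → R ≤ R' → ‖∫ r in R..R', F x r‖ ≤ C / R

theorem integral_div_sq_le {C R R' : ℝ} (hC : 0 ≤ C) (hR : 0 < R) (hRR' : R ≤ R') :
    ∫ r in R..R', C / r ^ 2 ≤ C / R := by
  have hd : ∀ r ∈ Set.uIcc R R', HasDerivAt (fun r : ℝ => -(C / r)) (C / r ^ 2) r := fun r hr => by
    rw [Set.uIcc_of_le hRR'] at hr
    have : r ≠ 0 := (hR.trans_le hr.1).ne'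
    have h := ((hasDerivAt_inv this).const_mul C).neg
    simp only [← div_eq_mul_inv] at h
    refine h.congr_deriv ?_
    field_simp
  rw [intervalIntegral.integral_eq_sub_of_hasDerivAt hd]
  · have : 0 ≤ C / R' := div_nonneg hC (hR.le.trans hRR')
    linarith
  · refine ContinuousOn.intervalIntegrable_of_Icc hRR' ?_
    exact continuousOn_const.div (continuous_pow 2).continuousOn
      fun r hr => pow_ne_zero _ (hR.trans_le hr.1).ne'

theorem norm_integral_le_div {F : ℝ → ℂ} {C R R' : ℝ} (hC : 0 ≤ C) (hR : 0 < R) (hRR' : R ≤ R')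
    (h : ∀ r, R ≤ r → ‖F r‖ ≤ C / r ^ 2) : ‖∫ r in R..R', F r‖ ≤ C / R := by
  refine (intervalIntegral.norm_integral_le_of_norm_le hRR'
    (Filter.Eventually.of_forall fun r hr => h r hr.1.le) ?_).trans (integral_div_sq_le hC hR hRR')
  refine ContinuousOn.intervalIntegrable_of_Icc hRR' ?_
  exact continuousOn_const.div (continuous_pow 2).continuousOn
    fun r hr => pow_ne_zero _ (hR.trans_le hr.1).ne'

namespace UniformTail

variable {S : Set ℝ} {F G : ℝ → ℝ → ℂ}

theorem of_bound {C R₀ : ℝ} (hC : 0 ≤ C) (hR₀ : 0 < R₀)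
    (h : ∀ x ∈ S, ∀ r, R₀ ≤ r → ‖F x r‖ ≤ C / r ^ 2) : UniformTail S F :=
  ⟨C, R₀, hR₀, fun x hx _ _ hR hRR' => norm_integral_le_div hC (hR₀.trans_le hR) hRR'
    fun r hr => h x hx r (hR.trans hr)⟩

theorem congr (hF : UniformTail S F) (h : ∀ x ∈ S, ∀ r, 0 < r → F x r = G x r) :
    UniformTail S G := by
  obtain ⟨C, R₀, hR₀, hC⟩ := hF
  refine ⟨C, R₀, hR₀, fun x hx R R' hR hRR' => ?_⟩
  rw [← intervalIntegral.integral_congr (f := F x) (g := G x)]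
  · exact hC x hx R R' hR hRR'
  · intro r hr
    rw [Set.uIcc_of_le hRR'] at hr
    exact h x hx r (hR₀.trans_le (hR.trans hr.1))

theorem intervalIntegrable {f : ℝ → ℂ} (hf : ContinuousOn f (Set.Ioi 0)) {R R' : ℝ} (hR : 0 < R)
    (hRR' : R ≤ R') : IntervalIntegrable f MeasureTheory.volume R R' :=
  (hf.mono fun _ hr => hR.trans_le hr.1).intervalIntegrable_of_Icc hRR'

theorem add (hF : UniformTail S F) (hG : UniformTail S G)
    (hFc : ∀ x ∈ S, ContinuousOn (F x) (Set.Ioi 0))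
    (hGc : ∀ x ∈ S, ContinuousOn (G x) (Set.Ioi 0)) :
    UniformTail S fun x r => F x r + G x r := by
  obtain ⟨C, R₀, hR₀, hC⟩ := hF
  obtain ⟨C', R₀', hR₀', hC'⟩ := hG
  refine ⟨C + C', max R₀ R₀', lt_max_of_lt_left hR₀, fun x hx R R' hR hRR' => ?_⟩
  have h1 : R₀ ≤ R := (le_max_left _ _).trans hR
  have h2 : R₀' ≤ R := (le_max_right _ _).trans hR
  rw [intervalIntegral.integral_add (intervalIntegrable (hFc x hx) (hR₀.trans_le h1) hRR')
    (intervalIntegrable (hGc x hx) (hR₀.trans_le h1) hRR'), add_div]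
  exact (norm_add_le _ _).trans (add_le_add (hC x hx R R' h1 hRR') (hC' x hx R R' h2 hRR'))

theorem const_mul (hF : UniformTail S F) (c : ℂ) : UniformTail S fun x r => c * F x r := by
  obtain ⟨C, R₀, hR₀, hC⟩ := hF
  refine ⟨‖c‖ * C, R₀, hR₀, fun x hx R R' hR hRR' => ?_⟩
  rw [intervalIntegral.integral_const_mul, norm_mul, mul_div_assoc]
  exact mul_le_mul_of_nonneg_left (hC x hx R R' hR hRR') (norm_nonneg c)

theorem sum {ι : Type*} (s : Finset ι) {F : ι → ℝ → ℝ → ℂ} (hF : ∀ i ∈ s, UniformTail S (F i))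
    (hFc : ∀ i ∈ s, ∀ x ∈ S, ContinuousOn (F i x) (Set.Ioi 0)) :
    UniformTail S fun x r => ∑ i ∈ s, F i x r := by
  classical
  induction s using Finset.induction_on with
  | empty => exact of_bound le_rfl one_pos fun x _ r _ => by simp
  | insert i s hi ih =>
    simp only [Finset.sum_insert hi]
    refine add (hF i (Finset.mem_insert_self _ _))
      (ih (fun j hj => hF j (Finset.mem_insert_of_mem hj))
        fun j hj => hFc j (Finset.mem_insert_of_mem hj))
      (hFc i (Finset.mem_insert_self _ _)) fun x hx => ?_
    exact continuousOn_finsetSum _ fun j hj => hFc j (Finset.mem_insert_of_mem hj) x hx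

/-- Improper integrals with uniform tails converge, and their value is continuous. -/
theorem exists_limit (hF : UniformTail S F) (hFc : ContinuousOn (Function.uncurry F)
    (S ×ˢ Set.Ici 0)) : ∃ L : ℝ → ℂ, ContinuousOn L S ∧
      ∀ x ∈ S, Filter.Tendsto (fun R => ∫ r in (0 : ℝ)..R, F x r) Filter.atTop (𝓝 (L x)) := by
  obtain ⟨C, R₀, hR₀, hC⟩ := hF
  have hi : ∀ x ∈ S, ∀ R R' : ℝ, 0 ≤ R → R ≤ R' →
      IntervalIntegrable (F x) MeasureTheory.volume R R' := fun x hx R R' h0 h => by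
    refine ContinuousOn.intervalIntegrable_of_Icc h ?_
    exact hFc.comp (f := fun r => (x, r)) (by fun_prop) fun r hr => ⟨hx, h0.trans hr.1⟩
  have hdiff : ∀ x ∈ S, ∀ R R', R₀ ≤ R → R ≤ R' →
      ‖(∫ r in (0 : ℝ)..R', F x r) - ∫ r in (0 : ℝ)..R, F x r‖ ≤ C / R := by
    intro x hx R R' hR hRR'
    have h0 : 0 ≤ R := hR₀.le.trans hR
    rw [intervalIntegral.integral_interval_sub_left (hi x hx 0 R' le_rfl (h0.trans hRR'))
      (hi x hx 0 R le_rfl h0)]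
    exact hC x hx R R' hR hRR'
  have hlim0 : Filter.Tendsto (fun R : ℝ => C / R) Filter.atTop (𝓝 0) :=
    Filter.tendsto_id.const_div_atTop C
  have hex : ∀ x ∈ S, ∃ l, Filter.Tendsto (fun R => ∫ r in (0 : ℝ)..R, F x r) Filter.atTop (𝓝 l) := by
    intro x hx
    apply cauchy_map_iff_exists_tendsto.1
    rw [Metric.cauchy_iff]
    refine ⟨inferInstance, fun ε hε => ?_⟩
    obtain ⟨R, hR, hR'⟩ := ((hlim0.eventually (gt_mem_nhds (half_pos hε))).and
      (Filter.eventually_ge_atTop R₀)).exists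
    refine ⟨_, Filter.image_mem_map (Filter.Ici_mem_atTop R), ?_⟩
    rintro _ ⟨R₁, h1, rfl⟩ _ ⟨R₂, h2, rfl⟩
    refine (dist_triangle_right _ _ (∫ r in (0 : ℝ)..R, F x r)).trans_lt ?_
    rw [dist_eq_norm, dist_eq_norm]
    linarith [hdiff x hx R R₁ hR' h1, hdiff x hx R R₂ hR' h2]
  choose! L hL using hex
  refine ⟨L, ?_, hL⟩
  -- Letting the upper limit in `hdiff` tend to infinity gives an error bound independent of x, and
  -- continuity passes to uniform limits.
  have hunif : TendstoUniformlyOn (fun R x => ∫ r in (0 : ℝ)..R, F x r) L Filter.atTop S := by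
    rw [Metric.tendstoUniformlyOn_iff]
    intro ε hε
    filter_upwards [hlim0.eventually (gt_mem_nhds hε), Filter.eventually_ge_atTop R₀] with R hR hR' x hx
    refine lt_of_le_of_lt ?_ hR
    rw [dist_eq_norm]
    refine le_of_tendsto ((hL x hx).sub_const _).norm ?_
    filter_upwards [Filter.eventually_ge_atTop R] with R' h
    exact hdiff x hx R R' hR' h
  refine hunif.continuousOn (Filter.Eventually.frequently ?_)
  filter_upwards [Filter.eventually_ge_atTop 0] with R hR
  exact ContinuousOn.intervalIntegral_parametric hR
    (hFc.mono (Set.prod_mono le_rfl Set.Icc_subset_Ici_self))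

end UniformTail

theorem continuousOn_exp_div (z w : ℂ) (n : ℕ) :
    ContinuousOn (fun r : ℝ => Complex.exp (z * r + w * r ^ n) / r) (Set.Ioi 0) := fun r hr => by
  have : (r : ℂ) ≠ 0 := by exact_mod_cast (show (0 : ℝ) < r from hr).ne'
  exact (ContinuousAt.div (by fun_prop) (by fun_prop) this).continuousWithinAt

/-- Integration by parts for an integral with phase `zr + wr^n` without stationary points. -/
theorem norm_integral_exp_div_le {z w : ℂ} {n : ℕ} (hn : 2 ≤ n) (hz : z.re ≤ 0) (hz1 : ‖z‖ ≤ 1)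
    (hw : w.re ≤ 0) {c R R' : ℝ} (hc : 0 < c) (hR : 0 < R) (hRR' : R ≤ R')
    (hD : ∀ r : ℝ, R ≤ r → c ≤ ‖z + n * w * r ^ (n - 1)‖) :
    ‖∫ r in R..R', Complex.exp (z * r + w * r ^ n) / r‖ ≤ (2 / c + (n / c + n / c ^ 2)) / R := by
  set D : ℝ → ℂ := fun r => z + n * w * r ^ (n - 1) with hDdef
  have hEn : ∀ r : ℝ, R ≤ r → ‖Complex.exp (z * r + w * r ^ n)‖ ≤ 1 := fun r hr => by
    have h0 : 0 ≤ r := hR.le.trans hr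
    rw [Complex.norm_exp, Real.exp_le_one_iff, Complex.add_re, Complex.re_mul_ofReal,
      ← Complex.ofReal_pow, Complex.re_mul_ofReal]
    exact add_nonpos (mul_nonpos_of_nonpos_of_nonneg hz h0)
      (mul_nonpos_of_nonpos_of_nonneg hw (by positivity))
  have hD0 : ∀ r : ℝ, R ≤ r → D r ≠ 0 := fun r hr h => by
    have := hD r hr
    rw [show z + n * w * r ^ (n - 1) = 0 from h, norm_zero] at this
    linarith
  have hr0 : ∀ r : ℝ, R ≤ r → (r : ℂ) ≠ 0 := fun r hr => by
    exact_mod_cast (hR.trans_le hr).ne'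
  have hEd : ∀ r : ℝ, HasDerivAt (fun r : ℝ => Complex.exp (z * r + w * r ^ n))
      (Complex.exp (z * r + w * r ^ n) * D r) r := fun r => by
    have h1 := (hasDerivAt_id r).ofReal_comp
    refine ((h1.const_mul z).add ((h1.pow n).const_mul w)).cexp.congr_deriv ?_
    simp only [hDdef, id, Pi.add_apply, Pi.pow_apply]
    push_cast
    ring
  have hDd : ∀ r : ℝ, HasDerivAt D (n * w * ((n - 1 : ℕ) * (r : ℂ) ^ (n - 1 - 1))) r := fun r => by
    have h1 := (hasDerivAt_id r).ofReal_comp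
    refine (((h1.pow (n - 1)).const_mul (n * w)).const_add z).congr_deriv ?_
    simp
  -- Since rD′ = (n−1)(D − z), the derivative of rD is nD − (n−1)z. No bare power of r occurs, so
  -- |D| ≥ c and |z| ≤ 1 suffice to make this derivative O(r⁻²).
  have hhd : ∀ r : ℝ, R ≤ r → HasDerivAt (fun r : ℝ => ((r : ℂ) * D r)⁻¹)
      (-(n * D r - (n - 1) * z) / (r * D r) ^ 2) r := fun r hr => by
    have h1 := (hasDerivAt_id r).ofReal_comp
    refine ((h1.mul (hDd r)).inv (mul_ne_zero (hr0 r hr) (hD0 r hr))).congr_deriv ?_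
    congr 2
    have hp : (r : ℂ) * (r : ℂ) ^ (n - 1 - 1) = r ^ (n - 1) := by
      rw [← pow_succ', show n - 1 - 1 + 1 = n - 1 by omega]
    have hcast : ((n - 1 : ℕ) : ℂ) = n - 1 := by
      rw [Nat.cast_sub (by omega)]; simp
    simp only [id, hDdef, hcast, Complex.ofReal_one, one_mul]
    linear_combination (n * w * (n - 1)) * hp
  have hn1 : (1 : ℝ) ≤ n := by exact_mod_cast (by omega : 1 ≤ n)
  have hcn : ‖(n : ℂ) - 1‖ ≤ n := by
    rw [show (n : ℂ) - 1 = ((n - 1 : ℝ) : ℂ) by push_cast; rfl, Complex.norm_real,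
      Real.norm_of_nonneg (by linarith)]
    linarith
  have hh'n : ∀ r : ℝ, R ≤ r → ‖-(n * D r - (n - 1) * z) / (r * D r) ^ 2‖ ≤
      (n / c + n / c ^ 2) / r ^ 2 := fun r hr => by
    have hrp : 0 < r := hR.trans_le hr
    have hDp : 0 < ‖D r‖ := hc.trans_le (hD r hr)
    rw [norm_div, norm_neg, norm_pow, norm_mul, Complex.norm_real, Real.norm_of_nonneg hrp.le,
      mul_pow, div_le_div_iff₀ (by positivity) (by positivity)]
    have h1 : ‖n * D r - (n - 1) * z‖ ≤ n * ‖D r‖ + n := by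
      refine (norm_sub_le _ _).trans (add_le_add ?_ ?_)
      · rw [norm_mul, Complex.norm_natCast]
      · rw [norm_mul]
        exact (mul_le_mul hcn hz1 (norm_nonneg _) (by linarith)).trans (by simp)
    have h2 : (n : ℝ) * ‖D r‖ + n ≤ (n / c + n / c ^ 2) * ‖D r‖ ^ 2 := by
      have h3 : 1 ≤ ‖D r‖ / c := (one_le_div hc).2 (hD r hr)
      have h4 : (n / c + n / c ^ 2) * ‖D r‖ ^ 2 =
          n * ‖D r‖ * (‖D r‖ / c) + n * (‖D r‖ / c) ^ 2 := by
        field_simp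
      rw [h4]
      refine add_le_add ?_ ?_
      · exact le_mul_of_one_le_right (by positivity) h3
      · exact le_mul_of_one_le_right (by positivity) (one_le_pow₀ h3)
    calc _ ≤ (n * ‖D r‖ + n) * r ^ 2 := by gcongr
      _ ≤ (n / c + n / c ^ 2) * ‖D r‖ ^ 2 * r ^ 2 := by gcongr
      _ = _ := by ring
  have hDc : Continuous D := by
    simp only [hDdef]
    fun_prop
  have hparts := intervalIntegral.integral_mul_deriv_eq_deriv_mul (a := R) (b := R')
    (u := fun r : ℝ => ((r : ℂ) * D r)⁻¹) (u' := fun r => -(n * D r - (n - 1) * z) / (r * D r) ^ 2)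
    (v := fun r : ℝ => Complex.exp (z * r + w * r ^ n))
    (v' := fun r : ℝ => Complex.exp (z * r + w * r ^ n) * D r)
    (fun r hr => hhd r (by rw [Set.uIcc_of_le hRR'] at hr; exact hr.1)) (fun r _ => hEd r)
    (ContinuousOn.intervalIntegrable_of_Icc hRR' <| ContinuousOn.div
      (Continuous.continuousOn (by fun_prop)) (Continuous.continuousOn (by fun_prop))
      fun r hr => pow_ne_zero 2 (mul_ne_zero (hr0 r hr.1) (hD0 r hr.1)))
    (Continuous.intervalIntegrable (by fun_prop) _ _)
  have heq : ∫ r in R..R', Complex.exp (z * r + w * r ^ n) / r =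
      ∫ r in R..R', ((r : ℂ) * D r)⁻¹ * (Complex.exp (z * r + w * r ^ n) * D r) := by
    refine intervalIntegral.integral_congr fun r hr => ?_
    rw [Set.uIcc_of_le hRR'] at hr
    have h1 := hr0 r hr.1
    have h2 := hD0 r hr.1
    field_simp
  have hb : ∀ r, R ≤ r → ‖((r : ℂ) * D r)⁻¹ * Complex.exp (z * r + w * r ^ n)‖ ≤ 1 / c / R := by
    intro r hr
    have hDr := hD r hr
    have hrp : 0 < r := hR.trans_le hr
    rw [norm_mul, norm_inv, norm_mul, Complex.norm_real, Real.norm_of_nonneg (hR.le.trans hr)]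
    refine (mul_le_of_le_one_right (by positivity) (hEn r hr)).trans ?_
    rw [div_div, one_div]
    refine inv_anti₀ (by positivity) ?_
    rw [mul_comm c]
    exact mul_le_mul hr hDr hc.le (hR.le.trans hr)
  rw [heq, hparts, add_div]
  refine (norm_sub_le _ _).trans (add_le_add ((norm_sub_le _ _).trans ?_) ?_)
  · refine (add_le_add (hb R' hRR') (hb R le_rfl)).trans (le_of_eq ?_)
    ring
  · refine norm_integral_le_div (by positivity) hR hRR' fun r hr => ?_
    rw [norm_mul]
    exact (mul_le_of_le_one_right (norm_nonneg _) (hEn r hr)).trans (hh'n r hr)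

/-- Both alternatives keep the derivative z + nwr^{n−1} of the phase away from 0: a nonzero w
dominates for large r, and for w = 0 the lower bound on z does it. -/
theorem UniformTail.exp_div {S : Set ℝ} {z : ℝ → ℂ} {w : ℂ} {n : ℕ} (hn : 2 ≤ n)
    (hz : ∀ x ∈ S, (z x).re ≤ 0) (hz1 : ∀ x ∈ S, ‖z x‖ ≤ 1) (hw : w.re ≤ 0)
    (h : w ≠ 0 ∨ ∃ c > 0, ∀ x ∈ S, c ≤ ‖z x‖) :
    UniformTail S fun x r => Complex.exp (z x * r + w * r ^ n) / r := by
  have key : ∃ c R₀ : ℝ, 0 < c ∧ 0 < R₀ ∧ ∀ x ∈ S, ∀ r : ℝ, R₀ ≤ r →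
      c ≤ ‖z x + n * w * r ^ (n - 1)‖ := by
    by_cases hw0 : w = 0
    · obtain ⟨c, hc, hcz⟩ := h.resolve_left (not_not.2 hw0)
      exact ⟨c, 1, hc, one_pos, fun x hx r _ => by simpa [hw0] using hcz x hx⟩
    · have hwp : 0 < ‖w‖ := norm_pos_iff.2 hw0
      -- Beyond this radius the term nwr^{n−1} has modulus at least 2; subtracting |z| ≤ 1 leaves
      -- the lower bound 1.
      refine ⟨1, max 1 (2 / ‖w‖), one_pos, lt_max_of_lt_left one_pos, fun x hx r hr => ?_⟩
      have hr1 : 1 ≤ r := (le_max_left _ _).trans hr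
      have hr2 : 2 ≤ ‖w‖ * r := by
        rw [← div_le_iff₀' hwp]
        exact (le_max_right _ _).trans hr
      have hn1 : (1 : ℝ) ≤ n := by exact_mod_cast (by omega : 1 ≤ n)
      have hpow : r ≤ r ^ (n - 1) := le_self_pow₀ hr1 (by omega)
      have h1 : 2 ≤ ‖n * w * (r : ℂ) ^ (n - 1)‖ := by
        rw [norm_mul, norm_mul, norm_pow, Complex.norm_natCast, Complex.norm_real,
          Real.norm_of_nonneg (by linarith)]
        calc (2 : ℝ) ≤ ‖w‖ * r := hr2
          _ ≤ ‖w‖ * r ^ (n - 1) := by gcongr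
          _ ≤ n * (‖w‖ * r ^ (n - 1)) := le_mul_of_one_le_left (by positivity) hn1
          _ = _ := by ring
      have h2 := norm_sub_le (z x + n * w * (r : ℂ) ^ (n - 1)) (z x)
      rw [add_sub_cancel_left] at h2
      linarith [hz1 x hx]
  obtain ⟨c, R₀, hc, hR₀, hD⟩ := key
  exact ⟨_, R₀, hR₀, fun x hx R R' hR hRR' => norm_integral_exp_div_le hn (hz x hx) (hz1 x hx) hw hc
    (hR₀.trans_le hR) hRR' fun r hr => hD x hx r (hR.trans hr)⟩

/-! ### Boundary transforms as entire functions and their decay -/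

theorem differentiable_integral_cexp_mul {u v : ℝ} (huv : u ≤ v) {X : ℝ → ℂ}
    (hX : ContinuousOn X (Set.Icc u v)) :
    Differentiable ℂ fun l : ℂ => ∫ s in u..v, Complex.exp (l * s) * X s := by
  intro l₀
  have hi : ∀ g : ℝ → ℂ, Continuous g → IntervalIntegrable (fun s => g s * X s)
      MeasureTheory.volume u v := fun g hg =>
    (hg.continuousOn.mul hX).intervalIntegrable_of_Icc huv
  obtain ⟨M, hM⟩ := isCompact_Icc.exists_bound_of_continuousOn hX
  have hM0 : 0 ≤ M := (norm_nonneg _).trans (hM u ⟨le_rfl, huv⟩)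
  set K := max |u| |v| with hK
  have hsK : ∀ s ∈ Set.Icc u v, |s| ≤ K := fun s hs => abs_le_max_abs_abs hs.1 hs.2
  refine (intervalIntegral.hasDerivAt_integral_of_dominated_loc_of_deriv_le
    (F := fun l s => Complex.exp (l * s) * X s) (F' := fun l s => Complex.exp (l * s) * s * X s)
    (bound := fun _ => Real.exp ((‖l₀‖ + 1) * K) * K * M)
    (Metric.ball_mem_nhds l₀ one_pos) ?_ ?_ ?_ ?_ ?_ ?_).2.differentiableAt
  · exact Filter.Eventually.of_forall fun l =>
      ((hi _ (by fun_prop)).def').aestronglyMeasurable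
  · exact hi _ (by fun_prop)
  · exact ((hi _ (by fun_prop)).def').aestronglyMeasurable
  · refine Filter.Eventually.of_forall fun s hs l hl => ?_
    rw [Set.uIoc_of_le huv] at hs
    have hs' := Set.Ioc_subset_Icc_self hs
    rw [norm_mul, norm_mul, Complex.norm_exp, Complex.norm_real, Real.norm_eq_abs]
    have h1 : (l * s).re ≤ (‖l₀‖ + 1) * K := by
      refine (Complex.re_le_norm _).trans ?_
      rw [norm_mul, Complex.norm_real, Real.norm_eq_abs]
      have : ‖l‖ ≤ ‖l₀‖ + 1 := by
        have := norm_le_norm_add_norm_sub' l l₀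
        have h2 : ‖l - l₀‖ < 1 := by rwa [mem_ball_iff_norm] at hl
        linarith
      exact mul_le_mul this (hsK s hs') (abs_nonneg _) (by positivity)
    gcongr
    · exact hsK s hs'
    · exact hM s hs'
  · exact intervalIntegrable_const
  · refine Filter.Eventually.of_forall fun s _ l _ => ?_
    have h := ((hasDerivAt_id l).mul_const (s : ℂ)).cexp.mul_const (X s)
    simpa using h

namespace IBVP

variable {n : ℕ} {P : IBVP n} {q : ℝ → ℝ → ℂ}

theorem norm_a (P : IBVP n) : ‖P.a‖ = 1 := by
  rw [P.a_eq.1, Complex.norm_exp_ofReal_mul_I]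

theorem norm_c (P : IBVP n) (j : Fin n) (ρ : ℂ) : ‖P.c j ρ‖ = ‖ρ‖ ^ (n - ((j : ℕ) + 1)) := by
  simp [c, norm_a]

theorem differentiable_c (P : IBVP n) (j : Fin n) : Differentiable ℂ (P.c j) := by
  unfold c
  fun_prop

/-- The weighted sum of the transforms over `[u,v]` of the boundary values at `x = e`. -/
noncomputable def segmentSum (P : IBVP n) (q : ℝ → ℝ → ℂ) (e u v : ℝ) (ρ : ℂ) : ℂ :=
  ∑ j : Fin n, P.c j ρ * ∫ t in u..v, Complex.exp (P.a * ρ ^ n * t) * dx j q e t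

theorem boundarySum_eq_segmentSum (P : IBVP n) (q : ℝ → ℝ → ℂ) (e τ : ℝ) (ρ : ℂ) :
    P.boundarySum q e τ ρ = P.segmentSum q e 0 τ ρ := rfl

theorem IsSolution.continuousOn_dx (hq : P.IsSolution q) (j : ℕ) {e : ℝ}
    (he : e ∈ Set.Icc (0 : ℝ) 1) {u v : ℝ} (hu : 0 ≤ u) (hv : v ≤ P.T) :
    ContinuousOn (dx j q e) (Set.Icc u v) :=
  (hq.contDiffOn_dx_right j he).continuousOn.mono (Set.Icc_subset_Icc hu hv)

theorem IsSolution.differentiable_segmentSum (hq : P.IsSolution q) {e : ℝ}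
    (he : e ∈ Set.Icc (0 : ℝ) 1) {u v : ℝ} (hu : 0 ≤ u) (huv : u ≤ v) (hv : v ≤ P.T) :
    Differentiable ℂ (P.segmentSum q e u v) := by
  unfold segmentSum
  refine Differentiable.fun_sum fun j _ => (P.differentiable_c j).mul ?_
  exact (differentiable_integral_cexp_mul huv (hq.continuousOn_dx j he hu hv)).comp
    (f := fun ρ : ℂ => P.a * ρ ^ n) (by fun_prop)

theorem IsSolution.segmentSum_sub (hq : P.IsSolution q) {e : ℝ} (he : e ∈ Set.Icc (0 : ℝ) 1)
    {t : ℝ} (ht : t ∈ Set.Icc 0 P.T) (ρ : ℂ) :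
    P.segmentSum q e 0 P.T ρ - P.segmentSum q e 0 t ρ = P.segmentSum q e t P.T ρ := by
  unfold segmentSum
  rw [← Finset.sum_sub_distrib]
  refine Finset.sum_congr rfl fun j _ => ?_
  have hec : Continuous fun s : ℝ => Complex.exp (P.a * ρ ^ n * s) := by fun_prop
  rw [← mul_sub, intervalIntegral.integral_interval_sub_left]
  · exact (hec.continuousOn.mul (hq.continuousOn_dx j he le_rfl le_rfl)).intervalIntegrable_of_Icc
      P.T_pos.le
  · exact (hec.continuousOn.mul (hq.continuousOn_dx j he le_rfl ht.2)).intervalIntegrable_of_Icc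
      ht.1

/-- The coefficient c_j has degree n−1−j and one integration by parts in time gains |ρ|⁻ⁿ, so order
j contributes O(|ρ|^{−1−j}). The worst case j = 0 gives 1/|ρ|. -/
theorem IsSolution.exists_norm_segmentSum_le (hq : P.IsSolution q) {e : ℝ}
    (he : e ∈ Set.Icc (0 : ℝ) 1) {u v : ℝ} (hu : 0 ≤ u) (huv : u ≤ v) (hv : v ≤ P.T) :
    ∃ C, ∀ ρ : ℂ, 1 ≤ ‖ρ‖ → ∀ t : ℝ, (∀ s ∈ Set.Icc u v, (P.a * ρ ^ n * (s - t)).re ≤ 0) →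
      ‖Complex.exp (-(P.a * ρ ^ n * t)) * P.segmentSum q e u v ρ‖ ≤ C / ‖ρ‖ := by
  have hder : ∀ j : ℕ, ∀ s ∈ Set.Icc u v, HasDerivWithinAt (dx j q e)
      (derivWithin (dx j q e) (Set.Icc 0 P.T) s) (Set.Icc u v) s := fun j s hs =>
    (((hq.contDiffOn_dx_right j he).differentiableOn (by simp) s
      ⟨hu.trans hs.1, hs.2.trans hv⟩).hasDerivWithinAt).mono (Set.Icc_subset_Icc hu hv)
  have hc : ∀ j : ℕ, ContinuousOn (derivWithin (dx j q e) (Set.Icc 0 P.T)) (Set.Icc u v) := fun j =>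
    ((hq.contDiffOn_dx_right j he).derivWithin (m := ∞) (uniqueDiffOn_Icc P.T_pos)
      (by simp)).continuousOn.mono (Set.Icc_subset_Icc hu hv)
  choose C hC0 hC using fun j : Fin n => exists_norm_exp_mul_integral_le huv (hder j) (hc j)
  refine ⟨∑ j, C j, fun ρ hρ t hs => ?_⟩
  have hρ0 : 0 < ‖ρ‖ := one_pos.trans_le hρ
  have hl : P.a * ρ ^ n ≠ 0 := by
    rw [← norm_pos_iff, norm_mul, norm_a, norm_pow]
    positivity
  rw [segmentSum, Finset.mul_sum, Finset.sum_div]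
  refine norm_sum_le_of_le _ fun j _ => ?_
  rw [mul_left_comm, norm_mul, norm_c]
  refine (mul_le_mul_of_nonneg_left (hC j _ hl t hs) (by positivity)).trans ?_
  rw [norm_mul, norm_a, one_mul, norm_pow, mul_div_assoc', div_le_div_iff₀ (by positivity) hρ0]
  have h1 : ‖ρ‖ ^ (n - ((j : ℕ) + 1)) * ‖ρ‖ ≤ ‖ρ‖ ^ n := by
    rw [← pow_succ]
    exact pow_le_pow_right₀ hρ (by omega)
  calc _ = C j * (‖ρ‖ ^ (n - ((j : ℕ) + 1)) * ‖ρ‖) := by ring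
    _ ≤ _ := mul_le_mul_of_nonneg_left h1 (hC0 j)

theorem norm_exp_I_mul_polar (R φ y : ℝ) :
    ‖Complex.exp (Complex.I * (R * Complex.exp (φ * Complex.I)) * y)‖ =
      Real.exp (-(R * (Real.sin φ * y))) := by
  rw [Complex.norm_exp, Complex.re_mul_ofReal, Complex.I_mul_re, Complex.im_ofReal_mul,
    Complex.exp_ofReal_mul_I_im]
  ring_nf

/-- The sign condition `hcos` serves two uses: the segment [0,t] where Re(aρⁿ) ≥ 0, and the segment
[t,T] where Re(aρⁿ) ≤ 0. The condition `hsin` says that e^{iρy} decays away from the real axis at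
rate d, as Jordan's lemma requires. -/
theorem IsSolution.tendsto_rayIntegral_segmentSum (hq : P.IsSolution q) {e : ℝ}
    (he : e ∈ Set.Icc (0 : ℝ) 1) {u v : ℝ} (hu : 0 ≤ u) (huv : u ≤ v) (hv : v ≤ P.T)
    {t y d φ₁ φ₂ : ℝ} (hφ : φ₁ ≤ φ₂) (hd : 0 < d)
    (hcos : ∀ φ ∈ Set.Icc φ₁ φ₂, ∀ s ∈ Set.Icc u v, Real.cos (P.a.arg + n * φ) * (s - t) ≤ 0)
    (hsin : ∀ φ ∈ Set.Icc φ₁ φ₂, Real.sin φ * y = d * |Real.sin φ|) :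
    Filter.Tendsto (fun R =>
      rayIntegral (fun ρ => Complex.exp (Complex.I * ρ * y - P.a * ρ ^ n * t) *
        P.segmentSum q e u v ρ) φ₁ R -
      rayIntegral (fun ρ => Complex.exp (Complex.I * ρ * y - P.a * ρ ^ n * t) *
        P.segmentSum q e u v ρ) φ₂ R) Filter.atTop (𝓝 0) := by
  obtain ⟨C, hC⟩ := hq.exists_norm_segmentSum_le he hu huv hv
  have hds := hq.differentiable_segmentSum he hu huv hv
  refine tendsto_rayIntegral_sub (C := C) (R₀ := 1) (by fun_prop) hφ hd fun R hR φ hφ' => ?_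
  have hR0 : 0 < R := one_pos.trans_le hR
  have hn : ‖(R : ℂ) * Complex.exp (φ * Complex.I)‖ = R := by
    rw [norm_mul, Complex.norm_exp_ofReal_mul_I, mul_one, Complex.norm_real,
      Real.norm_of_nonneg hR0.le]
  have h := hC (R * Complex.exp (φ * Complex.I)) (hn.symm ▸ hR) t fun s hs => by
    rw [← Complex.ofReal_sub, Complex.re_mul_ofReal, re_polar, mul_assoc]
    exact mul_nonpos_of_nonneg_of_nonpos (by positivity) (hcos φ hφ' s hs)
  rw [hn] at h
  rw [sub_eq_add_neg, Complex.exp_add, mul_assoc, norm_mul, norm_exp_I_mul_polar, hsin φ hφ',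
    mul_comm (C / R), ← mul_assoc R]
  exact mul_le_mul_of_nonneg_left h (Real.exp_nonneg _)

/-! ### The integral representation at interior points -/

/-- The integrand of the integral of the initial datum. -/
noncomputable def initialIntegrand (P : IBVP n) (x t : ℝ) (ρ : ℂ) : ℂ :=
  Complex.exp (Complex.I * ρ * x - P.a * ρ ^ n * t) * fourierTransform P.q₀ ρ

/-- The integrand of the integrals of the boundary values at `x = e`. -/
noncomputable def boundaryIntegrand (P : IBVP n) (q : ℝ → ℝ → ℂ) (e y t : ℝ) (ρ : ℂ) : ℂ :=
  Complex.exp (Complex.I * ρ * y - P.a * ρ ^ n * t) * P.boundarySum q e P.T ρ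

theorem continuous_initialIntegrand (P : IBVP n) (x t : ℝ) :
    Continuous (P.initialIntegrand x t) := by
  have := continuous_fourierTransform P.q₀_smooth.continuousOn
  unfold initialIntegrand
  fun_prop

theorem IsSolution.continuous_boundaryIntegrand (hq : P.IsSolution q) {e : ℝ}
    (he : e ∈ Set.Icc (0 : ℝ) 1) (y t : ℝ) : Continuous (P.boundaryIntegrand q e y t) := by
  have := (hq.differentiable_segmentSum he le_rfl P.T_pos.le le_rfl).continuous
  unfold boundaryIntegrand
  simp only [boundarySum_eq_segmentSum]
  fun_prop

/-- The boundary values at one end, integrated along the real line and along the boundary of the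
sectors of a half plane, give the same limit. -/
theorem IsSolution.tendsto_boundary_deformation (hq : P.IsSolution q) {e : ℝ}
    (he : e ∈ Set.Icc (0 : ℝ) 1) {t y d lo hi : ℝ} (ht : t ∈ Set.Icc 0 P.T) (h0 : 0 ≤ lo)
    (hlohi : lo ≤ hi) (h2 : hi ≤ 2 * Real.pi) {S : Finset (Fin n)}
    (hS : ∀ m ∈ S, lo ≤ P.startAngle m ∧ P.endAngle m ≤ hi)
    (hS' : ∀ m ∉ S, P.endAngle m ≤ lo ∨ hi ≤ P.startAngle m) (hd : 0 < d)
    (hsin : ∀ φ ∈ Set.Icc lo hi, Real.sin φ * y = d * |Real.sin φ|) :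
    Filter.Tendsto (fun R =>
      rayIntegral (fun ρ => Complex.exp (Complex.I * ρ * y - P.a * ρ ^ n * t) *
        P.boundarySum q e t ρ) lo R -
      rayIntegral (fun ρ => Complex.exp (Complex.I * ρ * y - P.a * ρ ^ n * t) *
        P.boundarySum q e t ρ) hi R -
      ∑ m ∈ S, (rayIntegral (P.boundaryIntegrand q e y t) (P.startAngle m) R -
        rayIntegral (P.boundaryIntegrand q e y t) (P.endAngle m) R)) Filter.atTop (𝓝 0) := by
  set g : ℂ → ℂ := fun ρ => Complex.exp (Complex.I * ρ * y - P.a * ρ ^ n * t) *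
        P.boundarySum q e t ρ with hg
  have hgc : Continuous g := by
    have := (hq.differentiable_segmentSum he le_rfl ht.1 ht.2).continuous
    simp only [hg, boundarySum_eq_segmentSum]
    fun_prop
  -- Outside D the transform over [0,t] is the controlled one, as s − t ≤ 0 there.
  have h1 := P.tendsto_sub_sum_sectors h0 hlohi h2 hS hS' (rayIntegral g)
    fun φ₁ φ₂ h₁ h₁₂ h₂ hcos => hq.tendsto_rayIntegral_segmentSum he le_rfl ht.1 ht.2 h₁₂ hd
      (fun φ hφ s hs => mul_nonpos_of_nonneg_of_nonpos (hcos φ hφ) (by linarith [hs.2]))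
      fun φ hφ => hsin φ ⟨h₁.trans hφ.1, hφ.2.trans h₂⟩
  -- Enlarging [0,t] to [0,T] adds the transform over [t,T]. On each sector of D it is controlled,
  -- as s − t ≥ 0, so its integral around the sector tends to 0.
  have h3 : Filter.Tendsto (fun R => ∑ m ∈ S,
      (rayIntegral (fun ρ => P.boundaryIntegrand q e y t ρ - g ρ) (P.startAngle m) R -
        rayIntegral (fun ρ => P.boundaryIntegrand q e y t ρ - g ρ) (P.endAngle m) R))
      Filter.atTop (𝓝 (∑ m ∈ S, 0)) := by
    refine tendsto_finsetSum S fun m hm => ?_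
    have hfun : (fun ρ => P.boundaryIntegrand q e y t ρ - g ρ) = fun ρ =>
        Complex.exp (Complex.I * ρ * y - P.a * ρ ^ n * t) * P.segmentSum q e t P.T ρ := by
      ext ρ
      rw [← hq.segmentSum_sub he ht, boundaryIntegrand, hg, mul_sub]
      rfl
    rw [hfun]
    exact hq.tendsto_rayIntegral_segmentSum he ht.1 ht.2 le_rfl (P.startAngle_lt_endAngle m).le hd
      (fun φ hφ s hs => mul_nonpos_of_nonpos_of_nonneg (P.cos_nonpos_sector m hφ.1 hφ.2)
        (by linarith [hs.1]))
      fun φ hφ => hsin φ ⟨(hS m hm).1.trans hφ.1, hφ.2.trans (hS m hm).2⟩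
  have h4 := h1.sub h3
  rw [Finset.sum_const_zero, sub_zero] at h4
  refine h4.congr fun R => ?_
  rw [sub_sub, ← Finset.sum_add_distrib]
  congr 1
  refine Finset.sum_congr rfl fun m _ => ?_
  rw [rayIntegral_sub (hq.continuous_boundaryIntegrand he y t) hgc,
    rayIntegral_sub (hq.continuous_boundaryIntegrand he y t) hgc]
  ring

-- Fourier inversion, the global relation over [0,t] and the deformation in each half plane. All
-- integrals share one truncation radius R and only their combination is shown to converge here.
open Classical in
theorem IsSolution.tendsto_representation (hq : P.IsSolution q) {x t : ℝ}
    (hx : x ∈ Set.Ioo (0 : ℝ) 1) (ht : t ∈ Set.Icc 0 P.T) :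
    Filter.Tendsto (fun R =>
      (rayIntegral (P.initialIntegrand x t) 0 R - rayIntegral (P.initialIntegrand x t) Real.pi R)
      - ∑ m with P.sector m ⊆ P.DPlus,
        (rayIntegral (P.boundaryIntegrand q 0 x t) (P.startAngle m) R -
          rayIntegral (P.boundaryIntegrand q 0 x t) (P.endAngle m) R)
      - ∑ m with P.sector m ⊆ P.DMinus,
        (rayIntegral (P.boundaryIntegrand q 1 (x - 1) t) (P.startAngle m) R -
          rayIntegral (P.boundaryIntegrand q 1 (x - 1) t) (P.endAngle m) R))
      Filter.atTop (𝓝 (2 * Real.pi * q x t)) := by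
  have hpi := Real.pi_pos
  have h01 : (0 : ℝ) ∈ Set.Icc (0 : ℝ) 1 := ⟨le_rfl, zero_le_one⟩
  have h11 : (1 : ℝ) ∈ Set.Icc (0 : ℝ) 1 := ⟨zero_le_one, le_rfl⟩
  have hP := hq.tendsto_boundary_deformation (y := x) h01 ht le_rfl hpi.le (by linarith)
    (S := Finset.univ.filter fun m => P.sector m ⊆ P.DPlus)
    (fun m hm => ⟨P.startAngle_nonneg m,
      (P.sector_subset_DPlus_iff m).1 (Finset.mem_filter.1 hm).2⟩)
    (fun m hm => Or.inr ((P.endAngle_le_pi_or m).resolve_left fun h =>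
      hm (Finset.mem_filter.2 ⟨Finset.mem_univ m, (P.sector_subset_DPlus_iff m).2 h⟩)))
    hx.1 (fun φ hφ => by
      rw [abs_of_nonneg (Real.sin_nonneg_of_nonneg_of_le_pi hφ.1 hφ.2), mul_comm])
  have hM := hq.tendsto_boundary_deformation (y := x - 1) (d := 1 - x) h11 ht hpi.le
    (by linarith : Real.pi ≤ 2 * Real.pi) le_rfl
    (S := Finset.univ.filter fun m => P.sector m ⊆ P.DMinus)
    (fun m hm => ⟨(P.sector_subset_DMinus_iff m).1 (Finset.mem_filter.1 hm).2, P.endAngle_le m⟩)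
    (fun m hm => Or.inl ((P.endAngle_le_pi_or m).resolve_right fun h =>
      hm (Finset.mem_filter.2 ⟨Finset.mem_univ m, (P.sector_subset_DMinus_iff m).2 h⟩)))
    (by linarith [hx.2]) (fun φ hφ => by
      have : Real.sin φ ≤ 0 := by
        rw [← Real.sin_sub_two_pi]
        exact Real.sin_nonpos_of_nonpos_of_neg_pi_le (by linarith [hφ.2]) (by linarith [hφ.1])
      rw [abs_of_nonpos this]
      ring)
  have hqt : ContDiffOn ℝ ∞ (fun x => q x t) (Set.Icc 0 1) := by
    simpa only [dx_zero] using hq.contDiffOn_dx_left 0 ht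
  have hF := tendsto_integral_fourierTransform hqt hx
  have hFc := continuous_fourierTransform hqt.continuousOn
  set g₀ : ℂ → ℂ := fun ρ => Complex.exp (Complex.I * ρ * x - P.a * ρ ^ n * t) *
    P.boundarySum q 0 t ρ with hg₀
  set g₁ : ℂ → ℂ := fun ρ => Complex.exp (Complex.I * ρ * (x - 1 : ℝ) - P.a * ρ ^ n * t) *
    P.boundarySum q 1 t ρ with hg₁
  have hg₀c : Continuous g₀ := by
    have := (hq.differentiable_segmentSum h01 le_rfl ht.1 ht.2).continuous
    simp only [hg₀, boundarySum_eq_segmentSum]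
    fun_prop
  have hg₁c : Continuous g₁ := by
    have := (hq.differentiable_segmentSum h11 le_rfl ht.1 ht.2).continuous
    simp only [hg₁, boundarySum_eq_segmentSum]
    fun_prop
  have hsplit : ∀ ρ : ℂ, Complex.exp (Complex.I * ρ * x) * fourierTransform (fun x => q x t) ρ =
      P.initialIntegrand x t ρ - g₀ ρ + g₁ ρ := by
    intro ρ
    have h := hq.exp_mul_fourierTransform ρ ht
    have e1 : Complex.exp (Complex.I * ρ * x) = Complex.exp (Complex.I * ρ * x - P.a * ρ ^ n * t) *
        Complex.exp (P.a * ρ ^ n * t) := by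
      rw [← Complex.exp_add]; ring_nf
    have e2 : Complex.exp (Complex.I * ρ * (x - 1 : ℝ) - P.a * ρ ^ n * t) =
        Complex.exp (Complex.I * ρ * x - P.a * ρ ^ n * t) * Complex.exp (-Complex.I * ρ) := by
      rw [← Complex.exp_add]; push_cast; ring_nf
    simp only [hg₀, hg₁, initialIntegrand, e2]
    rw [e1, mul_assoc, h]
    ring
  have hray : ∀ φ R, rayIntegral (fun ρ => Complex.exp (Complex.I * ρ * x) *
      fourierTransform (fun x => q x t) ρ) φ R =
      rayIntegral (P.initialIntegrand x t) φ R - rayIntegral g₀ φ R + rayIntegral g₁ φ R := by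
    intro φ R
    have hic := P.continuous_initialIntegrand x t
    simp only [hsplit]
    rw [rayIntegral_add (f := fun ρ => P.initialIntegrand x t ρ - g₀ ρ) (hic.sub hg₀c) hg₁c,
      rayIntegral_sub hic hg₀c]
  -- The lower half plane is swept by angles from π to 2π, which traverses the real line backwards.
  -- This reversal turns the plus sign of the terms from x = 1 into the minus sign of the formula.
  have h2pi : ∀ R, rayIntegral g₁ (2 * Real.pi) R = rayIntegral g₁ 0 R := by
    intro R
    simp [rayIntegral]
  have h := (hF.add hP).add hM
  rw [add_zero, add_zero] at h
  refine h.congr fun R => ?_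
  rw [← rayIntegral_zero_sub_rayIntegral_pi (by fun_prop : Continuous fun ρ : ℂ =>
    Complex.exp (Complex.I * ρ * x) * fourierTransform (fun x => q x t) ρ), hray, hray, h2pi]
  ring

end IBVP

namespace IBVP

variable {n : ℕ} {P : IBVP n} {q : ℝ → ℝ → ℂ}

/-! ### Convergence along the rays -/

theorem continuous_ray_uncurry {g : ℝ → ℂ → ℂ} (hg : Continuous (Function.uncurry g)) (φ : ℝ) :
    Continuous (Function.uncurry fun (x r : ℝ) =>
      g x (r * Complex.exp (φ * Complex.I)) * Complex.exp (φ * Complex.I)) := by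
  have h : Continuous fun p : ℝ × ℝ => (p.1, (p.2 : ℂ) * Complex.exp (φ * Complex.I)) := by fun_prop
  exact (hg.comp h).mul continuous_const

/-- On the real axis the transform of q₀ is i(e^{-iρ}q₀(1) − q₀(0))/ρ up to O(ρ⁻²). The two leading
terms have linear phases x − 1 and x. They have uniform tails either through the ρⁿ phase when t ≠
0, or because x stays away from both endpoints. -/
theorem uniformTail_initialIntegrand (P : IBVP n) {S : Set ℝ} (hS : S ⊆ Set.Icc 0 1) {t : ℝ}
    (ht : 0 ≤ t) (h : t ≠ 0 ∨ ∃ δ > 0, ∀ x ∈ S, δ ≤ x ∧ δ ≤ 1 - x) {φ : ℝ}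
    (hφ : Real.sin φ = 0) (hcos : 0 ≤ Real.cos (P.a.arg + n * φ)) :
    UniformTail S fun x r => P.initialIntegrand x t (r * Complex.exp (φ * Complex.I)) *
      Complex.exp (φ * Complex.I) := by
  set d := Complex.exp (φ * Complex.I) with hd
  have hd1 : ‖d‖ = 1 := Complex.norm_exp_ofReal_mul_I φ
  have hd0 : d ≠ 0 := Complex.exp_ne_zero _
  have hdim : d.im = 0 := by rw [hd, Complex.exp_ofReal_mul_I_im, hφ]
  have hare : 0 ≤ (P.a * d ^ n).re := by
    have := P.re_polar 1 φ
    simp only [Complex.ofReal_one, one_mul, one_pow] at this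
    rwa [hd, this]
  set w := -(P.a * d ^ n * t) with hw
  have hwre : w.re ≤ 0 := by
    rw [hw, Complex.neg_re, Complex.re_mul_ofReal]
    exact neg_nonpos.2 (mul_nonneg hare ht)
  have hw0 : t ≠ 0 → w ≠ 0 := fun h0 => by
    have ha : P.a ≠ 0 := norm_pos_iff.1 (by rw [norm_a]; exact one_pos)
    exact neg_ne_zero.2 (mul_ne_zero (mul_ne_zero ha (pow_ne_zero _ hd0)) (by exact_mod_cast h0))
  have htail : ∀ y : ℝ → ℝ, (∀ x ∈ S, |y x| ≤ 1) →
      (t ≠ 0 ∨ ∃ δ > 0, ∀ x ∈ S, δ ≤ |y x|) →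
      UniformTail S fun x r => Complex.exp (Complex.I * d * y x * r + w * r ^ n) / r := by
    intro y hy hδ
    refine UniformTail.exp_div P.two_le (fun x hx => ?_) (fun x hx => ?_) hwre (hδ.imp hw0 ?_)
    · rw [Complex.re_mul_ofReal, Complex.I_mul_re, hdim]
      simp
    · simpa [hd1] using hy x hx
    · rintro ⟨δ, hδ, hδS⟩
      exact ⟨δ, hδ, fun x hx => by simpa [hd1] using hδS x hx⟩
  have h0 := htail (fun x => x) (fun x hx => by rw [abs_of_nonneg (hS hx).1]; exact (hS hx).2)
    (h.imp_right fun ⟨δ, hδ, hδS⟩ => ⟨δ, hδ, fun x hx => (hδS x hx).1.trans (le_abs_self x)⟩)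
  have h1 := htail (fun x => x - 1)
    (fun x hx => by
      rw [abs_of_nonpos (by linarith [(hS hx).2])]
      linarith [(hS hx).1])
    (h.imp_right fun ⟨δ, hδ, hδS⟩ => ⟨δ, hδ, fun x hx => by
      have := neg_le_abs (x - 1)
      linarith [(hδS x hx).2]⟩)
  obtain ⟨C, hC0, hC⟩ := exists_norm_exp_mul_integral_sub_le one_pos P.q₀_smooth
  set M₀ : ℝ → ℝ → ℂ := fun x r => Complex.exp (Complex.I * d * x * r + w * r ^ n) / r with hM₀
  set M₁ : ℝ → ℝ → ℂ := fun x r =>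
    Complex.exp (Complex.I * d * ((x - 1 : ℝ) : ℂ) * r + w * r ^ n) / r with hM₁
  set F : ℝ → ℝ → ℂ := fun x r => P.initialIntegrand x t (r * d) * d with hF
  have hFc : ∀ x ∈ S, ContinuousOn (F x) (Set.Ioi 0) := fun x _ => by
    have := P.continuous_initialIntegrand x t
    exact Continuous.continuousOn (by fun_prop)
  have hM₀c : ∀ x ∈ S, ContinuousOn (M₀ x) (Set.Ioi 0) := fun x _ => continuousOn_exp_div _ _ _
  have hM₁c : ∀ x ∈ S, ContinuousOn (M₁ x) (Set.Ioi 0) := fun x _ => continuousOn_exp_div _ _ _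
  have hmain : UniformTail S fun x r =>
      (Complex.I * P.q₀ 1) * M₁ x r + (-(Complex.I * P.q₀ 0)) * M₀ x r :=
    (h1.const_mul _).add (h0.const_mul _) (fun x hx => continuousOn_const.mul (hM₁c x hx))
      fun x hx => continuousOn_const.mul (hM₀c x hx)
  have hmc : ∀ x ∈ S, ContinuousOn (fun r => (Complex.I * P.q₀ 1) * M₁ x r +
      (-(Complex.I * P.q₀ 0)) * M₀ x r) (Set.Ioi 0) := fun x hx =>
    (continuousOn_const.mul (hM₁c x hx)).add (continuousOn_const.mul (hM₀c x hx))
  have hrem : UniformTail S fun x r => F x r - ((Complex.I * P.q₀ 1) * M₁ x r +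
      (-(Complex.I * P.q₀ 0)) * M₀ x r) := by
    refine UniformTail.of_bound hC0 one_pos fun x hx r hr => ?_
    have hr0 : 0 < r := one_pos.trans_le hr
    have hrc : (r : ℂ) ≠ 0 := by exact_mod_cast hr0.ne'
    set l : ℂ := -Complex.I * (r * d) with hl
    have hl0 : l ≠ 0 := mul_ne_zero (neg_ne_zero.2 Complex.I_ne_zero) (mul_ne_zero hrc hd0)
    have hln : ‖l‖ = r := by
      rw [hl, norm_mul, norm_mul, norm_neg, Complex.norm_I, hd1, Complex.norm_real,
        Real.norm_of_nonneg hr0.le]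
      ring
    have hb := hC l hl0 0 fun s _ => by
      rw [Complex.ofReal_zero, sub_zero, Complex.re_mul_ofReal, hl, neg_mul, Complex.neg_re,
        Complex.I_mul_re, Complex.im_ofReal_mul, hdim]
      simp
    rw [hln] at hb
    set E := Complex.exp (Complex.I * d * x * r + w * r ^ n) with hE
    have hEn : ‖E‖ ≤ 1 := by
      rw [hE, Complex.norm_exp, Real.exp_le_one_iff, Complex.add_re, Complex.re_mul_ofReal,
        Complex.re_mul_ofReal, Complex.I_mul_re, hdim, ← Complex.ofReal_pow, Complex.re_mul_ofReal]
      have : w.re * r ^ n ≤ 0 := mul_nonpos_of_nonpos_of_nonneg hwre (by positivity)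
      simpa using this
    have hFE : F x r = E * d * ∫ s in (0 : ℝ)..1, Complex.exp (l * s) * P.q₀ s := by
      simp only [hF, initialIntegrand, fourierTransform]
      rw [show Complex.I * (r * d) * x - P.a * (r * d) ^ n * t =
        Complex.I * d * x * r + w * r ^ n by rw [hw]; ring]
      ring
    have hM1E : M₁ x r = E * Complex.exp l / r := by
      rw [hM₁, hE, ← Complex.exp_add, hl]
      push_cast
      ring_nf
    have hdl : d / l = Complex.I / r := by
      rw [hl]
      field_simp
      rw [Complex.I_sq]
    have : F x r - ((Complex.I * P.q₀ 1) * M₁ x r + (-(Complex.I * P.q₀ 0)) * M₀ x r) =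
        E * d * (Complex.exp (-(l * (0 : ℝ))) * (∫ s in (0 : ℝ)..1, Complex.exp (l * s) * P.q₀ s) -
        (Complex.exp (l * ((1 : ℝ) - (0 : ℝ))) * P.q₀ 1 -
          Complex.exp (l * ((0 : ℝ) - (0 : ℝ))) * P.q₀ 0) / l) := by
      simp only [Complex.ofReal_zero, Complex.ofReal_one, mul_zero, neg_zero, Complex.exp_zero,
        one_mul, sub_zero, mul_one, sub_self]
      rw [hFE, hM1E, hM₀]
      linear_combination (-E * (Complex.exp l * P.q₀ 1 - P.q₀ 0)) * (-hdl)
    rw [this, norm_mul, norm_mul, hd1, mul_one]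
    exact (mul_le_of_le_one_left (norm_nonneg _) hEn).trans hb
  refine (hmain.add hrem hmc fun x hx => (hFc x hx).sub (hmc x hx)).congr fun x _ r _ => ?_
  simp only [hF]
  ring

/-- On the edge of a sector aρⁿ is purely imaginary, so the time exponentials only oscillate. The
leading terms come from the time endpoints 0 and T and carry phases proportional to −t and T − t.
Hence the requirement 0 < t < T, or else y bounded away from 0. -/
theorem IsSolution.uniformTail_boundaryIntegrand (hq : P.IsSolution q) {e : ℝ}
    (he : e ∈ Set.Icc (0 : ℝ) 1) {S : Set ℝ} {y : ℝ → ℝ} (hy : ∀ x ∈ S, |y x| ≤ 1) {t : ℝ}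
    (h : t ∈ Set.Ioo 0 P.T ∨ ∃ δ > 0, ∀ x ∈ S, δ ≤ |y x|) {φ : ℝ}
    (hφ : ∀ x ∈ S, 0 ≤ Real.sin φ * y x) (hcos : Real.cos (P.a.arg + n * φ) = 0) :
    UniformTail S fun x r => P.boundaryIntegrand q e (y x) t (r * Complex.exp (φ * Complex.I)) *
      Complex.exp (φ * Complex.I) := by
  set d := Complex.exp (φ * Complex.I) with hd
  have hd1 : ‖d‖ = 1 := Complex.norm_exp_ofReal_mul_I φ
  have hd0 : d ≠ 0 := Complex.exp_ne_zero _
  have hdim : d.im = Real.sin φ := by rw [hd, Complex.exp_ofReal_mul_I_im]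
  set μ := P.a * d ^ n with hμ
  have hμ1 : ‖μ‖ = 1 := by rw [hμ, norm_mul, norm_a, norm_pow, hd1, one_pow, one_mul]
  have hμ0 : μ ≠ 0 := norm_pos_iff.1 (by rw [hμ1]; exact one_pos)
  have hμre : μ.re = 0 := by
    have := P.re_polar 1 φ
    simp only [Complex.ofReal_one, one_mul, one_pow] at this
    rw [hμ, hd, this, hcos]
  have hzre : ∀ x ∈ S, (Complex.I * d * y x).re ≤ 0 := fun x hx => by
    rw [Complex.re_mul_ofReal, Complex.I_mul_re, hdim]
    linarith [hφ x hx]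
  have hl : ∀ r : ℝ, P.a * (r * d) ^ n = μ * r ^ n := fun r => by rw [hμ]; ring
  have htail : ∀ τ : ℝ, (τ ≠ 0 ∨ ∃ δ > 0, ∀ x ∈ S, δ ≤ |y x|) →
      UniformTail S fun x r => Complex.exp (Complex.I * d * y x * r + μ * τ * r ^ n) / r := by
    intro τ hτ
    refine UniformTail.exp_div P.two_le hzre (fun x hx => ?_) ?_ (hτ.imp ?_ ?_)
    · simpa [hd1] using hy x hx
    · rw [Complex.re_mul_ofReal, hμre, zero_mul]
    · exact fun h0 => mul_ne_zero hμ0 (by exact_mod_cast h0)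
    · rintro ⟨δ, hδ, hδS⟩
      exact ⟨δ, hδ, fun x hx => by simpa [hd1] using hδS x hx⟩
  have hT := htail (P.T - t) (h.imp_left fun h => sub_ne_zero.2 h.2.ne')
  have h0 := htail (-t) (h.imp_left fun h => neg_ne_zero.2 h.1.ne')
  have hE : ∀ x ∈ S, ∀ r : ℝ, 0 < r → ‖Complex.exp (Complex.I * d * y x * r)‖ ≤ 1 :=
    fun x hx r hr => by
      rw [Complex.norm_exp, Real.exp_le_one_iff, Complex.re_mul_ofReal]
      exact mul_nonpos_of_nonpos_of_nonneg (hzre x hx) hr.le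
  set X : Fin n → ℝ → ℂ := fun j r =>
    ∫ s in (0 : ℝ)..P.T, Complex.exp (P.a * (r * d) ^ n * s) * dx j q e s with hX
  set F : Fin n → ℝ → ℝ → ℂ := fun j x r => Complex.exp (Complex.I * d * y x * r) *
    (P.c j (r * d) * (Complex.exp (-(P.a * (r * d) ^ n * t)) * X j r) * d) with hF
  have hXc : ∀ j, Continuous (X j) := fun j => by
    have h1 := (differentiable_integral_cexp_mul P.T_pos.le
      (hq.continuousOn_dx j he le_rfl le_rfl)).continuous
    exact h1.comp (f := fun r : ℝ => P.a * ((r : ℂ) * d) ^ n) (by fun_prop)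
  have hFc : ∀ j x, Continuous (F j x) := fun j x => by
    have h1 := (P.differentiable_c j).continuous
    have h2 := hXc j
    simp only [hF]
    fun_prop
  have hnorm : ∀ r : ℝ, 0 < r → ‖P.a * (r * d) ^ n‖ = r ^ n := fun r hr => by
    rw [hl, norm_mul, hμ1, one_mul, norm_pow, Complex.norm_real, Real.norm_of_nonneg hr.le]
  have hnz : ∀ r : ℝ, 0 < r → P.a * (r * d) ^ n ≠ 0 := fun r hr =>
    norm_pos_iff.1 (by rw [hnorm r hr]; positivity)
  have hre : ∀ r : ℝ, ∀ s ∈ Set.Icc 0 P.T, (P.a * (r * d) ^ n * (s - t)).re ≤ 0 := fun r s _ => by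
    rw [hl, ← Complex.ofReal_sub, Complex.re_mul_ofReal, ← Complex.ofReal_pow,
      Complex.re_mul_ofReal, hμre]
    simp
  have hcn : ∀ j : Fin n, ∀ r : ℝ, 0 < r → ‖P.c j (r * d)‖ = r ^ (n - ((j : ℕ) + 1)) :=
    fun j r hr => by
      rw [norm_c, norm_mul, hd1, mul_one, Complex.norm_real, Real.norm_of_nonneg hr.le]
  have hder : ∀ j : ℕ, ∀ s ∈ Set.Icc 0 P.T, HasDerivWithinAt (dx j q e)
      (derivWithin (dx j q e) (Set.Icc 0 P.T) s) (Set.Icc 0 P.T) s := fun j s hs =>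
    ((hq.contDiffOn_dx_right j he).differentiableOn (by simp) s hs).hasDerivWithinAt
  have hdc : ∀ j : ℕ, ContinuousOn (derivWithin (dx j q e) (Set.Icc 0 P.T)) (Set.Icc 0 P.T) :=
    fun j => ((hq.contDiffOn_dx_right j he).derivWithin (m := ∞) (uniqueDiffOn_Icc P.T_pos)
      (by simp)).continuousOn
  have hj : ∀ j ∈ Finset.univ, UniformTail S (F j) := by
    intro j _
    -- Order j decays like r^{−1−j}, so only j = 0 fails to be O(r⁻²) and needs its endpoint terms
    -- split off.
    by_cases hj0 : (j : ℕ) = 0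
    · obtain ⟨C, hC0, hC⟩ := exists_norm_exp_mul_integral_sub_le P.T_pos
        (hq.contDiffOn_dx_right j he)
      set M₀ : ℝ → ℝ → ℂ := fun x r =>
        Complex.exp (Complex.I * d * y x * r + μ * (-t : ℝ) * r ^ n) / r with hM₀
      set M₁ : ℝ → ℝ → ℂ := fun x r =>
        Complex.exp (Complex.I * d * y x * r + μ * (P.T - t : ℝ) * r ^ n) / r with hM₁
      have hM₀c : ∀ x ∈ S, ContinuousOn (M₀ x) (Set.Ioi 0) := fun x _ => continuousOn_exp_div _ _ _
      have hM₁c : ∀ x ∈ S, ContinuousOn (M₁ x) (Set.Ioi 0) := fun x _ => continuousOn_exp_div _ _ _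
      have hmain : UniformTail S fun x r =>
          (Complex.I * dx j q e P.T) * M₁ x r + (-(Complex.I * dx j q e 0)) * M₀ x r :=
        (hT.const_mul _).add (h0.const_mul _) (fun x hx => continuousOn_const.mul (hM₁c x hx))
          fun x hx => continuousOn_const.mul (hM₀c x hx)
      have hmc : ∀ x ∈ S, ContinuousOn (fun r => (Complex.I * dx j q e P.T) * M₁ x r +
          (-(Complex.I * dx j q e 0)) * M₀ x r) (Set.Ioi 0) := fun x hx =>
        (continuousOn_const.mul (hM₁c x hx)).add (continuousOn_const.mul (hM₀c x hx))
      have hrem : UniformTail S fun x r => F j x r - ((Complex.I * dx j q e P.T) * M₁ x r +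
          (-(Complex.I * dx j q e 0)) * M₀ x r) := by
        refine UniformTail.of_bound hC0 one_pos fun x hx r hr => ?_
        have hr0 : 0 < r := one_pos.trans_le hr
        have hrc : (r : ℂ) ≠ 0 := by exact_mod_cast hr0.ne'
        have hb := hC _ (hnz r hr0) t (hre r)
        rw [hnorm r hr0] at hb
        have hcl : P.c j (r * d) * d / (P.a * (r * d) ^ n) = Complex.I / r := by
          have hpow : ((r : ℂ) * d) ^ n = (r * d) ^ (n - 1) * (r * d) := by
            rw [← pow_succ, show n - 1 + 1 = n by have := P.two_le; omega]
          rw [div_eq_div_iff (hnz r hr0) hrc, c, hj0, zero_add, pow_one, Complex.inv_I, hpow]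
          ring
        have hEx := hE x hx r hr0
        have e1 : M₁ x r = Complex.exp (Complex.I * d * y x * r) *
            Complex.exp (P.a * (r * d) ^ n * (P.T - t)) / r := by
          rw [hM₁, ← Complex.exp_add]
          simp only [hl]
          congr 2
          push_cast
          ring
        have e0 : M₀ x r = Complex.exp (Complex.I * d * y x * r) *
            Complex.exp (P.a * (r * d) ^ n * ((0 : ℝ) - t)) / r := by
          rw [hM₀, ← Complex.exp_add]
          simp only [hl]
          congr 2
          push_cast
          ring
        have heq : F j x r - ((Complex.I * dx j q e P.T) * M₁ x r +
            (-(Complex.I * dx j q e 0)) * M₀ x r) = Complex.exp (Complex.I * d * y x * r) *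
            (P.c j (r * d) * d) * (Complex.exp (-(P.a * (r * d) ^ n * t)) * X j r -
            (Complex.exp (P.a * (r * d) ^ n * (P.T - t)) * dx j q e P.T -
              Complex.exp (P.a * (r * d) ^ n * ((0 : ℝ) - t)) * dx j q e 0) /
              (P.a * (r * d) ^ n)) := by
          rw [e0, e1]
          simp only [hF]
          linear_combination (Complex.exp (Complex.I * d * y x * r) *
            (Complex.exp (P.a * (r * d) ^ n * (P.T - t)) * dx j q e P.T -
              Complex.exp (P.a * (r * d) ^ n * ((0 : ℝ) - t)) * dx j q e 0)) * hcl
        have hc0 : ‖P.c j (r * d)‖ = r ^ (n - 1) := by rw [hcn j r hr0, hj0]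
        rw [heq, norm_mul, norm_mul, norm_mul, hd1, mul_one, hc0]
        calc _ ≤ 1 * r ^ (n - 1) * (C / (r ^ n) ^ 2) := by gcongr
          _ ≤ C / r ^ 2 := by
            rw [one_mul, mul_div_assoc', div_le_div_iff₀ (by positivity) (by positivity)]
            have : r ^ (n - 1) * r ^ 2 ≤ (r ^ n) ^ 2 := by
              rw [← pow_add, ← pow_mul]
              exact pow_le_pow_right₀ hr (by have := P.two_le; omega)
            calc _ = C * (r ^ (n - 1) * r ^ 2) := by ring
              _ ≤ _ := mul_le_mul_of_nonneg_left this hC0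
      refine (hmain.add hrem hmc fun x hx =>
        (hFc j x).continuousOn.sub (hmc x hx)).congr fun x _ r _ => ?_
      ring
    · obtain ⟨C, hC0, hC⟩ := exists_norm_exp_mul_integral_le P.T_pos.le (hder j) (hdc j)
      refine UniformTail.of_bound hC0 one_pos fun x hx r hr => ?_
      have hr0 : 0 < r := one_pos.trans_le hr
      have hb := hC _ (hnz r hr0) t (hre r)
      rw [hnorm r hr0] at hb
      have hEx := hE x hx r hr0
      simp only [hF]
      rw [norm_mul, norm_mul, hd1, mul_one, norm_mul, hcn j r hr0]
      calc _ ≤ 1 * (r ^ (n - ((j : ℕ) + 1)) * (C / r ^ n)) := by gcongr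
        _ ≤ C / r ^ 2 := by
          rw [one_mul, mul_div_assoc', div_le_div_iff₀ (by positivity) (by positivity)]
          have : r ^ (n - ((j : ℕ) + 1)) * r ^ 2 ≤ r ^ n := by
            rw [← pow_add]
            exact pow_le_pow_right₀ hr (by have := j.2; omega)
          calc _ = C * (r ^ (n - ((j : ℕ) + 1)) * r ^ 2) := by ring
            _ ≤ _ := mul_le_mul_of_nonneg_left this hC0
  refine (UniformTail.sum Finset.univ hj fun j _ x _ => (hFc j x).continuousOn).congr
    fun x _ r _ => ?_
  simp only [hF, boundaryIntegrand, boundarySum, partialTransform, Finset.mul_sum, Finset.sum_mul]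
  refine Finset.sum_congr rfl fun j _ => ?_
  rw [sub_eq_add_neg, Complex.exp_add,
    show Complex.I * (r * d) * y x = Complex.I * d * y x * r by ring]
  ring

theorem cos_startAngle (P : IBVP n) (m : Fin n) :
    Real.cos (P.a.arg + n * P.startAngle m) = 0 := by
  have hn : (n : ℝ) ≠ 0 := by exact_mod_cast P.n_pos.ne'
  rw [startAngle, mul_div_cancel₀ _ hn, show P.a.arg + (Real.pi / 2 - P.a.arg +
    2 * Real.pi * (m : ℕ)) = Real.pi / 2 + (m : ℕ) * (2 * Real.pi) by ring,
    Real.cos_add_nat_mul_two_pi, Real.cos_pi_div_two]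

theorem cos_endAngle (P : IBVP n) (m : Fin n) :
    Real.cos (P.a.arg + n * P.endAngle m) = 0 := by
  have hn : (n : ℝ) ≠ 0 := by exact_mod_cast P.n_pos.ne'
  rw [endAngle, mul_div_cancel₀ _ hn, show P.a.arg + (3 * Real.pi / 2 - P.a.arg +
    2 * Real.pi * (m : ℕ)) = Real.pi / 2 + Real.pi + (m : ℕ) * (2 * Real.pi) by ring,
    Real.cos_add_nat_mul_two_pi, Real.cos_add_pi, Real.cos_pi_div_two, neg_zero]

theorem exists_limit_initialIntegrand (P : IBVP n) {S : Set ℝ} (hS : S ⊆ Set.Icc 0 1) {t : ℝ}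
    (ht : 0 ≤ t) (h : t ≠ 0 ∨ ∃ δ > 0, ∀ x ∈ S, δ ≤ x ∧ δ ≤ 1 - x) {φ : ℝ}
    (hφ : Real.sin φ = 0) (hcos : 0 ≤ Real.cos (P.a.arg + n * φ)) :
    ∃ L : ℝ → ℂ, ContinuousOn L S ∧ ∀ x ∈ S,
      Filter.Tendsto (rayIntegral (P.initialIntegrand x t) φ) Filter.atTop (𝓝 (L x)) := by
  refine (P.uniformTail_initialIntegrand hS ht h hφ hcos).exists_limit
    (continuous_ray_uncurry (g := fun x => P.initialIntegrand x t) ?_ φ).continuousOn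
  have := continuous_fourierTransform P.q₀_smooth.continuousOn
  unfold initialIntegrand Function.uncurry
  fun_prop

theorem IsSolution.exists_limit_boundaryIntegrand (hq : P.IsSolution q) {e : ℝ}
    (he : e ∈ Set.Icc (0 : ℝ) 1) {S : Set ℝ} {y : ℝ → ℝ} (hyc : Continuous y)
    (hy : ∀ x ∈ S, |y x| ≤ 1) {t : ℝ}
    (h : t ∈ Set.Ioo 0 P.T ∨ ∃ δ > 0, ∀ x ∈ S, δ ≤ |y x|) {φ : ℝ}
    (hφ : ∀ x ∈ S, 0 ≤ Real.sin φ * y x) (hcos : Real.cos (P.a.arg + n * φ) = 0) :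
    ∃ L : ℝ → ℂ, ContinuousOn L S ∧ ∀ x ∈ S,
      Filter.Tendsto (rayIntegral (P.boundaryIntegrand q e (y x) t) φ) Filter.atTop (𝓝 (L x)) := by
  refine (hq.uniformTail_boundaryIntegrand he hy h hφ hcos).exists_limit
    (continuous_ray_uncurry (g := fun x => P.boundaryIntegrand q e (y x) t) ?_ φ).continuousOn
  have := (hq.differentiable_segmentSum he le_rfl P.T_pos.le le_rfl).continuous
  unfold boundaryIntegrand Function.uncurry
  simp only [boundarySum_eq_segmentSum]
  fun_prop

open Classical in
/-- The integral representation, with the transforms of the boundary values as integrands. -/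
theorem IsSolution.exists_representation (hq : P.IsSolution q) {x t : ℝ}
    (hx : x ∈ Set.Icc (0 : ℝ) 1) (ht : t ∈ Set.Icc 0 P.T)
    (hxt : x ∈ Set.Ioo (0 : ℝ) 1 ∨ t ∈ Set.Ioo 0 P.T) :
    ∃ L₁ L₂ : ℂ, ∃ P₁ P₂ M₁ M₂ : Fin n → ℂ,
      Filter.Tendsto (rayIntegral (P.initialIntegrand x t) 0) Filter.atTop (𝓝 L₁) ∧
      Filter.Tendsto (rayIntegral (P.initialIntegrand x t) Real.pi) Filter.atTop (𝓝 L₂) ∧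
      (∀ m, P.sector m ⊆ P.DPlus →
        Filter.Tendsto (rayIntegral (P.boundaryIntegrand q 0 x t) (P.startAngle m))
          Filter.atTop (𝓝 (P₁ m)) ∧
        Filter.Tendsto (rayIntegral (P.boundaryIntegrand q 0 x t) (P.endAngle m))
          Filter.atTop (𝓝 (P₂ m))) ∧
      (∀ m, P.sector m ⊆ P.DMinus →
        Filter.Tendsto (rayIntegral (P.boundaryIntegrand q 1 (x - 1) t) (P.startAngle m))
          Filter.atTop (𝓝 (M₁ m)) ∧
        Filter.Tendsto (rayIntegral (P.boundaryIntegrand q 1 (x - 1) t) (P.endAngle m))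
          Filter.atTop (𝓝 (M₂ m))) ∧
      2 * Real.pi * q x t = L₁ - L₂ - ∑ m with P.sector m ⊆ P.DPlus, (P₁ m - P₂ m)
        - ∑ m with P.sector m ⊆ P.DMinus, (M₁ m - M₂ m) := by
  have hpi := Real.pi_pos
  have h01 : (0 : ℝ) ∈ Set.Icc (0 : ℝ) 1 := ⟨le_rfl, zero_le_one⟩
  have h11 : (1 : ℝ) ∈ Set.Icc (0 : ℝ) 1 := ⟨zero_le_one, le_rfl⟩
  -- For interior x the singleton suffices at every t. For 0 < t < T the whole interval is
  -- admissible, which is what allows x = 0 and x = 1 to be reached from inside.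
  obtain ⟨S, hxS, hS, hSt, hSc⟩ : ∃ S : Set ℝ, x ∈ S ∧ S ⊆ Set.Icc 0 1 ∧
      (t ∈ Set.Ioo 0 P.T ∨ ∃ δ > 0, ∀ x ∈ S, δ ≤ x ∧ δ ≤ 1 - x) ∧
      S ⊆ closure (S ∩ Set.Ioo 0 1) := by
    rcases hxt with h | h
    · refine ⟨{x}, rfl, by simpa using hx, Or.inr ⟨min x (1 - x), lt_min h.1 (by linarith [h.2]), ?_⟩,
        fun z hz => subset_closure ⟨hz, by rw [Set.mem_singleton_iff.1 hz]; exact h⟩⟩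
      rintro _ rfl
      exact ⟨min_le_left _ _, min_le_right _ _⟩
    · refine ⟨Set.Icc 0 1, hx, subset_rfl, Or.inl h, ?_⟩
      rw [Set.inter_eq_right.2 Set.Ioo_subset_Icc_self, closure_Ioo zero_ne_one]
  have hSt' : t ≠ 0 ∨ ∃ δ > 0, ∀ x ∈ S, δ ≤ x ∧ δ ≤ 1 - x := hSt.imp_left fun h => h.1.ne'
  obtain ⟨L₁, hL₁c, hL₁⟩ := P.exists_limit_initialIntegrand hS ht.1 hSt' (φ := 0) Real.sin_zero
    (by
      rw [mul_zero, add_zero]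
      exact Real.cos_nonneg_of_mem_Icc (abs_le.1 P.a_eq.2.1))
  obtain ⟨L₂, hL₂c, hL₂⟩ := P.exists_limit_initialIntegrand hS ht.1 hSt' Real.sin_pi P.a_eq.2.2
  have hplus : ∀ φ, 0 ≤ Real.sin φ → Real.cos (P.a.arg + n * φ) = 0 →
      ∃ L : ℝ → ℂ, ContinuousOn L S ∧ ∀ x ∈ S,
      Filter.Tendsto (rayIntegral (P.boundaryIntegrand q 0 x t) φ) Filter.atTop (𝓝 (L x)) :=
    fun φ hs hc => hq.exists_limit_boundaryIntegrand h01 continuous_id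
      (fun x hx => by rw [id, abs_of_nonneg (hS hx).1]; exact (hS hx).2)
      (hSt.imp_right fun ⟨δ, hδ, hδS⟩ => ⟨δ, hδ, fun x hx => (hδS x hx).1.trans (le_abs_self x)⟩)
      (fun x hx => mul_nonneg hs (hS hx).1) hc
  have hminus : ∀ φ, Real.sin φ ≤ 0 → Real.cos (P.a.arg + n * φ) = 0 →
      ∃ L : ℝ → ℂ, ContinuousOn L S ∧ ∀ x ∈ S,
      Filter.Tendsto (rayIntegral (P.boundaryIntegrand q 1 (x - 1) t) φ)
        Filter.atTop (𝓝 (L x)) :=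
    fun φ hs hc => hq.exists_limit_boundaryIntegrand (y := fun x => x - 1) h11 (by fun_prop)
      (fun x hx => by
        rw [abs_of_nonpos (by linarith [(hS hx).2])]
        linarith [(hS hx).1])
      (hSt.imp_right fun ⟨δ, hδ, hδS⟩ => ⟨δ, hδ, fun x hx => by
        have := neg_le_abs (x - 1)
        linarith [(hδS x hx).2]⟩)
      (fun x hx => mul_nonneg_of_nonpos_of_nonpos hs (by linarith [(hS hx).2])) hc
  have hsinP : ∀ m, P.sector m ⊆ P.DPlus →
      0 ≤ Real.sin (P.startAngle m) ∧ 0 ≤ Real.sin (P.endAngle m) := fun m hm => by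
    have h1 := (P.sector_subset_DPlus_iff m).1 hm
    have h2 := P.startAngle_nonneg m
    have h3 := P.startAngle_lt_endAngle m
    exact ⟨Real.sin_nonneg_of_nonneg_of_le_pi h2 (by linarith),
      Real.sin_nonneg_of_nonneg_of_le_pi (by linarith) h1⟩
  have hsinM : ∀ m, P.sector m ⊆ P.DMinus →
      Real.sin (P.startAngle m) ≤ 0 ∧ Real.sin (P.endAngle m) ≤ 0 := fun m hm => by
    have h1 := (P.sector_subset_DMinus_iff m).1 hm
    have h2 := P.endAngle_le m
    have h3 := P.startAngle_lt_endAngle m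
    rw [← Real.sin_sub_two_pi (P.startAngle m), ← Real.sin_sub_two_pi (P.endAngle m)]
    exact ⟨Real.sin_nonpos_of_nonpos_of_neg_pi_le (by linarith) (by linarith),
      Real.sin_nonpos_of_nonpos_of_neg_pi_le (by linarith) (by linarith)⟩
  choose! P₁ hP₁c hP₁ using fun m (hm : P.sector m ⊆ P.DPlus) =>
    hplus _ (hsinP m hm).1 (P.cos_startAngle m)
  choose! P₂ hP₂c hP₂ using fun m (hm : P.sector m ⊆ P.DPlus) =>
    hplus _ (hsinP m hm).2 (P.cos_endAngle m)
  choose! M₁ hM₁c hM₁ using fun m (hm : P.sector m ⊆ P.DMinus) =>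
    hminus _ (hsinM m hm).1 (P.cos_startAngle m)
  choose! M₂ hM₂c hM₂ using fun m (hm : P.sector m ⊆ P.DMinus) =>
    hminus _ (hsinM m hm).2 (P.cos_endAngle m)
  refine ⟨L₁ x, L₂ x, fun m => P₁ m x, fun m => P₂ m x, fun m => M₁ m x, fun m => M₂ m x,
    hL₁ x hxS, hL₂ x hxS, fun m hm => ⟨hP₁ m hm x hxS, hP₂ m hm x hxS⟩,
    fun m hm => ⟨hM₁ m hm x hxS, hM₂ m hm x hxS⟩, ?_⟩
  have hqt : ContinuousOn (fun x => q x t) S := by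
    have := (hq.contDiffOn_dx_left 0 ht).continuousOn.mono hS
    simpa only [dx_zero] using this
  -- At interior points the joint limit is already known, and it must agree with the combination of
  -- the separate limits. Continuity in x then carries the identity to the closure.
  have heq : Set.EqOn (fun x => 2 * Real.pi * q x t) (fun x => L₁ x - L₂ x
      - ∑ m with P.sector m ⊆ P.DPlus, (P₁ m x - P₂ m x)
      - ∑ m with P.sector m ⊆ P.DMinus, (M₁ m x - M₂ m x)) (S ∩ Set.Ioo 0 1) := by
    intro x hx
    refine tendsto_nhds_unique (hq.tendsto_representation hx.2 ht) ?_
    refine (((hL₁ x hx.1).sub (hL₂ x hx.1)).sub (tendsto_finsetSum _ fun m hm => ?_)).sub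
      (tendsto_finsetSum _ fun m hm => ?_)
    · have hm' := (Finset.mem_filter.1 hm).2
      exact (hP₁ m hm' x hx.1).sub (hP₂ m hm' x hx.1)
    · have hm' := (Finset.mem_filter.1 hm).2
      exact (hM₁ m hm' x hx.1).sub (hM₂ m hm' x hx.1)
  refine heq.of_subset_closure (continuousOn_const.mul hqt) ?_ Set.inter_subset_left hSc hxS
  refine ((hL₁c.sub hL₂c).sub (continuousOn_finsetSum _ fun m hm => ?_)).sub
    (continuousOn_finsetSum _ fun m hm => ?_)
  · have hm' := (Finset.mem_filter.1 hm).2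
    exact (hP₁c m hm').sub (hP₂c m hm')
  · have hm' := (Finset.mem_filter.1 hm).2
    exact (hM₁c m hm').sub (hM₂c m hm')

end IBVP

/-! ### Zeros on the contours and the integral formula -/

/-- Zeros of a nonzero entire function are isolated, and a discrete subset of the plane is
countable. This serves twice: zeros of Δ_P are negligible on rays, and an entire function with
uncountably many zeros vanishes. -/
theorem Differentiable.countable_zeros {f : ℂ → ℂ} (hf : Differentiable ℂ f) (h : ∃ z, f z ≠ 0) :
    (f ⁻¹' {0}).Countable := by
  obtain ⟨z, hz⟩ := h
  have hdis : IsDiscrete (f ⁻¹' {0} ∩ Set.univ) := isDiscrete_of_codiscreteWithin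
    ((hf.differentiableOn.analyticOnNhd isOpen_univ).preimage_zero_mem_codiscrete hz)
  rw [Set.inter_univ] at hdis
  exact (HereditarilyLindelofSpace.isLindelof _).countable_of_isDiscrete hdis

/-- An entire function that is not identically zero is nonzero almost everywhere on a ray. -/
theorem Differentiable.ae_ray_ne_zero {f : ℂ → ℂ} (hf : Differentiable ℂ f) (h : ∃ z, f z ≠ 0)
    (φ : ℝ) : ∀ᵐ r : ℝ, f (r * Complex.exp (φ * Complex.I)) ≠ 0 := by
  have hinj : Function.Injective fun r : ℝ => (r : ℂ) * Complex.exp (φ * Complex.I) :=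
    fun r s hrs => Complex.ofReal_injective (mul_right_cancel₀ (Complex.exp_ne_zero _) hrs)
  exact ((hf.countable_zeros h).preimage hinj).ae_notMem _

namespace IBVP

variable {n : ℕ} {P : IBVP n} {q : ℝ → ℝ → ℂ}

theorem differentiable_DeltaP (P : IBVP n) : Differentiable ℂ P.DeltaP := by
  have hc := P.differentiable_c
  have h : ∀ k j, Differentiable ℂ fun ρ => P.charMatrix ρ k j := fun k j => by
    unfold charMatrix
    simp only
    split_ifs <;> fun_prop
  unfold DeltaP
  simp only [Matrix.det_apply]
  fun_prop

theorem hasRayIntegral_of_tendsto {f : ℂ → ℂ} (hf : Continuous f) {φ : ℝ} {L : ℂ}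
    (h : Filter.Tendsto (rayIntegral f φ) Filter.atTop (𝓝 L)) : HasRayIntegral f φ L :=
  ⟨fun _ _ => (continuous_rayIntegrand hf φ).intervalIntegrable _ _, h⟩

/-- At a zero of Δ_P the quotient takes the default value 0 and differs in general from the entire
function it represents. Both requirements on a ray integral ignore such a null set. -/
theorem HasRayIntegral.congr_ae {f g : ℂ → ℂ} {φ : ℝ} {L : ℂ} (h : HasRayIntegral f φ L)
    (hfg : ∀ᵐ r : ℝ, f (r * Complex.exp (φ * Complex.I)) = g (r * Complex.exp (φ * Complex.I))) :
    HasRayIntegral g φ L := by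
  have hae : ∀ R : ℝ, ∀ᵐ r : ℝ, r ∈ Set.uIoc 0 R →
      f (r * Complex.exp (φ * Complex.I)) * Complex.exp (φ * Complex.I) =
      g (r * Complex.exp (φ * Complex.I)) * Complex.exp (φ * Complex.I) := fun R => by
    filter_upwards [hfg] with r hr _
    rw [hr]
  refine ⟨fun R hR => (h.1 R hR).congr_ae ?_, h.2.congr fun R =>
    intervalIntegral.integral_congr_ae (hae R)⟩
  exact (MeasureTheory.ae_restrict_iff' measurableSet_uIoc).2 (hae R)

theorem IsSolution.hasIntegrals (hq : P.IsSolution q) (hΔ : ∃ ρ, P.DeltaP ρ ≠ 0) {x t : ℝ}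
    (hx : x ∈ Set.Icc (0 : ℝ) 1) (ht : t ∈ Set.Icc 0 P.T)
    (hxt : x ∈ Set.Ioo (0 : ℝ) 1 ∨ t ∈ Set.Ioo 0 P.T) :
    ∃ I₀ IPlus IMinus : ℂ,
      IBVP.HasLineIntegral (fun ρ =>
        Complex.exp (Complex.I * ρ * x - P.a * ρ ^ n * t) * IBVP.fourierTransform P.q₀ ρ) I₀ ∧
      P.HasBoundaryIntegral P.DPlus (fun ρ =>
        Complex.exp (Complex.I * ρ * x - P.a * ρ ^ n * t) * P.integrandSum q P.JPlus ρ) IPlus ∧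
      P.HasBoundaryIntegral P.DMinus (fun ρ =>
        Complex.exp (Complex.I * ρ * (x - 1) - P.a * ρ ^ n * t) *
          P.integrandSum q P.JMinus ρ) IMinus ∧
      2 * Real.pi * q x t = I₀ - IPlus - IMinus := by
  classical
  obtain ⟨L₁, L₂, P₁, P₂, M₁, M₂, h1, h2, hP, hM, heq⟩ := hq.exists_representation hx ht hxt
  have hne := P.differentiable_DeltaP.ae_ray_ne_zero hΔ
  have hplus : ∀ φ L, Filter.Tendsto (rayIntegral (P.boundaryIntegrand q 0 x t) φ)
      Filter.atTop (𝓝 L) → HasRayIntegral (fun ρ =>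
        Complex.exp (Complex.I * ρ * x - P.a * ρ ^ n * t) * P.integrandSum q P.JPlus ρ) φ L :=
    fun φ L h => (hasRayIntegral_of_tendsto (hq.continuous_boundaryIntegrand ⟨le_rfl, zero_le_one⟩
      x t) h).congr_ae <| by
        filter_upwards [hne φ] with r hr
        rw [hq.integrandSum_JPlus hr, boundaryIntegrand]
  have hminus : ∀ φ L, Filter.Tendsto (rayIntegral (P.boundaryIntegrand q 1 (x - 1) t) φ)
      Filter.atTop (𝓝 L) → HasRayIntegral (fun ρ =>
        Complex.exp (Complex.I * ρ * (x - 1) - P.a * ρ ^ n * t) *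
          P.integrandSum q P.JMinus ρ) φ L :=
    fun φ L h => (hasRayIntegral_of_tendsto (hq.continuous_boundaryIntegrand ⟨zero_le_one, le_rfl⟩
      (x - 1) t) h).congr_ae <| by
        filter_upwards [hne φ] with r hr
        rw [hq.integrandSum_JMinus hr, boundaryIntegrand, Complex.ofReal_sub, Complex.ofReal_one]
  have hini := P.continuous_initialIntegrand x t
  exact ⟨L₁ - L₂, _, _, ⟨L₁, L₂, hasRayIntegral_of_tendsto hini h1,
    hasRayIntegral_of_tendsto hini h2, rfl⟩,
    ⟨P₁, P₂, fun m hm => ⟨hplus _ _ (hP m hm).1, hplus _ _ (hP m hm).2⟩, rfl⟩,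
    ⟨M₁, M₂, fun m hm => ⟨hminus _ _ (hM m hm).1, hminus _ _ (hM m hm).2⟩, rfl⟩, heq⟩

end IBVP

/-! ### Laplace inversion integrals -/

theorem norm_one_add_mul_I_sq (y : ℝ) : ‖(1 : ℂ) + y * Complex.I‖ ^ 2 = 1 + y ^ 2 := by
  rw [← Complex.normSq_eq_norm_sq, Complex.normSq_apply]
  simp
  ring

theorem one_add_mul_I_re (y : ℝ) : ((1 : ℂ) + y * Complex.I).re = 1 := by simp

/-- A function that is analytic and `O(|z|⁻²)` in a right half-plane has vanishing integral over
vertical lines. -/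
theorem integral_vertical_eq_zero {G : ℂ → ℂ} (hG : DifferentiableOn ℂ G {z | 1 ≤ z.re}) {M : ℝ}
    (hM : ∀ z : ℂ, 1 ≤ z.re → ‖G z‖ ≤ M * (‖z‖ ^ 2)⁻¹) :
    ∫ y : ℝ, G (1 + y * Complex.I) = 0 := by
  have hM0 : 0 ≤ M := by simpa using (norm_nonneg _).trans (hM 1 (by simp))
  have hcont : Continuous fun y : ℝ => G (1 + y * Complex.I) :=
    hG.continuousOn.comp_continuous (by fun_prop) fun y => (one_add_mul_I_re y).ge
  have hint : MeasureTheory.Integrable fun y : ℝ => G (1 + y * Complex.I) := by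
    refine (integrable_inv_one_add_sq.const_mul M).mono' hcont.aestronglyMeasurable
      (Filter.Eventually.of_forall fun y => ?_)
    rw [← norm_one_add_mul_I_sq]
    exact hM _ (one_add_mul_I_re y).ge
  have hlim := MeasureTheory.intervalIntegral_tendsto_integral hint Filter.tendsto_neg_atTop_atBot
    Filter.tendsto_id
  refine tendsto_nhds_unique hlim (squeeze_zero_norm' (a := fun Y : ℝ => 4 * M / Y) ?_ ?_)
  · filter_upwards [Filter.eventually_gt_atTop 0] with Y hY
    -- Cauchy's theorem on the rectangle [1, 1+Y] × [−Y, Y]. On the other three sides |z| ≥ Y and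
    -- their total length is 4Y, whence the bound 4M/Y.
    have key := Complex.integral_boundary_rect_eq_zero_of_differentiableOn G
      (1 + ((-Y : ℝ) : ℂ) * Complex.I) (((1 + Y : ℝ) : ℂ) + Y * Complex.I) (hG.mono ?_)
    · have hre : ((1 : ℂ) + ((-Y : ℝ) : ℂ) * Complex.I).re = 1 := one_add_mul_I_re _
      have him : ((1 : ℂ) + ((-Y : ℝ) : ℂ) * Complex.I).im = -Y := by simp
      have hre' : (((1 + Y : ℝ) : ℂ) + Y * Complex.I).re = 1 + Y := by simp
      have him' : (((1 + Y : ℝ) : ℂ) + Y * Complex.I).im = Y := by simp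
      rw [hre, him, hre', him', Complex.ofReal_one, smul_eq_mul, smul_eq_mul] at key
      have hb : ∀ z : ℂ, 1 ≤ z.re → Y ≤ ‖z‖ → ‖G z‖ ≤ M * (Y ^ 2)⁻¹ := fun z h1 h2 =>
        (hM z h1).trans (by gcongr)
      have h1 : ∀ s : ℝ, |s| = Y → ‖∫ x in (1 : ℝ)..1 + Y, G (x + s * Complex.I)‖ ≤
          M * (Y ^ 2)⁻¹ * Y := fun s hs => by
        have := intervalIntegral.norm_integral_le_of_norm_le_const (a := 1) (b := 1 + Y)
          (f := fun x : ℝ => G (x + s * Complex.I)) (C := M * (Y ^ 2)⁻¹) fun x hx => by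
            rw [Set.uIoc_of_le (by linarith)] at hx
            refine hb _ (by simpa using hx.1.le) ?_
            have := Complex.abs_im_le_norm ((x : ℂ) + s * Complex.I)
            simpa [hs] using this
        rwa [add_sub_cancel_left, abs_of_pos hY] at this
      have h2 : ‖∫ y in (-Y)..Y, G (((1 + Y : ℝ) : ℂ) + y * Complex.I)‖ ≤
          M * (Y ^ 2)⁻¹ * (2 * Y) := by
        have := intervalIntegral.norm_integral_le_of_norm_le_const (a := -Y) (b := Y)
          (f := fun y : ℝ => G (((1 + Y : ℝ) : ℂ) + y * Complex.I)) (C := M * (Y ^ 2)⁻¹)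
          fun y _ => by
            refine hb _ (by simpa using hY.le) ?_
            have := Complex.re_le_norm (((1 + Y : ℝ) : ℂ) + y * Complex.I)
            rw [Complex.add_re, Complex.ofReal_re, Complex.re_ofReal_mul, Complex.I_re,
              mul_zero] at this
            linarith
        rwa [show Y - -Y = 2 * Y by ring, abs_of_pos (by linarith)] at this
      have h3 := h1 (-Y) (by rw [abs_neg, abs_of_pos hY])
      have h4 := h1 Y (abs_of_pos hY)
      rw [id]
      set A := ∫ y in (-Y)..Y, G (1 + y * Complex.I)
      set B := ∫ y in (-Y)..Y, G (((1 + Y : ℝ) : ℂ) + y * Complex.I)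
      have hA : ‖A‖ = ‖Complex.I * A‖ := by rw [norm_mul, Complex.norm_I, one_mul]
      have hB : ‖B‖ = ‖Complex.I * B‖ := by rw [norm_mul, Complex.norm_I, one_mul]
      rw [hA, ← sub_eq_zero.1 key]
      rw [hB] at h2
      refine (norm_add_le _ _).trans ((add_le_add_left (norm_sub_le _ _) _).trans ?_)
      have : 4 * M / Y = M * (Y ^ 2)⁻¹ * Y + M * (Y ^ 2)⁻¹ * Y + M * (Y ^ 2)⁻¹ * (2 * Y) := by
        field_simp
        ring
      linarith
    · intro z hz
      have := hz.1
      simp only [Set.mem_preimage, one_add_mul_I_re] at this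
      rw [Set.uIcc_of_le (by simp; linarith)] at this
      exact this.1
  · exact tendsto_const_nhds.div_atTop Filter.tendsto_id

/-- A multiplier, analytic in the right half-plane, that decays faster than any
`exp(-K |z|^{1/2})`. -/
noncomputable def decayMultiplier (z : ℂ) : ℂ := Complex.exp (-z ^ (3 / 4 : ℂ))

theorem decayMultiplier_ne_zero (z : ℂ) : decayMultiplier z ≠ 0 := Complex.exp_ne_zero _

theorem differentiableAt_decayMultiplier {z : ℂ} (hz : 1 ≤ z.re) :
    DifferentiableAt ℂ decayMultiplier z := by
  have : DifferentiableAt ℂ (fun z : ℂ => z ^ (3 / 4 : ℂ)) z :=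
    differentiableAt_id.cpow_const (Or.inl (by simpa using by linarith))
  unfold decayMultiplier
  fun_prop

theorem one_le_norm_of_one_le_re {z : ℂ} (hz : 1 ≤ z.re) : 1 ≤ ‖z‖ :=
  hz.trans (Complex.re_le_norm z)

/-- In the right half plane the argument of z^{3/4} is at most 3π/8 < π/2, so its real part is
comparable with its modulus. The nested square roots express |z|^{3/4} as a cube. -/
theorem norm_decayMultiplier_le {z : ℂ} (hz : 1 ≤ z.re) :
    ‖decayMultiplier z‖ ≤ Real.exp (-(Real.cos (3 * Real.pi / 8) * √(√‖z‖) ^ 3)) := by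
  have hpi := Real.pi_pos
  have hz0 : z ≠ 0 := by
    rintro rfl
    norm_num at hz
  have hpos : 0 < ‖z‖ := norm_pos_iff.2 hz0
  rw [decayMultiplier, Complex.norm_exp, Complex.neg_re]
  refine Real.exp_le_exp.2 (neg_le_neg ?_)
  have h34 : (3 / 4 : ℂ) = ((3 / 4 : ℝ) : ℂ) := by norm_num
  have hpow : ‖z‖ ^ (3 / 4 : ℝ) = √(√‖z‖) ^ 3 := by
    rw [Real.sqrt_eq_rpow, Real.sqrt_eq_rpow, ← Real.rpow_mul hpos.le, ← Real.rpow_natCast,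
      ← Real.rpow_mul hpos.le]
    norm_num
  have harg : |z.arg| ≤ Real.pi / 2 := Complex.abs_arg_le_pi_div_two_iff.2 (by linarith)
  rw [h34, Complex.cpow_ofReal_re, hpow, mul_comm]
  refine mul_le_mul_of_nonneg_left ?_ (by positivity)
  rw [← Real.cos_abs (z.arg * _)]
  rw [abs_mul, abs_of_pos (by norm_num : (0 : ℝ) < 3 / 4)]
  exact Real.cos_le_cos_of_nonneg_of_le_pi (by positivity) (by linarith) (by linarith)

/-- With u = |z|^{1/4} the product is at most exp(Ku² − cu³), and the cubic term wins. To gain |z|⁻²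
as well, |z|² = u⁸ is bounded by 8!·e^u, which accounts for the factorial and for K + 1 in place of
K. -/
theorem exists_exp_mul_norm_decayMultiplier_le {K : ℝ} (hK : 0 ≤ K) :
    ∃ M, 0 ≤ M ∧ ∀ z : ℂ, 1 ≤ z.re →
      Real.exp (K * √‖z‖) * ‖decayMultiplier z‖ ≤ M * (‖z‖ ^ 2)⁻¹ := by
  set c := Real.cos (3 * Real.pi / 8) with hc
  have hc0 : 0 < c := Real.cos_pos_of_mem_Ioo
    ⟨by linarith [Real.pi_pos], by linarith [Real.pi_pos]⟩
  refine ⟨(Nat.factorial 8 : ℝ) * Real.exp ((K + 1) ^ 3 / c ^ 2), by positivity, fun z hz => ?_⟩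
  have h1 := one_le_norm_of_one_le_re hz
  set u := √(√‖z‖) with hu
  have hu1 : 1 ≤ u := Real.one_le_sqrt.2 (Real.one_le_sqrt.2 h1)
  have hu2 : √‖z‖ = u ^ 2 := (Real.sq_sqrt (Real.sqrt_nonneg _)).symm
  have hu4 : ‖z‖ = u ^ 4 := by
    rw [show u ^ 4 = (u ^ 2) ^ 2 by ring, ← hu2, Real.sq_sqrt (norm_nonneg _)]
  have hd := norm_decayMultiplier_le hz
  rw [← hc, ← hu] at hd
  rw [← div_eq_mul_inv, le_div_iff₀ (by positivity), hu2]
  have h8 : ‖z‖ ^ 2 ≤ (Nat.factorial 8 : ℝ) * Real.exp (u ^ 2) := by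
    have h := Real.pow_div_factorial_le_exp u (by linarith) 8
    rw [div_le_iff₀ (by positivity)] at h
    have h' : Real.exp u ≤ Real.exp (u ^ 2) := Real.exp_le_exp.2 (by nlinarith)
    rw [hu4, ← pow_mul]
    exact h.trans ((mul_comm _ _).trans_le (by gcongr))
  -- Split at cu = K + 1: below it the quadratic term is bounded by the constant, above it the
  -- expression is nonpositive.
  have hexp : (K + 1) * u ^ 2 - c * u ^ 3 ≤ (K + 1) ^ 3 / c ^ 2 := by
    rw [le_div_iff₀ (by positivity)]
    rcases le_total (c * u) (K + 1) with h | h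
    · have : (c * u) ^ 2 ≤ (K + 1) ^ 2 := by gcongr
      have h0 : 0 ≤ c ^ 3 * u ^ 3 := by positivity
      nlinarith
    · have h2 : (K + 1) * (c ^ 2 * u ^ 2) ≤ c * u * (c ^ 2 * u ^ 2) := by gcongr
      have h0 : 0 ≤ (K + 1) ^ 3 := by positivity
      nlinarith
  calc Real.exp (K * u ^ 2) * ‖decayMultiplier z‖ * ‖z‖ ^ 2
      ≤ Real.exp (K * u ^ 2) * Real.exp (-(c * u ^ 3)) *
        ((Nat.factorial 8 : ℝ) * Real.exp (u ^ 2)) := by gcongr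
    _ = (Nat.factorial 8 : ℝ) * Real.exp ((K + 1) * u ^ 2 - c * u ^ 3) := by
      rw [show (K + 1) * u ^ 2 - c * u ^ 3 = K * u ^ 2 + -(c * u ^ 3) + u ^ 2 by ring, Real.exp_add,
        Real.exp_add]
      ring
    _ ≤ _ := by gcongr

/-! ### Superpositions of exponentials -/

/-- The superposition `∫ e^{μ(y) t + ν(y) x} H(y) dy` of exponential solutions, as a function of
`(x, t)`. -/
noncomputable def expIntegral (μ ν H : ℝ → ℂ) (p : ℝ × ℝ) : ℂ :=
  ∫ y, Complex.exp (μ y * p.2 + ν y * p.1) * H y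

/-- `H` decays faster than every `e^{-N w}`, where the weight `w` controls the exponents. -/
structure ExpDecay (w : ℝ → ℝ) (H : ℝ → ℂ) : Prop where
  continuous : Continuous H
  integrable : ∀ N : ℕ, MeasureTheory.Integrable fun y => Real.exp (N * w y) * ‖H y‖

/-- A factor of size e^w costs one unit of N. Since differentiation multiplies the density by an
exponent, decay against every e^{Nw} is the condition stable under all derivatives. -/
theorem ExpDecay.mul {w : ℝ → ℝ} {H ν : ℝ → ℂ} (hw : Continuous w) (hH : ExpDecay w H)
    (hν : Continuous ν) (hνw : ∀ y, ‖ν y‖ ≤ Real.exp (w y)) : ExpDecay w fun y => ν y * H y where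
  continuous := hν.mul hH.continuous
  integrable N := by
    refine (hH.integrable (N + 1)).mono' ?_ (Filter.Eventually.of_forall fun y => ?_)
    · have := hH.continuous
      exact Continuous.aestronglyMeasurable (by fun_prop)
    · rw [norm_mul, norm_norm, norm_mul, Real.norm_of_nonneg (Real.exp_pos _).le]
      calc _ ≤ Real.exp (N * w y) * (Real.exp (w y) * ‖H y‖) := by gcongr; exact hνw y
        _ = _ := by
          rw [← mul_assoc, ← Real.exp_add]
          push_cast
          ring_nf

section

variable {w : ℝ → ℝ} {μ ν H : ℝ → ℂ}

theorem norm_exp_mul_le {K : ℕ} (hμw : ∀ y, |(μ y).re| ≤ w y) (hνw : ∀ y, |(ν y).re| ≤ w y)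
    {p : ℝ × ℝ} (hp : |p.1| + |p.2| ≤ K) (y : ℝ) :
    ‖Complex.exp (μ y * p.2 + ν y * p.1) * H y‖ ≤ Real.exp (K * w y) * ‖H y‖ := by
  rw [norm_mul, Complex.norm_exp, Complex.add_re, Complex.re_mul_ofReal, Complex.re_mul_ofReal]
  have hw0 : 0 ≤ w y := (abs_nonneg _).trans (hμw y)
  have h1 : (μ y).re * p.2 ≤ w y * |p.2| :=
    (le_abs_self _).trans (by rw [abs_mul]; gcongr; exact hμw y)
  have h2 : (ν y).re * p.1 ≤ w y * |p.1| :=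
    (le_abs_self _).trans (by rw [abs_mul]; gcongr; exact hνw y)
  have h3 : w y * (|p.1| + |p.2|) ≤ w y * K := by gcongr
  have h4 : (μ y).re * p.2 + (ν y).re * p.1 ≤ K * w y := by linarith
  gcongr

theorem continuous_expIntegrand (hμ : Continuous μ) (hν : Continuous ν) (hH : ExpDecay w H)
    (p : ℝ × ℝ) : Continuous fun y => Complex.exp (μ y * p.2 + ν y * p.1) * H y := by
  have := hH.continuous
  fun_prop

theorem integrable_expIntegrand (hμ : Continuous μ) (hν : Continuous ν) (hH : ExpDecay w H)
    (hμw : ∀ y, |(μ y).re| ≤ w y) (hνw : ∀ y, |(ν y).re| ≤ w y) (p : ℝ × ℝ) :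
    MeasureTheory.Integrable fun y => Complex.exp (μ y * p.2 + ν y * p.1) * H y :=
  (hH.integrable ⌈|p.1| + |p.2|⌉₊).mono'
    (continuous_expIntegrand hμ hν hH p).aestronglyMeasurable
    (Filter.Eventually.of_forall (norm_exp_mul_le hμw hνw (Nat.le_ceil _)))

theorem hasFDerivAt_expIntegral (hw : Continuous w) (hμ : Continuous μ) (hν : Continuous ν)
    (hH : ExpDecay w H) (hμw : ∀ y, |(μ y).re| ≤ w y) (hνw : ∀ y, |(ν y).re| ≤ w y)
    (hμw' : ∀ y, ‖μ y‖ ≤ Real.exp (w y)) (hνw' : ∀ y, ‖ν y‖ ≤ Real.exp (w y)) (p : ℝ × ℝ) :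
    HasFDerivAt (expIntegral μ ν H)
      (expIntegral μ ν (fun y => ν y * H y) p •
          Complex.ofRealCLM.comp (ContinuousLinearMap.fst ℝ ℝ ℝ) +
        expIntegral μ ν (fun y => μ y * H y) p •
          Complex.ofRealCLM.comp (ContinuousLinearMap.snd ℝ ℝ ℝ)) p := by
  set L₁ : ℝ × ℝ →L[ℝ] ℂ := Complex.ofRealCLM.comp (ContinuousLinearMap.fst ℝ ℝ ℝ) with hL₁
  set L₂ : ℝ × ℝ →L[ℝ] ℂ := Complex.ofRealCLM.comp (ContinuousLinearMap.snd ℝ ℝ ℝ) with hL₂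
  have hνH := hH.mul hw hν hνw'
  have hμH := hH.mul hw hμ hμw'
  have hi₁ := integrable_expIntegrand hμ hν hνH hμw hνw p
  have hi₂ := integrable_expIntegrand hμ hν hμH hμw hνw p
  have key : HasFDerivAt (expIntegral μ ν H)
      (∫ y, ((Complex.exp (μ y * p.2 + ν y * p.1) * (ν y * H y)) • L₁ +
        (Complex.exp (μ y * p.2 + ν y * p.1) * (μ y * H y)) • L₂)) p := by
    -- Within the unit ball of the sup metric each coordinate moves by less than 1, hence the
    -- summand 2.
    set K : ℕ := ⌈|p.1| + |p.2| + 2⌉₊ with hK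
    have hball : ∀ p' ∈ Metric.ball p 1, |p'.1| + |p'.2| ≤ K := fun p' hp' => by
      have h := (Prod.dist_eq (x := p') (y := p)).symm.trans_lt (Metric.mem_ball.1 hp')
      have h1 := (le_max_left _ _).trans_lt h
      have h2 := (le_max_right _ _).trans_lt h
      rw [Real.dist_eq] at h1 h2
      have h3 := abs_sub_abs_le_abs_sub p'.1 p.1
      have h4 := abs_sub_abs_le_abs_sub p'.2 p.2
      exact le_trans (by linarith) (Nat.le_ceil _)
    refine hasFDerivAt_integral_of_dominated_of_fderiv_le
      (F := fun (p : ℝ × ℝ) y => Complex.exp (μ y * p.2 + ν y * p.1) * H y)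
      (F' := fun (p : ℝ × ℝ) y => (Complex.exp (μ y * p.2 + ν y * p.1) * (ν y * H y)) • L₁ +
        (Complex.exp (μ y * p.2 + ν y * p.1) * (μ y * H y)) • L₂)
      (bound := fun y => Real.exp (K * w y) * ‖ν y * H y‖ * ‖L₁‖ +
        Real.exp (K * w y) * ‖μ y * H y‖ * ‖L₂‖)
      (Metric.ball_mem_nhds p one_pos) ?_ ?_ ?_ ?_ ?_ ?_
    · exact Filter.Eventually.of_forall fun p' =>
        (continuous_expIntegrand hμ hν hH p').aestronglyMeasurable
    · exact integrable_expIntegrand hμ hν hH hμw hνw p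
    · exact ((hi₁.smul_const L₁).add (hi₂.smul_const L₂)).aestronglyMeasurable
    · refine Filter.Eventually.of_forall fun y p' hp' => (norm_add_le _ _).trans ?_
      rw [norm_smul, norm_smul]
      gcongr
      · exact norm_exp_mul_le (H := fun y => ν y * H y) hμw hνw (hball p' hp') y
      · exact norm_exp_mul_le (H := fun y => μ y * H y) hμw hνw (hball p' hp') y
    · exact ((hνH.integrable K).mul_const _).add ((hμH.integrable K).mul_const _)
    · refine Filter.Eventually.of_forall fun y p' _ => ?_
      have h1 : HasFDerivAt (fun p : ℝ × ℝ => (p.1 : ℂ)) L₁ p' := L₁.hasFDerivAt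
      have h2 : HasFDerivAt (fun p : ℝ × ℝ => (p.2 : ℂ)) L₂ p' := L₂.hasFDerivAt
      have h3 : HasFDerivAt (fun p : ℝ × ℝ => μ y * p.2 + ν y * p.1) (μ y • L₂ + ν y • L₁) p' :=
        (h2.const_mul (μ y)).add (h1.const_mul (ν y))
      refine (h3.cexp.mul_const (H y)).congr_fderiv ?_
      rw [smul_add, smul_add, smul_smul, smul_smul, smul_smul, smul_smul, add_comm]
      congr 2 <;> ring
  rwa [MeasureTheory.integral_add (hi₁.smul_const L₁) (hi₂.smul_const L₂),
    integral_smul_const, integral_smul_const] at key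

/-- The derivative is built from integrals of the same kind with densities νH and μH, which again
satisfy `ExpDecay`. The induction therefore has to run over all densities at once. -/
theorem contDiff_expIntegral (hw : Continuous w) (hμ : Continuous μ) (hν : Continuous ν)
    (hH : ExpDecay w H) (hμw : ∀ y, |(μ y).re| ≤ w y) (hνw : ∀ y, |(ν y).re| ≤ w y)
    (hμw' : ∀ y, ‖μ y‖ ≤ Real.exp (w y)) (hνw' : ∀ y, ‖ν y‖ ≤ Real.exp (w y)) :
    ContDiff ℝ ∞ (expIntegral μ ν H) := by
  refine contDiff_infty.2 fun m => ?_
  induction m generalizing H with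
  | zero =>
    exact contDiff_zero.2 (continuous_iff_continuousAt.2 fun p =>
      (hasFDerivAt_expIntegral hw hμ hν hH hμw hνw hμw' hνw' p).continuousAt)
  | succ m ih =>
    refine contDiff_succ_iff_hasFDerivAt.2 ⟨_, ?_,
      hasFDerivAt_expIntegral hw hμ hν hH hμw hνw hμw' hνw'⟩
    exact ((ih (hH.mul hw hν hνw')).smul contDiff_const).add
      ((ih (hH.mul hw hμ hμw')).smul contDiff_const)

theorem hasDerivAt_expIntegral_left (hw : Continuous w) (hμ : Continuous μ) (hν : Continuous ν)
    (hH : ExpDecay w H) (hμw : ∀ y, |(μ y).re| ≤ w y) (hνw : ∀ y, |(ν y).re| ≤ w y)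
    (hμw' : ∀ y, ‖μ y‖ ≤ Real.exp (w y)) (hνw' : ∀ y, ‖ν y‖ ≤ Real.exp (w y)) (x t : ℝ) :
    HasDerivAt (fun x => expIntegral μ ν H (x, t)) (expIntegral μ ν (fun y => ν y * H y) (x, t))
      x := by
  have h := (hasFDerivAt_expIntegral hw hμ hν hH hμw hνw hμw' hνw' (x, t)).comp_hasDerivAt x
    ((hasDerivAt_id x).prodMk (hasDerivAt_const x t))
  exact h.congr_deriv (by simp)

theorem hasDerivAt_expIntegral_right (hw : Continuous w) (hμ : Continuous μ) (hν : Continuous ν)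
    (hH : ExpDecay w H) (hμw : ∀ y, |(μ y).re| ≤ w y) (hνw : ∀ y, |(ν y).re| ≤ w y)
    (hμw' : ∀ y, ‖μ y‖ ≤ Real.exp (w y)) (hνw' : ∀ y, ‖ν y‖ ≤ Real.exp (w y)) (x t : ℝ) :
    HasDerivAt (fun t => expIntegral μ ν H (x, t)) (expIntegral μ ν (fun y => μ y * H y) (x, t))
      t := by
  have h := (hasFDerivAt_expIntegral hw hμ hν hH hμw hνw hμw' hνw' (x, t)).comp_hasDerivAt t
    ((hasDerivAt_const t x).prodMk (hasDerivAt_id t))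
  exact h.congr_deriv (by simp)

end

/-! ### Entire functions of exponential type -/

/-- `f` is an entire function of exponential type. -/
structure IsExpType (f : ℂ → ℂ) : Prop where
  differentiable : Differentiable ℂ f
  bound : ∃ C K : ℝ, 0 ≤ C ∧ 0 ≤ K ∧ ∀ z, ‖f z‖ ≤ C * Real.exp (K * ‖z‖)

namespace IsExpType

variable {f g : ℂ → ℂ}

theorem const (c : ℂ) : IsExpType fun _ => c :=
  ⟨differentiable_const c, ‖c‖, 0, norm_nonneg c, le_rfl, fun z => by simp⟩

theorem add (hf : IsExpType f) (hg : IsExpType g) : IsExpType fun z => f z + g z := by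
  obtain ⟨hf, C, K, hC, hK, hCK⟩ := hf
  obtain ⟨hg, C', K', hC', hK', hCK'⟩ := hg
  refine ⟨hf.add hg, C + C', K + K', by positivity, by positivity, fun z => ?_⟩
  refine (norm_add_le _ _).trans ?_
  rw [add_mul]
  refine add_le_add ((hCK z).trans ?_) ((hCK' z).trans ?_) <;> gcongr <;> linarith

theorem mul (hf : IsExpType f) (hg : IsExpType g) : IsExpType fun z => f z * g z := by
  obtain ⟨hf, C, K, hC, hK, hCK⟩ := hf
  obtain ⟨hg, C', K', hC', hK', hCK'⟩ := hg
  refine ⟨hf.mul hg, C * C', K + K', by positivity, by positivity, fun z => ?_⟩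
  rw [norm_mul, add_mul, Real.exp_add]
  calc _ ≤ (C * Real.exp (K * ‖z‖)) * (C' * Real.exp (K' * ‖z‖)) := by
        gcongr
        exacts [hCK z, hCK' z]
    _ = _ := by ring

theorem const_mul (c : ℂ) (hf : IsExpType f) : IsExpType fun z => c * f z := (const c).mul hf

theorem neg (hf : IsExpType f) : IsExpType fun z => -f z := by
  simpa using hf.const_mul (-1)

theorem sub (hf : IsExpType f) (hg : IsExpType g) : IsExpType fun z => f z - g z := by
  simpa only [sub_eq_add_neg] using hf.add hg.neg

theorem sum {ι : Type*} (s : Finset ι) {f : ι → ℂ → ℂ} (hf : ∀ i ∈ s, IsExpType (f i)) :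
    IsExpType fun z => ∑ i ∈ s, f i z := by
  classical
  induction s using Finset.induction_on with
  | empty => simpa using const 0
  | insert i s hi ih =>
    simp only [Finset.sum_insert hi]
    exact (hf i (Finset.mem_insert_self i s)).add
      (ih fun j hj => hf j (Finset.mem_insert_of_mem hj))

theorem id : IsExpType fun z => z :=
  ⟨differentiable_id, 1, 1, zero_le_one, zero_le_one, fun z => by
    linarith [Real.add_one_le_exp (1 * ‖z‖)]⟩

theorem pow (hf : IsExpType f) (m : ℕ) : IsExpType fun z => f z ^ m := by
  induction m with
  | zero => simpa using const 1
  | succ m ih => simpa only [pow_succ] using ih.mul hf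

theorem cexp_mul (c : ℂ) : IsExpType fun z => Complex.exp (c * z) :=
  ⟨by fun_prop, 1, ‖c‖, zero_le_one, norm_nonneg c, fun z => by
    rw [Complex.norm_exp, one_mul, ← norm_mul]
    exact Real.exp_le_exp.2 (Complex.re_le_norm _)⟩

end IsExpType

/-- The ring of entire functions of exponential type. -/
def expTypeSubring : Subring (ℂ → ℂ) where
  carrier := {f | IsExpType f}
  mul_mem' := IsExpType.mul
  one_mem' := IsExpType.const 1
  add_mem' := IsExpType.add
  zero_mem' := IsExpType.const 0
  neg_mem' := IsExpType.neg

/-- Evaluation at a point, on the ring of entire functions of exponential type. -/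
def expTypeEval (z : ℂ) : expTypeSubring →+* ℂ := (Pi.evalRingHom _ z).comp expTypeSubring.subtype

instance : NoZeroDivisors expTypeSubring where
  eq_zero_or_eq_zero_of_mul_eq_zero {f g} h := by
    have han : ∀ f : expTypeSubring, AnalyticOnNhd ℂ f.1 Set.univ := fun f =>
      f.2.differentiable.differentiableOn.analyticOnNhd isOpen_univ
    refine ((han f).eq_zero_or_eq_zero_of_mul_eq_zero (han g) (fun z _ => ?_)
      isPreconnected_univ).imp (fun h => Subtype.ext (funext fun z => h z trivial))
      fun h => Subtype.ext (funext fun z => h z trivial)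
    exact congrFun (congrArg Subtype.val h) z

instance : IsDomain expTypeSubring := NoZeroDivisors.to_isDomain _

/-- A square matrix of entire functions of exponential type whose determinant vanishes identically
has a nonzero kernel vector of the same kind. -/
theorem exists_isExpType_mulVec_eq_zero {m : Type*} [Fintype m] [DecidableEq m]
    {M : ℂ → Matrix m m ℂ} (hM : ∀ i j, IsExpType fun z => M z i j) (hdet : ∀ z, (M z).det = 0) :
    ∃ X : m → ℂ → ℂ, (∀ j, IsExpType (X j)) ∧ (∃ j z, X j z ≠ 0) ∧
      ∀ z, (M z).mulVec (fun j => X j z) = 0 := by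
  let N : Matrix m m expTypeSubring := fun i j => ⟨_, hM i j⟩
  have hN : N.det = 0 := Subtype.ext <| funext fun z => by
    have : expTypeEval z N.det = (M z).det := RingHom.map_det _ _
    exact this.trans (hdet z)
  -- Over an integral domain a singular matrix has a nonzero kernel vector with entries in the ring
  -- itself, so no poles appear. The identity theorem is what makes this ring a domain.
  obtain ⟨X, hX0, hX⟩ := Matrix.exists_mulVec_eq_zero_iff.2 hN
  refine ⟨fun j => (X j).1, fun j => (X j).2, ?_, fun z => ?_⟩
  · by_contra! h
    exact hX0 (funext fun j => Subtype.ext (funext fun z => h j z))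
  · funext i
    have h := RingHom.map_mulVec (expTypeEval z) N X i
    rw [hX] at h
    exact h.symm.trans (map_zero _)

/-- As |ρ(z)| ≤ |z|^{1/2}, exponential type in ρ means growth exp(K|z|^{1/2}) in z, which the
multiplier absorbs. The factor 2 in the weight ensures |z| ≤ e^w, so that the exponent z itself is
an admissible factor. -/
theorem IsExpType.expDecay {B ρ : ℂ → ℂ} (hB : IsExpType B)
    (hρ : DifferentiableOn ℂ ρ {z | 1 ≤ z.re}) (hρn : ∀ z : ℂ, 1 ≤ z.re → ‖ρ z‖ ≤ √‖z‖) :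
    ExpDecay (fun y : ℝ => 2 * √‖1 + y * Complex.I‖) fun y : ℝ =>
      decayMultiplier (1 + y * Complex.I) * B (ρ (1 + y * Complex.I)) := by
  obtain ⟨hd, C, K, hC, hK, hCK⟩ := hB
  have hline : Continuous fun y : ℝ => (1 : ℂ) + y * Complex.I := by fun_prop
  have hD : ContinuousOn decayMultiplier {z | 1 ≤ z.re} := fun z hz =>
    (differentiableAt_decayMultiplier hz).continuousAt.continuousWithinAt
  have h1 := hD.comp_continuous hline fun y => (one_add_mul_I_re y).ge
  have h2 := hd.continuous.comp (hρ.continuousOn.comp_continuous hline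
    fun y => (one_add_mul_I_re y).ge)
  have hcont := h1.mul h2
  refine ⟨hcont, fun N => ?_⟩
  obtain ⟨M, hM0, hM⟩ := exists_exp_mul_norm_decayMultiplier_le (K := 2 * N + K) (by positivity)
  refine (integrable_inv_one_add_sq.const_mul (C * M)).mono' ?_
    (Filter.Eventually.of_forall fun y => ?_)
  · have := hcont.norm
    exact Continuous.aestronglyMeasurable
      ((by fun_prop : Continuous fun y : ℝ => Real.exp (N * (2 * √‖1 + y * Complex.I‖))).mul this)
  · have hz := (one_add_mul_I_re y).ge
    have h3 := hM _ hz
    rw [norm_one_add_mul_I_sq] at h3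
    set z : ℂ := 1 + y * Complex.I
    rw [norm_mul, norm_norm, norm_mul, Real.norm_of_nonneg (Real.exp_pos _).le]
    calc _ ≤ Real.exp (N * (2 * √‖z‖)) * (‖decayMultiplier z‖ * (C * Real.exp (K * √‖z‖))) := by
          gcongr
          exact (hCK _).trans (by gcongr; exact hρn z hz)
      _ = C * (Real.exp ((2 * N + K) * √‖z‖) * ‖decayMultiplier z‖) := by
          rw [show (2 * N + K) * √‖z‖ = N * (2 * √‖z‖) + K * √‖z‖ by ring, Real.exp_add]
          ring
      _ ≤ _ := by
          rw [mul_assoc]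
          gcongr

/-- The superposition of exponential solutions vanishes for negative times. -/
theorem IsExpType.expIntegral_eq_zero {B ρ : ℂ → ℂ} (hB : IsExpType B)
    (hρ : DifferentiableOn ℂ ρ {z | 1 ≤ z.re}) (hρn : ∀ z : ℂ, 1 ≤ z.re → ‖ρ z‖ ≤ √‖z‖)
    {d : ℂ} (hd : ‖d‖ ≤ 1) {p : ℝ × ℝ} (hp : p.2 ≤ 0) :
    expIntegral (fun y => 1 + y * Complex.I) (fun y => d * ρ (1 + y * Complex.I))
      (fun y => decayMultiplier (1 + y * Complex.I) * B (ρ (1 + y * Complex.I))) p = 0 := by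
  obtain ⟨hBd, C, K, hC, hK, hCK⟩ := hB
  obtain ⟨M, hM0, hM⟩ := exists_exp_mul_norm_decayMultiplier_le (K := |p.1| + K) (by positivity)
  refine integral_vertical_eq_zero (G := fun z => Complex.exp (z * p.2 + d * ρ z * p.1) *
    (decayMultiplier z * B (ρ z))) (M := C * M) ?_ fun z hz => ?_
  · have h1 : DifferentiableOn ℂ decayMultiplier {z | 1 ≤ z.re} := fun z hz =>
      (differentiableAt_decayMultiplier hz).differentiableWithinAt
    have h2 : DifferentiableOn ℂ (fun z => B (ρ z)) {z | 1 ≤ z.re} :=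
      hBd.comp_differentiableOn hρ
    fun_prop
  · have h3 := hM z hz
    rw [norm_mul, Complex.norm_exp, norm_mul]
    have h4 : (z * p.2 + d * ρ z * p.1).re ≤ |p.1| * √‖z‖ := by
      rw [Complex.add_re, Complex.re_mul_ofReal, Complex.re_mul_ofReal]
      -- For nonpositive time e^{zt} does not grow to the right, so only the growth in |z|^{1/2} is
      -- left for the multiplier.
      have h5 : z.re * p.2 ≤ 0 := mul_nonpos_of_nonneg_of_nonpos (by linarith) hp
      have h6 : |(d * ρ z).re| ≤ √‖z‖ := (Complex.abs_re_le_norm _).trans (by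
        rw [norm_mul]
        exact (mul_le_of_le_one_left (norm_nonneg _) hd).trans (hρn z hz))
      have h7 : (d * ρ z).re * p.1 ≤ √‖z‖ * |p.1| :=
        (le_abs_self _).trans (by rw [abs_mul]; gcongr)
      linarith
    calc _ ≤ Real.exp (|p.1| * √‖z‖) * (‖decayMultiplier z‖ * (C * Real.exp (K * √‖z‖))) := by
          gcongr
          exact (hCK _).trans (by gcongr; exact hρn z hz)
      _ = C * (Real.exp ((|p.1| + K) * √‖z‖) * ‖decayMultiplier z‖) := by
          rw [add_mul, Real.exp_add]
          ring
      _ ≤ _ := by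
          rw [mul_assoc]
          gcongr

/-- An analytic branch of the roots of `a ρⁿ = -z` in a right half-plane. -/
theorem exists_root_branch {n : ℕ} (hn : 2 ≤ n) {a : ℂ} (ha : ‖a‖ = 1) :
    ∃ ρ : ℂ → ℂ, DifferentiableOn ℂ ρ {z | 1 ≤ z.re} ∧
      (∀ z : ℂ, 1 ≤ z.re → ‖ρ z‖ ≤ √‖z‖) ∧ ∀ z, a * ρ z ^ n = -z := by
  have hn0 : n ≠ 0 := by omega
  have ha0 : a ≠ 0 := norm_pos_iff.1 (by rw [ha]; exact one_pos)
  obtain ⟨κ, hκ⟩ := IsAlgClosed.exists_pow_nat_eq (-a⁻¹) (Nat.pos_of_ne_zero hn0)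
  have hroot : ∀ z, a * (κ * z ^ (n⁻¹ : ℂ)) ^ n = -z := fun z => by
    rw [mul_pow, hκ, Complex.cpow_nat_inv_pow z hn0]
    field_simp
  refine ⟨fun z => κ * z ^ (n⁻¹ : ℂ), fun z hz => ?_, fun z hz => ?_, hroot⟩
  · have hz' : z ∈ Complex.slitPlane := Or.inl (lt_of_lt_of_le one_pos hz)
    exact (((differentiableAt_id.cpow_const hz')).const_mul κ).differentiableWithinAt
  · have h := congrArg norm (hroot z)
    rw [norm_mul, ha, one_mul, norm_pow, norm_neg] at h
    refine le_of_pow_le_pow_left₀ hn0 (Real.sqrt_nonneg _) ?_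
    rw [h]
    -- Here n ≥ 2 and |z| ≥ 1 bound |z|^{1/n} by |z|^{1/2}, whose exponent lies below the 3/4 of the
    -- multiplier.
    calc ‖z‖ = √‖z‖ ^ 2 := (Real.sq_sqrt (norm_nonneg _)).symm
      _ ≤ _ := pow_le_pow_right₀ (Real.one_le_sqrt.2 (one_le_norm_of_one_le_re hz)) hn

namespace IBVP

variable {n : ℕ} {P : IBVP n}

/-! ### Nontrivial solutions of the homogeneous problem -/

/-- Orthogonality of the n-th roots of unity. The exponent n − r stands for −r, so that only natural
powers occur. -/
theorem sum_omega_pow (hn : 0 < n) (l r : Fin n) :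
    ∑ k : Fin n, omega n ^ ((k : ℕ) * (l + (n - r))) = if l = r then (n : ℂ) else 0 := by
  have hprim : IsPrimitiveRoot (omega n) n := Complex.isPrimitiveRoot_exp n hn.ne'
  set ζ := omega n ^ ((l : ℕ) + (n - r)) with hζ
  have hsum : ∑ k : Fin n, omega n ^ ((k : ℕ) * (l + (n - r))) = ∑ k ∈ Finset.range n, ζ ^ k := by
    rw [Finset.sum_range]
    exact Finset.sum_congr rfl fun k _ => by rw [hζ, ← pow_mul, mul_comm]
  have hone : ζ = 1 ↔ l = r := by
    rw [hζ, hprim.pow_eq_one_iff_dvd]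
    constructor
    · rintro ⟨m, hm⟩
      have h1 := l.2
      have h2 := r.2
      have hm1 : m = 1 := by
        rcases m with - | - | m
        · omega
        · rfl
        · rw [show n * (m + 1 + 1) = n * m + 2 * n by ring] at hm
          omega
      subst hm1
      exact Fin.ext (by omega)
    · rintro rfl
      exact ⟨1, by have := l.2; omega⟩
  rw [hsum]
  split_ifs with h
  · rw [hone.2 h]
    simp
  · have h1 := geom_sum_mul ζ n
    rw [show ζ ^ n = 1 by rw [hζ, ← pow_mul, mul_comm, pow_mul, omega_pow hn, one_pow], sub_self,
      mul_eq_zero] at h1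
    exact h1.resolve_right (sub_ne_zero.2 (mt hone.1 h))

/-- Inversion of a discrete Fourier transform. The combination of exponentials e^{iω^k zx} with
these coefficients has prescribed derivatives at x = 0, up to a factor that does not depend on the
order l. -/
theorem sum_pow_mul_c (P : IBVP n) (β : Fin n → ℂ) (z : ℂ) (l : Fin n) :
    ∑ k : Fin n, (Complex.I * omega n ^ (k : ℕ) * z) ^ (l : ℕ) *
      (omega n ^ (k : ℕ) * ∑ r, P.c r (omega n ^ (k : ℕ) * z) * β r) =
    -(n * P.a * Complex.I⁻¹) * (z ^ (n - 1) * β l) := by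
  have hterm : ∀ k r : Fin n, (Complex.I * omega n ^ (k : ℕ) * z) ^ (l : ℕ) *
      (omega n ^ (k : ℕ) * (P.c r (omega n ^ (k : ℕ) * z) * β r)) =
      (Complex.I ^ (l : ℕ) * z ^ (l : ℕ) * P.c r z * β r) *
        omega n ^ ((k : ℕ) * (l + (n - r))) := fun k r => by
    rw [c_omega, show (l : ℕ) + (n - r) = l + 1 + (n - 1 - r) by have := r.2; omega, mul_pow,
      mul_pow, Nat.mul_add, Nat.mul_add, pow_add, pow_add, mul_one, mul_comm (n - 1 - (r : ℕ)),
      pow_mul (omega n) (k : ℕ) (l : ℕ)]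
    ring
  simp only [Finset.mul_sum, hterm]
  rw [Finset.sum_comm]
  simp only [← Finset.mul_sum, sum_omega_pow P.n_pos, mul_ite, mul_zero]
  rw [Finset.sum_ite_eq Finset.univ l, if_pos (Finset.mem_univ l), c]
  have hl : (l : ℕ) + (n - (l + 1)) = n - 1 := by have := l.2; omega
  have hI : Complex.I ^ (l : ℕ) ≠ 0 := pow_ne_zero _ Complex.I_ne_zero
  rw [← hl, pow_succ]
  field_simp
  rw [pow_add]
  ring

theorem isExpType_c (P : IBVP n) (r : Fin n) (d : ℂ) : IsExpType fun z => P.c r (d * z) :=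
  ((IsExpType.id.const_mul d).pow _).const_mul _

theorem isExpType_charMatrix (P : IBVP n) (k j : Fin n) :
    IsExpType fun z => P.charMatrix z k j := by
  have he : IsExpType fun z => Complex.exp (-Complex.I * omega n ^ (k : ℕ) * z) :=
    IsExpType.cexp_mul _
  have hsum : ∀ (S : Finset (Fin n)) (row : S → Fin n), IsExpType fun z =>
      ∑ r : S, (P.Ahat (row r) j : ℂ) * P.c r (omega n ^ (k : ℕ) * z) := fun S row =>
    IsExpType.sum _ fun r _ => (P.isExpType_c r _).const_mul _
  simp only [charMatrix_apply]
  refine (IsExpType.sub ?_ (hsum _ _)).add (he.mul (hsum _ _))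
  split_ifs
  · exact P.isExpType_c _ _
  · exact (he.mul (P.isExpType_c _ _)).neg

/-- The coefficient of the `k`-th exponential in the solution of `φ⁽ⁿ⁾ = (iz)ⁿ φ` whose
derivatives at `0` are proportional to the `b (labelLeft r) z`. -/
noncomputable def homCoeff (P : IBVP n) (b : Fin (2 * n) → ℂ → ℂ) (k : Fin n) (z : ℂ) : ℂ :=
  omega n ^ (k : ℕ) * ∑ r, P.c r (omega n ^ (k : ℕ) * z) * b (labelLeft r) z

/-- The `l`-th `x`-derivative of a superposition of separated solutions of the homogeneous
equation. -/
noncomputable def homDeriv (P : IBVP n) (b : Fin (2 * n) → ℂ → ℂ) (ρ : ℂ → ℂ) (l : ℕ)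
    (x t : ℝ) : ℂ :=
  ∑ k : Fin n, expIntegral (fun y => 1 + y * Complex.I)
    (fun y => Complex.I * omega n ^ (k : ℕ) * ρ (1 + y * Complex.I))
    (fun y => decayMultiplier (1 + y * Complex.I) *
      ((Complex.I * omega n ^ (k : ℕ) * ρ (1 + y * Complex.I)) ^ l *
        P.homCoeff b k (ρ (1 + y * Complex.I)))) (x, t)

/-- The boundary values of the superposition with coefficient function `β`. -/
noncomputable def boundaryLaplace (P : IBVP n) (ρ β : ℂ → ℂ) (t : ℝ) : ℂ :=
  expIntegral (fun y => 1 + y * Complex.I) (fun _ => 0)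
    (fun y => decayMultiplier (1 + y * Complex.I) * (-(n * P.a * Complex.I⁻¹) *
      (ρ (1 + y * Complex.I) ^ (n - 1) * β (ρ (1 + y * Complex.I))))) (0, t)

theorem norm_I_mul_omega_pow (n k : ℕ) : ‖Complex.I * omega n ^ k‖ = 1 := by
  have : omega n = Complex.exp (((2 * Real.pi / n : ℝ) : ℂ) * Complex.I) := by
    rw [omega]
    push_cast
    ring_nf
  rw [norm_mul, Complex.norm_I, norm_pow, this, Complex.norm_exp_ofReal_mul_I, one_pow, one_mul]

theorem isExpType_homCoeff {b : Fin (2 * n) → ℂ → ℂ} (hb : ∀ l, IsExpType (b l)) (k : Fin n)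
    (l : ℕ) : IsExpType fun z =>
      (Complex.I * omega n ^ (k : ℕ) * z) ^ l * P.homCoeff b k z :=
  ((IsExpType.id.const_mul _).pow l).mul
    ((IsExpType.sum _ fun r _ => (P.isExpType_c r _).mul (hb _)).const_mul _)

theorem two_mul_sqrt_norm_bounds (y : ℝ) :
    |((1 : ℂ) + y * Complex.I).re| ≤ 2 * √‖1 + y * Complex.I‖ ∧
      ‖(1 : ℂ) + y * Complex.I‖ ≤ Real.exp (2 * √‖1 + y * Complex.I‖) := by
  have h1 : 1 ≤ ‖(1 : ℂ) + y * Complex.I‖ :=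
    one_le_norm_of_one_le_re (one_add_mul_I_re y).ge
  have h2 := Real.one_le_sqrt.2 h1
  refine ⟨by rw [one_add_mul_I_re, abs_one]; linarith, ?_⟩
  set s := √‖(1 : ℂ) + y * Complex.I‖
  calc ‖(1 : ℂ) + y * Complex.I‖ = s * s := (Real.mul_self_sqrt (norm_nonneg _)).symm
    _ ≤ Real.exp s * Real.exp s := by
      have := Real.add_one_le_exp s
      gcongr <;> linarith
    _ = _ := by rw [← Real.exp_add, two_mul]

section

variable {ρ : ℂ → ℂ}

theorem continuous_exponent (hρ : DifferentiableOn ℂ ρ {z | 1 ≤ z.re}) (d : ℂ) :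
    Continuous fun y : ℝ => d * ρ (1 + y * Complex.I) :=
  continuous_const.mul (hρ.continuousOn.comp_continuous (by fun_prop)
    fun y => (one_add_mul_I_re y).ge)

theorem norm_exponent_le (hρn : ∀ z : ℂ, 1 ≤ z.re → ‖ρ z‖ ≤ √‖z‖) {d : ℂ} (hd : ‖d‖ ≤ 1)
    (y : ℝ) : ‖d * ρ (1 + y * Complex.I)‖ ≤ 2 * √‖1 + y * Complex.I‖ := by
  rw [norm_mul]
  refine (mul_le_of_le_one_left (norm_nonneg _) hd).trans ((hρn _ (one_add_mul_I_re y).ge).trans ?_)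
  linarith [Real.sqrt_nonneg ‖(1 : ℂ) + y * Complex.I‖]

theorem integrable_homIntegrand (hρ : DifferentiableOn ℂ ρ {z | 1 ≤ z.re})
    (hρn : ∀ z : ℂ, 1 ≤ z.re → ‖ρ z‖ ≤ √‖z‖) {B : ℂ → ℂ} (hB : IsExpType B) {d : ℂ}
    (hd : ‖d‖ ≤ 1) (p : ℝ × ℝ) : MeasureTheory.Integrable fun y : ℝ =>
      Complex.exp ((1 + y * Complex.I) * p.2 + d * ρ (1 + y * Complex.I) * p.1) *
        (decayMultiplier (1 + y * Complex.I) * B (ρ (1 + y * Complex.I))) :=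
  integrable_expIntegrand (by fun_prop) (continuous_exponent hρ d) (hB.expDecay hρ hρn)
    (fun y => (two_mul_sqrt_norm_bounds y).1)
    (fun y => (Complex.abs_re_le_norm _).trans (norm_exponent_le hρn hd y)) p

theorem contDiff_homDeriv {b : Fin (2 * n) → ℂ → ℂ} (hb : ∀ l, IsExpType (b l))
    (hρ : DifferentiableOn ℂ ρ {z | 1 ≤ z.re}) (hρn : ∀ z : ℂ, 1 ≤ z.re → ‖ρ z‖ ≤ √‖z‖)
    (l : ℕ) : ContDiff ℝ ∞ fun p : ℝ × ℝ => P.homDeriv b ρ l p.1 p.2 := by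
  refine ContDiff.sum fun k _ => contDiff_expIntegral (by fun_prop) (by fun_prop)
    (continuous_exponent hρ _) ((isExpType_homCoeff hb k l).expDecay hρ hρn)
    (fun y => (two_mul_sqrt_norm_bounds y).1) (fun y => ?_)
    (fun y => (two_mul_sqrt_norm_bounds y).2) fun y => ?_
  · exact (Complex.abs_re_le_norm _).trans
      (norm_exponent_le hρn (norm_I_mul_omega_pow n k).le y)
  · refine (norm_exponent_le hρn (norm_I_mul_omega_pow n k).le y).trans ?_
    linarith [Real.add_one_le_exp (2 * √‖(1 : ℂ) + y * Complex.I‖)]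

theorem hasDerivAt_homDeriv_left {b : Fin (2 * n) → ℂ → ℂ} (hb : ∀ l, IsExpType (b l))
    (hρ : DifferentiableOn ℂ ρ {z | 1 ≤ z.re}) (hρn : ∀ z : ℂ, 1 ≤ z.re → ‖ρ z‖ ≤ √‖z‖)
    (l : ℕ) (x t : ℝ) :
    HasDerivAt (fun x => P.homDeriv b ρ l x t) (P.homDeriv b ρ (l + 1) x t) x := by
  refine HasDerivAt.fun_sum fun k _ => ?_
  have h := hasDerivAt_expIntegral_left (μ := fun y : ℝ => 1 + y * Complex.I) (by fun_prop)
    (by fun_prop)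
    (continuous_exponent hρ (Complex.I * omega n ^ (k : ℕ)))
    ((isExpType_homCoeff (P := P) hb k l).expDecay hρ hρn)
    (fun y => (two_mul_sqrt_norm_bounds y).1)
    (fun y => (Complex.abs_re_le_norm _).trans
      (norm_exponent_le hρn (norm_I_mul_omega_pow n k).le y))
    (fun y => (two_mul_sqrt_norm_bounds y).2)
    (fun y => (norm_exponent_le hρn (norm_I_mul_omega_pow n k).le y).trans
      (by linarith [Real.add_one_le_exp (2 * √‖(1 : ℂ) + y * Complex.I‖)])) x t
  refine h.congr_deriv ?_
  congr 1
  funext y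
  ring

/-- Each separated solution has time exponent z and spatial exponent iω^kρ(z); the equation reduces
to aρ(z)ⁿ = −z, as ωⁿ = 1 and (−i)ⁿiⁿ = 1. -/
theorem hasDerivAt_homDeriv_right {b : Fin (2 * n) → ℂ → ℂ} (hb : ∀ l, IsExpType (b l))
    (hρ : DifferentiableOn ℂ ρ {z | 1 ≤ z.re}) (hρn : ∀ z : ℂ, 1 ≤ z.re → ‖ρ z‖ ≤ √‖z‖)
    (hroot : ∀ z, P.a * ρ z ^ n = -z) (x t : ℝ) :
    HasDerivAt (fun t => P.homDeriv b ρ 0 x t)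
      (-(P.a * ((-Complex.I) ^ n * P.homDeriv b ρ n x t))) t := by
  rw [homDeriv, Finset.mul_sum, Finset.mul_sum, ← Finset.sum_neg_distrib]
  refine HasDerivAt.fun_sum fun k _ => ?_
  have h := hasDerivAt_expIntegral_right (μ := fun y : ℝ => 1 + y * Complex.I) (by fun_prop)
    (by fun_prop)
    (continuous_exponent hρ (Complex.I * omega n ^ (k : ℕ)))
    ((isExpType_homCoeff (P := P) hb k 0).expDecay hρ hρn)
    (fun y => (two_mul_sqrt_norm_bounds y).1)
    (fun y => (Complex.abs_re_le_norm _).trans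
      (norm_exponent_le hρn (norm_I_mul_omega_pow n k).le y))
    (fun y => (two_mul_sqrt_norm_bounds y).2)
    (fun y => (norm_exponent_le hρn (norm_I_mul_omega_pow n k).le y).trans
      (by linarith [Real.add_one_le_exp (2 * √‖(1 : ℂ) + y * Complex.I‖)])) x t
  refine h.congr_deriv ?_
  simp only [expIntegral]
  rw [← mul_assoc, ← neg_mul, ← MeasureTheory.integral_const_mul]
  congr 1
  funext y
  have hI : (-Complex.I) ^ n * Complex.I ^ n = 1 := by
    rw [← mul_pow, neg_mul, Complex.I_mul_I, neg_neg, one_pow]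
  have h1 : (Complex.I * omega n ^ (k : ℕ) * ρ (1 + y * Complex.I)) ^ n =
      Complex.I ^ n * ρ (1 + y * Complex.I) ^ n := by
    rw [mul_assoc, mul_pow, omega_pow_mul_pow P.n_pos]
  have h2 := hroot (1 + y * Complex.I)
  rw [h1, pow_zero]
  set z : ℂ := 1 + y * Complex.I
  set E := Complex.exp (z * t + Complex.I * omega n ^ (k : ℕ) * ρ z * x)
  linear_combination (E * decayMultiplier z * P.homCoeff b k (ρ z)) *
    (P.a * ρ z ^ n * hI + h2)

theorem dx_homDeriv {b : Fin (2 * n) → ℂ → ℂ} (hb : ∀ l, IsExpType (b l))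
    (hρ : DifferentiableOn ℂ ρ {z | 1 ≤ z.re}) (hρn : ∀ z : ℂ, 1 ≤ z.re → ‖ρ z‖ ≤ √‖z‖)
    (l : ℕ) {x : ℝ} (hx : x ∈ Set.Icc (0 : ℝ) 1) (t : ℝ) :
    dx l (P.homDeriv b ρ 0) x t = P.homDeriv b ρ l x t := by
  induction l generalizing x with
  | zero => rw [dx_zero]
  | succ l ih =>
    rw [dx_succ, derivWithin_congr (fun y hy => ih hy) (ih hx)]
    exact (hasDerivAt_homDeriv_left hb hρ hρn l x t).hasDerivWithinAt.derivWithin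
      (uniqueDiffOn_Icc one_pos x hx)

theorem homDeriv_left {b : Fin (2 * n) → ℂ → ℂ} (hb : ∀ l, IsExpType (b l))
    (hρ : DifferentiableOn ℂ ρ {z | 1 ≤ z.re}) (hρn : ∀ z : ℂ, 1 ≤ z.re → ‖ρ z‖ ≤ √‖z‖)
    (l : Fin n) (t : ℝ) :
    P.homDeriv b ρ l 0 t = P.boundaryLaplace ρ (b (labelLeft l)) t := by
  simp only [homDeriv, boundaryLaplace, expIntegral]
  rw [← MeasureTheory.integral_finsetSum _ fun k _ => integrable_homIntegrand hρ hρn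
    (isExpType_homCoeff (P := P) hb k l) (norm_I_mul_omega_pow n k).le (0, t)]
  congr 1
  funext y
  rw [← P.sum_pow_mul_c (fun r => b (labelLeft r) (ρ (1 + y * Complex.I)))]
  simp only [homCoeff, Finset.mul_sum, Complex.ofReal_zero, mul_zero]

/-- The relation `hrel` says that moving from x = 0 to x = 1, which multiplies the k-th coefficient
by e^{iω^k z}, merely replaces left boundary values by right ones. Inversion as at x = 0 then
applies. -/
theorem homDeriv_right {b : Fin (2 * n) → ℂ → ℂ} (hb : ∀ l, IsExpType (b l))
    (hrel : ∀ z, ∀ k : Fin n, ∑ r, P.c r (omega n ^ (k : ℕ) * z) * (b (labelLeft r) z -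
      Complex.exp (-Complex.I * omega n ^ (k : ℕ) * z) * b (labelRight r) z) = 0)
    (hρ : DifferentiableOn ℂ ρ {z | 1 ≤ z.re}) (hρn : ∀ z : ℂ, 1 ≤ z.re → ‖ρ z‖ ≤ √‖z‖)
    (l : Fin n) (t : ℝ) :
    P.homDeriv b ρ l 1 t = P.boundaryLaplace ρ (b (labelRight l)) t := by
  simp only [homDeriv, boundaryLaplace, expIntegral]
  rw [← MeasureTheory.integral_finsetSum _ fun k _ => integrable_homIntegrand hρ hρn
    (isExpType_homCoeff (P := P) hb k l) (norm_I_mul_omega_pow n k).le (1, t)]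
  congr 1
  funext y
  set z := ρ (1 + y * Complex.I)
  rw [← P.sum_pow_mul_c (fun r => b (labelRight r) z), Finset.mul_sum, Finset.mul_sum]
  refine Finset.sum_congr rfl fun k _ => ?_
  have h1 : ∑ r, P.c r (omega n ^ (k : ℕ) * z) * b (labelLeft r) z =
      Complex.exp (-Complex.I * omega n ^ (k : ℕ) * z) *
        ∑ r, P.c r (omega n ^ (k : ℕ) * z) * b (labelRight r) z := by
    rw [← sub_eq_zero, ← hrel z k, Finset.mul_sum, ← Finset.sum_sub_distrib]
    exact Finset.sum_congr rfl fun r _ => by ring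
  have h2 : Complex.exp (Complex.I * omega n ^ (k : ℕ) * z) *
      Complex.exp (-Complex.I * omega n ^ (k : ℕ) * z) = 1 := by
    rw [← Complex.exp_add, ← Complex.exp_zero]
    ring_nf
  rw [homCoeff, h1, Complex.ofReal_one, mul_one, Complex.exp_add, zero_mul, add_zero]
  set S := ∑ r, P.c r (omega n ^ (k : ℕ) * z) * b (labelRight r) z
  linear_combination (Complex.exp ((1 + y * Complex.I) * t) *
    decayMultiplier (1 + y * Complex.I) * (Complex.I * omega n ^ (k : ℕ) * z) ^ (l : ℕ) *
    omega n ^ (k : ℕ) * S) * h2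

theorem isExpType_boundary (P : IBVP n) {β : ℂ → ℂ} (hβ : IsExpType β) :
    IsExpType fun z => -(n * P.a * Complex.I⁻¹) * (z ^ (n - 1) * β z) :=
  ((IsExpType.id.pow _).mul hβ).const_mul _

theorem integrable_boundaryLaplace {β : ℂ → ℂ} (hβ : IsExpType β)
    (hρ : DifferentiableOn ℂ ρ {z | 1 ≤ z.re}) (hρn : ∀ z : ℂ, 1 ≤ z.re → ‖ρ z‖ ≤ √‖z‖)
    (t : ℝ) : MeasureTheory.Integrable fun y : ℝ =>
      Complex.exp ((1 + y * Complex.I) * t) * (decayMultiplier (1 + y * Complex.I) *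
        (-(n * P.a * Complex.I⁻¹) *
          (ρ (1 + y * Complex.I) ^ (n - 1) * β (ρ (1 + y * Complex.I))))) := by
  simpa using integrable_homIntegrand hρ hρn (P.isExpType_boundary hβ)
    (d := 0) (by simp) (0, t)

theorem boundaryLaplace_relation {b : Fin (2 * n) → ℂ → ℂ} (hb : ∀ l, IsExpType (b l))
    (hbJ : ∀ z k, b (P.J'seq k) z + ∑ j, P.Ahat k j * b (P.Jseq j) z = 0)
    (hρ : DifferentiableOn ℂ ρ {z | 1 ≤ z.re}) (hρn : ∀ z : ℂ, 1 ≤ z.re → ‖ρ z‖ ≤ √‖z‖)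
    (t : ℝ) (k : Fin n) :
    P.boundaryLaplace ρ (b (P.J'seq k)) t +
      ∑ j, P.Ahat k j * P.boundaryLaplace ρ (b (P.Jseq j)) t = 0 := by
  have hi : ∀ l, MeasureTheory.Integrable fun y : ℝ =>
      Complex.exp ((1 + y * Complex.I) * t) * (decayMultiplier (1 + y * Complex.I) *
        (-(n * P.a * Complex.I⁻¹) *
          (ρ (1 + y * Complex.I) ^ (n - 1) * b l (ρ (1 + y * Complex.I))))) := fun l =>
    integrable_boundaryLaplace (hb l) hρ hρn t
  simp only [boundaryLaplace, expIntegral, zero_mul, add_zero]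
  simp only [← MeasureTheory.integral_const_mul]
  rw [← MeasureTheory.integral_finsetSum _ fun j _ => (hi _).const_mul _,
    ← MeasureTheory.integral_add (hi _)
      (MeasureTheory.integrable_finsetSum _ fun j _ => (hi _).const_mul _)]
  refine MeasureTheory.integral_eq_zero_of_ae (Filter.Eventually.of_forall fun y => ?_)
  have h := hbJ (ρ (1 + y * Complex.I)) k
  beta_reduce
  set z := ρ (1 + y * Complex.I)
  have h' : ∀ j, (P.Ahat k j : ℂ) * (Complex.exp ((1 + y * Complex.I) * t) *
      (decayMultiplier (1 + y * Complex.I) *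
        (-(n * P.a * Complex.I⁻¹) * (z ^ (n - 1) * b (P.Jseq j) z)))) =
      (Complex.exp ((1 + y * Complex.I) * t) * (decayMultiplier (1 + y * Complex.I) *
        (-(n * P.a * Complex.I⁻¹) * z ^ (n - 1)))) * (P.Ahat k j * b (P.Jseq j) z) :=
    fun j => by ring
  rw [Pi.zero_apply, Finset.sum_congr rfl fun j _ => h' j, ← Finset.mul_sum]
  linear_combination (Complex.exp ((1 + y * Complex.I) * t) *
    (decayMultiplier (1 + y * Complex.I) * (-(n * P.a * Complex.I⁻¹) * z ^ (n - 1)))) * h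

theorem homDeriv_eq_zero_of_nonpos {b : Fin (2 * n) → ℂ → ℂ} (hb : ∀ l, IsExpType (b l))
    (hρ : DifferentiableOn ℂ ρ {z | 1 ≤ z.re}) (hρn : ∀ z : ℂ, 1 ≤ z.re → ‖ρ z‖ ≤ √‖z‖)
    (l : ℕ) (x : ℝ) {t : ℝ} (ht : t ≤ 0) : P.homDeriv b ρ l x t = 0 :=
  Finset.sum_eq_zero fun k _ => (isExpType_homCoeff hb k l).expIntegral_eq_zero hρ hρn
    (norm_I_mul_omega_pow n k).le ht

end

end IBVP

/-- The Fourier transform vanishes, hence is integrable, and the inversion formula recovers the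
continuous function G as 0. -/
theorem eq_zero_of_forall_integral_cexp_eq_zero {G : ℝ → ℂ} (hc : Continuous G)
    (hi : MeasureTheory.Integrable G)
    (h : ∀ t : ℝ, ∫ y : ℝ, Complex.exp (y * Complex.I * t) * G y = 0) : G = 0 := by
  have hF : FourierTransform.fourier G = 0 := funext fun w => by
    rw [Real.fourier_real_eq_integral_exp_smul, Pi.zero_apply, ← h (-2 * Real.pi * w)]
    congr 1
    funext y
    rw [smul_eq_mul]
    push_cast
    ring_nf
  have h1 := hc.fourierInv_fourier_eq hi (by rw [hF]; exact MeasureTheory.integrable_zero _ _ _)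
  rw [hF] at h1
  rw [← h1]
  funext w
  rw [Real.fourierInv_eq']
  simp

namespace IBVP

variable {n : ℕ} {P : IBVP n}

/-! ### Well-posedness excludes an identically vanishing determinant -/

/-- Uniqueness is available only for the given data, so the homogeneous solution is added to the
solution that exists. -/
theorem WellPosed.eq_zero (hP : P.WellPosed) {v : ℝ → ℝ → ℂ}
    (hv : ContDiffOn ℝ ∞ (fun p : ℝ × ℝ => v p.1 p.2) (Set.Icc 0 1 ×ˢ Set.Icc 0 P.T))
    (hpde : ∀ x ∈ Set.Icc (0 : ℝ) 1, ∀ t ∈ Set.Icc 0 P.T,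
      HasDerivWithinAt (fun s => v x s) (-(P.a * ((-Complex.I) ^ n * dx n v x t)))
        (Set.Icc 0 P.T) t)
    (hinit : ∀ x ∈ Set.Icc (0 : ℝ) 1, v x 0 = 0)
    (hbdry : ∀ t ∈ Set.Icc 0 P.T, (P.A.map Complex.ofReal).mulVec
      (boundaryVector (fun j => dx j v 0 t) (fun j => dx j v 1 t)) = 0)
    {x t : ℝ} (hx : x ∈ Set.Icc (0 : ℝ) 1) (ht : t ∈ Set.Icc 0 P.T) : v x t = 0 := by
  obtain ⟨⟨q, hq⟩, huniq⟩ := hP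
  have hdx : ∀ (j : ℕ), ∀ x ∈ Set.Icc (0 : ℝ) 1, ∀ t ∈ Set.Icc 0 P.T,
      dx j (fun x t => q x t + v x t) x t = dx j q x t + dx j v x t := fun j x hx t ht => by
    have hslice : ∀ w : ℝ → ℝ → ℂ, ContDiffOn ℝ ∞ (fun p : ℝ × ℝ => w p.1 p.2)
        (Set.Icc 0 1 ×ˢ Set.Icc 0 P.T) → ContDiffWithinAt ℝ j (fun y => w y t) (Set.Icc 0 1) x :=
      fun w hw => ((hw.comp (contDiff_id.prodMk contDiff_const).contDiffOn
        fun _ hy => ⟨hy, ht⟩ : ContDiffOn ℝ ∞ (fun y => w y t) (Set.Icc 0 1)) x hx).of_le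
        (by exact_mod_cast le_top)
    exact iteratedDerivWithin_add hx (uniqueDiffOn_Icc one_pos) (hslice q hq.smooth) (hslice v hv)
  have hsum : P.IsSolution fun x t => q x t + v x t := by
    refine ⟨hq.smooth.add hv, fun x hx t ht => ?_, fun x hx => ?_, fun t ht => ?_⟩
    · rw [((hq.hasDerivWithinAt_time hx ht).fun_add (hpde x hx t ht)).derivWithin
        (uniqueDiffOn_Icc P.T_pos t ht), hdx n x hx t ht]
      ring
    · rw [hinit x hx, add_zero, hq.initial x hx]
    · rw [← hq.boundary t ht, ← add_zero ((P.A.map Complex.ofReal).mulVec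
        (boundaryVector (fun j => dx j q 0 t) (fun j => dx j q 1 t))), ← hbdry t ht,
        ← Matrix.mulVec_add]
      congr 1
      funext c
      simp only [boundaryVector, Pi.add_apply, hdx _ 0 ⟨le_rfl, zero_le_one⟩ t ht,
        hdx _ 1 ⟨zero_le_one, le_rfl⟩ t ht]
      split_ifs <;> rfl
  have := huniq _ _ hsum hq x hx t ht
  simpa using this

section

variable {b : Fin (2 * n) → ℂ → ℂ} {ρ : ℂ → ℂ}

/-- The superposition vanishes for t ≤ 0 and solves the homogeneous problem for all times.
Translating time by multiples of T, vanishing up to mT supplies zero initial data for the next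
interval of length T. -/
theorem WellPosed.homDeriv_eq_zero (hP : P.WellPosed) (hb : ∀ l, IsExpType (b l))
    (hrel : ∀ z, ∀ k : Fin n, ∑ r, P.c r (omega n ^ (k : ℕ) * z) * (b (labelLeft r) z -
      Complex.exp (-Complex.I * omega n ^ (k : ℕ) * z) * b (labelRight r) z) = 0)
    (hbJ : ∀ z k, b (P.J'seq k) z + ∑ j, P.Ahat k j * b (P.Jseq j) z = 0)
    (hρ : DifferentiableOn ℂ ρ {z | 1 ≤ z.re}) (hρn : ∀ z : ℂ, 1 ≤ z.re → ‖ρ z‖ ≤ √‖z‖)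
    (hroot : ∀ z, P.a * ρ z ^ n = -z) (l : ℕ) {x : ℝ} (hx : x ∈ Set.Icc (0 : ℝ) 1) (t : ℝ) :
    P.homDeriv b ρ l x t = 0 := by
  have key : ∀ m : ℕ, ∀ x ∈ Set.Icc (0 : ℝ) 1, ∀ t ≤ m * P.T, P.homDeriv b ρ 0 x t = 0 := by
    intro m
    induction m with
    | zero =>
      intro x _ t ht
      exact homDeriv_eq_zero_of_nonpos hb hρ hρn 0 x (by simpa using ht)
    | succ m ih =>
      intro x hx t ht
      rcases le_or_gt t (m * P.T) with h | h
      · exact ih x hx t h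
      have hdx : ∀ l : ℕ, ∀ x ∈ Set.Icc (0 : ℝ) 1, ∀ s,
          dx l (fun x s => P.homDeriv b ρ 0 x (s + m * P.T)) x s =
            P.homDeriv b ρ l x (s + m * P.T) := fun l x hx s =>
        dx_homDeriv hb hρ hρn l hx (s + m * P.T)
      have := hP.eq_zero (v := fun x s => P.homDeriv b ρ 0 x (s + m * P.T)) ?_ ?_ ?_ ?_ hx
        (t := t - m * P.T) ⟨by linarith, by push_cast at ht; linarith⟩
      · simpa using this
      · exact ((contDiff_homDeriv hb hρ hρn 0).comp
          (contDiff_fst.prodMk (contDiff_snd.add contDiff_const))).contDiffOn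
      · intro x hx s _
        rw [hdx n x hx s]
        exact ((hasDerivAt_homDeriv_right hb hρ hρn hroot x
          (s + m * P.T)).comp_add_const s (m * P.T)).hasDerivWithinAt
      · intro x hx
        exact ih x hx _ (by simp)
      · intro s _
        simp only [hdx _ 0 ⟨le_rfl, zero_le_one⟩ s, hdx _ 1 ⟨zero_le_one, le_rfl⟩ s,
          homDeriv_left hb hρ hρn, homDeriv_right hb hrel hρ hρn]
        exact (P.mulVec_boundaryVector_eq_iff
          (fun l => P.boundaryLaplace ρ (b l) (s + m * P.T)) 0).2
          (boundaryLaplace_relation hb hbJ hρ hρn _)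
  have h0 : ∀ y ∈ Set.Icc (0 : ℝ) 1, P.homDeriv b ρ 0 y t = 0 := fun y hy => by
    obtain ⟨m, hm⟩ := exists_nat_ge (t / P.T)
    exact key m y hy t ((div_le_iff₀ P.T_pos).1 hm)
  rw [← dx_homDeriv hb hρ hρn l hx t, dx, iteratedDerivWithin_congr (g := fun _ => 0) h0 hx]
  simp

end

/-- The Laplace transform determines the coefficient function. -/
theorem eq_zero_of_boundaryLaplace_eq_zero (P : IBVP n) {β ρ : ℂ → ℂ} (hβ : IsExpType β)
    (hρ : DifferentiableOn ℂ ρ {z | 1 ≤ z.re}) (hρn : ∀ z : ℂ, 1 ≤ z.re → ‖ρ z‖ ≤ √‖z‖)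
    (hroot : ∀ z, P.a * ρ z ^ n = -z) (h : ∀ t, P.boundaryLaplace ρ β t = 0) (z : ℂ) :
    β z = 0 := by
  have ha : P.a ≠ 0 := norm_pos_iff.1 (by rw [norm_a]; exact one_pos)
  have hn : (n : ℂ) ≠ 0 := by exact_mod_cast P.n_pos.ne'
  have hG := eq_zero_of_forall_integral_cexp_eq_zero
    ((P.isExpType_boundary hβ).expDecay hρ hρn).continuous
    (by simpa using integrable_boundaryLaplace (P := P) hβ hρ hρn 0) fun t => by
      have h1 := h t
      simp only [boundaryLaplace, expIntegral, zero_mul, add_zero, add_mul, one_mul,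
        Complex.exp_add, mul_assoc (Complex.exp t)] at h1
      rw [MeasureTheory.integral_const_mul] at h1
      exact (mul_eq_zero.1 h1).resolve_left (Complex.exp_ne_zero _)
  -- Inverting the Laplace integral shows that β vanishes at ρ(1+iy) for every real y. These points
  -- are distinct because ρ is a branch of a root, so β would have uncountably many zeros.
  by_contra hz
  have hcount := hβ.differentiable.countable_zeros ⟨z, hz⟩
  have hinj : Function.Injective fun y : ℝ => ρ (1 + y * Complex.I) := fun y y' hyy => by
    have h1 := hroot (1 + y * Complex.I)
    simp only at hyy
    rw [hyy, hroot] at h1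
    have h2 := mul_right_cancel₀ Complex.I_ne_zero (add_left_cancel (neg_injective h1))
    exact (Complex.ofReal_injective h2).symm
  refine Cardinal.not_countable_real ((hcount.preimage hinj).mono fun y _ => ?_)
  have hy := congrFun hG y
  have hρ0 : ρ (1 + y * Complex.I) ≠ 0 := fun h0 => by
    have h1 := congrArg Complex.re (hroot (1 + y * Complex.I))
    rw [h0, zero_pow P.n_pos.ne', mul_zero, Complex.neg_re, one_add_mul_I_re] at h1
    norm_num at h1
  have h2 := (mul_eq_zero.1 hy).resolve_left (decayMultiplier_ne_zero _)
  have h3 : -((n : ℂ) * P.a * Complex.I⁻¹) ≠ 0 :=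
    neg_ne_zero.2 (mul_ne_zero (mul_ne_zero hn ha) (inv_ne_zero Complex.I_ne_zero))
  exact (mul_eq_zero.1 ((mul_eq_zero.1 h2).resolve_left h3)).resolve_left (pow_ne_zero _ hρ0)

theorem Jseq_injective (P : IBVP n) : Function.Injective P.Jseq :=
  (P.J.orderEmbOfFin P.card_J).injective.comp Fin.rev_injective

theorem J'seq_injective (P : IBVP n) : Function.Injective P.J'seq :=
  (P.J'.orderEmbOfFin P.card_J').injective.comp Fin.rev_injective

theorem Jseq_ne_J'seq (P : IBVP n) (j k : Fin n) : P.Jseq j ≠ P.J'seq k := fun h => by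
  have h1 : P.Jseq j ∈ P.J := Finset.orderEmbOfFin_mem _ _ _
  rw [h, J_eq_compl, Finset.mem_compl] at h1
  exact h1 (Finset.orderEmbOfFin_mem _ _ _)

/-- The characteristic determinant of a well-posed problem is not identically zero. -/
theorem WellPosed.exists_DeltaP_ne_zero (hP : P.WellPosed) : ∃ ρ, P.DeltaP ρ ≠ 0 := by
  by_contra! hdet
  obtain ⟨X, hX, ⟨j₀, z₀, hX0⟩, hker⟩ :=
    exists_isExpType_mulVec_eq_zero P.isExpType_charMatrix hdet
  obtain ⟨ρ, hρ, hρn, hroot⟩ := exists_root_branch P.two_le P.norm_a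
  -- Extends the kernel vector to all labels: its own entries at the labels without pivot, and at
  -- the pivot labels the values dictated by the homogeneous boundary conditions.
  let b : Fin (2 * n) → ℂ → ℂ := fun l z => ∑ j, ((if P.Jseq j = l then 1 else 0) * X j z +
    (if P.J'seq j = l then 1 else 0) * -∑ i, P.Ahat j i * X i z)
  have hb : ∀ l, IsExpType (b l) := fun l => IsExpType.sum _ fun j _ =>
    ((hX j).const_mul _).add
      ((IsExpType.sum _ fun i _ => (hX i).const_mul _).neg.const_mul _)
  have hbJ : ∀ j z, b (P.Jseq j) z = X j z := fun j z => by
    simp [b, P.Jseq_injective.eq_iff, (P.Jseq_ne_J'seq _ _).symm]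
  have hbJ' : ∀ z k, b (P.J'seq k) z + ∑ j, P.Ahat k j * b (P.Jseq j) z = 0 := fun z k => by
    have : b (P.J'seq k) z = -∑ i, P.Ahat k i * X i z := by
      simp [b, P.J'seq_injective.eq_iff, P.Jseq_ne_J'seq]
    simp only [this, hbJ, neg_add_cancel]
  have hrel : ∀ z, ∀ k : Fin n, ∑ r, P.c r (omega n ^ (k : ℕ) * z) * (b (labelLeft r) z -
      Complex.exp (-Complex.I * omega n ^ (k : ℕ) * z) * b (labelRight r) z) = 0 := fun z k => by
    have h := P.charMatrix_mulVec (fun l => b l z) 0 (hbJ' z) z k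
    simp only [hbJ, hker, Pi.zero_apply, mul_zero, Finset.sum_const_zero, sub_zero,
      add_zero] at h
    exact h.symm
  refine hX0 ?_
  rw [← hbJ]
  refine P.eq_zero_of_boundaryLaplace_eq_zero (hb _) hρ hρn hroot (fun t => ?_) z₀
  -- The nonzero component is read off at the end of [0,1] to which its label belongs, where its
  -- Laplace integral is a boundary derivative of the vanishing solution.
  rcases label_cases (P.Jseq j₀) with ⟨l, hl⟩ | ⟨l, hl⟩
  · rw [hl, ← homDeriv_left hb hρ hρn]
    exact hP.homDeriv_eq_zero hb hrel hbJ' hρ hρn hroot l ⟨le_rfl, zero_le_one⟩ t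
  · rw [hl, ← homDeriv_right hb hrel hρ hρn]
    exact hP.homDeriv_eq_zero hb hrel hbJ' hρ hρn hroot l ⟨zero_le_one, le_rfl⟩ t

end IBVP

/-! ### The integral representation for well-posed problems -/

theorem mainTheorem2 {n : ℕ} (P : IBVP n) (hP : P.WellPosed) (q : ℝ → ℝ → ℂ)
    (hq : P.IsSolution q) :
    (∃ ρ, P.DeltaP ρ ≠ 0) ∧
    ∀ x ∈ Set.Icc (0 : ℝ) 1, ∀ t ∈ Set.Icc 0 P.T,
      (x ∈ Set.Ioo (0 : ℝ) 1 ∨ t ∈ Set.Ioo 0 P.T) →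
      ∃ I₀ IPlus IMinus : ℂ,
        IBVP.HasLineIntegral (fun ρ =>
          Complex.exp (Complex.I * ρ * x - P.a * ρ ^ n * t) * IBVP.fourierTransform P.q₀ ρ) I₀ ∧
        P.HasBoundaryIntegral P.DPlus (fun ρ =>
          Complex.exp (Complex.I * ρ * x - P.a * ρ ^ n * t) * P.integrandSum q P.JPlus ρ) IPlus ∧
        P.HasBoundaryIntegral P.DMinus (fun ρ =>
          Complex.exp (Complex.I * ρ * (x - 1) - P.a * ρ ^ n * t) *
            P.integrandSum q P.JMinus ρ) IMinus ∧
        2 * Real.pi * q x t = I₀ - IPlus - IMinus :=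
  ⟨hP.exists_DeltaP_ne_zero, fun _ hx _ ht hxt =>
    hq.hasIntegrals hP.exists_DeltaP_ne_zero hx ht hxt⟩
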